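/- **Setting.** Forms are linear in the first and antilinear in the second argument, and $\mathfrak b[u]:=\mathfrak b(u,u)$. Let $H$ be a separable complex Hilbert space, $n\ge1$, $\Theta\subset\mathbb R^n$ compact and connected with $0$ in its interior. Let $a_\theta,b_\theta$ ($\theta\in\Theta$) be non‑negative sesquilinear forms on $H$ such that $(u,\tilde u)_\theta:=a_\theta(u,\tilde u)+b_\theta(u,\tilde u)$ are uniformly equivalent inner products of $H$ (for the norms $\|\cdot\|_\theta$ there is $K>0$ with $\|u\|_{\theta_1}\le K\|u\|_{\theta_2}$), and $|a_{\theta_1}(u,\tilde u)-a_{\theta_2}(u,\tilde u)|\le L_a|\theta_1-\theta_2|\,\|u\|_{\theta_1}\|\tilde u\|_{\theta_1}$ for some $L_a>0$. Let $\mathcal H$ be a separable complex Hilbert space with uniformly equivalent inner products $d_\theta$ ($\theta\in\Theta$), $H$ being compactly embedded and dense in $\mathcal H$, with $d_\theta[u]\le b_\theta[u]$ for $u\in H$. Put $V_\theta=\{v\in H: a_\theta[v]=0\}$ and $W_\theta=\{w\in H:(w,v)_\theta=0\ \forall v\in V_\theta\}$. All the bounds below hold for all $\theta,\theta_1,\theta_2\in\Theta$,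 with constants independent of them unless indicated. **Assumptions.** (H1) For every $\theta\in\Theta$ there is $\nu_\theta>0$ with $a_\theta[w]\ge\nu_\theta\|w\|_\theta^2$ for all $w\in W_\theta$. (H2) $V_\star\subset H$ is a closed subspace such that, with $V^\star_\theta:=V_\theta$ for $\theta\ne0$ and $V_0^\star:=V_\star$, for some $L_\star\ge0$: $\inf_{v_2\in V^\star_{\theta_2}}\|v_1-v_2\|_{\theta_2}\le L_\star|\theta_1-\theta_2|\,\|v_1\|_{\theta_1}$ for all $v_1\in V^\star_{\theta_1}$. Further, $Z$ is a closed subspace with $V_0=V_\star\dotplus Z$ (direct sum) and $|(v,z)_0|\le K_Z\|v\|_0\|z\|_0$ for $v\in V_\star$, $z\in Z$, for some $0\le K_Z<1$. (H3) For some $\gamma>0$: $a_\theta[w]\ge\gamma|\theta|^2\|w\|_\theta^2$ for all $w\in W_\theta$. (H4) There are bounded sesquilinear maps $a'_0=(a'_j)_{j}:V_0\times H\to\mathbb C^n$ and $a''_0=(a''_{jk})_{j,k}:V_0\times V_0\to\mathbb C^{n\times n}$ and constants $K_{a'},K_{a''}\ge 0$ with $|a_\theta(v,u)-\sum_ja'_j(v,u)\theta_j|\le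 K_{a'}|\theta|^2\|v\|_0\|u\|_0$ and $|a_\theta(v,\tilde v)-\sum_{j,k}a''_{jk}(v,\tilde v)\theta_j\theta_k|\le K_{a''}|\theta|^3\|v\|_0\|\tilde v\|_0$ for $v,\tilde v\in V_0$, $u\in H$. (H5) $|b_\theta(v,\tilde v)-b_0(v,\tilde v)|\le L_b|\theta|\,\|v\|_0\|\tilde v\|_\theta$ for $v,\tilde v\in V_0$, for some $L_b\ge 0$. (H6) There are linear bijections $\mathcal E_\theta:V_\star\to V_\theta^\star$ and $K_b\ge 0$ with $b_\theta(\mathcal E_\theta v,\mathcal E_\theta\tilde v)=b_0(v,\tilde v)$ for $v,\tilde v\in V_\star$ and $|b_\theta(\mathcal E_\theta v,z)-b_0(v,z)|\le K_b|\theta|\,\|v\|_0\|z\|_0$ for $v\in V_\star$, $z\in Z$, which extend to linear bijections $\mathcal E_\theta$ of $\mathcal H$ with $d_\theta(\mathcal E_\theta u,\mathcal E_\theta\tilde u)=d_0(u,\tilde u)$, $\mathcal E_0=I$ and $d_{\theta_1}^{1/2}[\mathcal E_{\theta_1}u-\mathcal E_{\theta_2}u]\le K_e|\theta_1-\theta_2|\,d_0^{1/2}[u]$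 for $u,\tilde u\in\mathcal H$, for some $K_e\ge 0$. **Operators.** For $0<\varepsilon<1$ and $\theta\in\Theta$, $\mathcal L_{\varepsilon,\theta}$ is the self‑adjoint operator in $(\mathcal H,d_\theta)$ generated by the form $\varepsilon^{-2}a_\theta+b_\theta$ with form domain $H$. For $v\in V_0$ let $N^jv\in W_0$ be the solution of $a_0(N^jv,w)=-a'_j(v,w)$ for all $w\in W_0$; put $a^h_{jk}(z,\tilde z)=a''_{jk}(z,\tilde z)-a_0(N^jz,N^k\tilde z)$ for $z,\tilde z\in Z$. Let $\mathcal H_0=(\overline{V_\star\dotplus Z},d_0)$ (closure in $\mathcal H$), let $\mathcal P$ be the orthogonal projection of $L^2(\mathbb R^n;(\mathcal H,d_0))$ onto $L^2(\mathbb R^n;\mathcal H_0)$, and let $\mathcal L$ be the operator in $L^2(\mathbb R^n;\mathcal H_0)$ generated by the form $$Q(u+v,\tilde u+\tilde v)=\int_{\mathbb R^n}\sum_{j,k=1}^na^h_{jk}(\partial_{x_j}u,\partial_{x_k}\tilde u)\,dx+\int_{\mathbb R^n}b_0(u+v,\tilde u+\tilde v)\,dx$$ with form domain $H^1(\mathbb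 R^n;(Z,b_0))\dotplus L^2(\mathbb R^n;(V_\star,b_0))$. Let $\mathcal F$ be the unitary Fourier transform $(\mathcal Ff)(\xi)=(2\pi)^{-n/2}\int e^{-ix\cdot\xi}f(x)\,dx$ in $L^2(\mathbb R^n;(\mathcal H,d_0))$, $(\Gamma_\varepsilon f)(x)=\varepsilon^{n/2}f(\varepsilon x)$, $\chi$ the extension by zero from $\Theta$ to $\mathbb R^n$, $\chi^*$ the restriction to $\Theta$, $\chi_\Theta$ the multiplication by the characteristic function of $\Theta$, and $(\mathcal Eg)(\theta)=\mathcal E_\theta g(\theta)$. Put $A_\varepsilon=\Gamma_\varepsilon^{-1}\mathcal F^{-1}\chi\,\mathcal E^{-1}$ and $A_\varepsilon^*=\mathcal E\chi^*\mathcal F\,\Gamma_\varepsilon$. $L^2(\Theta;(\mathcal H,d_\theta))$ denotes $L^2(\Theta;\mathcal H)$ with inner product $\int_\Theta d_\theta(u(\theta),\tilde u(\theta))\,d\theta$. **Theorem.** Assume (H1)–(H6). Then $\mathcal L$ is self‑adjoint; the operators $\mathcal L$ and $\mathcal L_{\varepsilon,\theta}$ ($0<\varepsilon<1$, $\theta\in\Theta$)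 are bijective from their domains onto the respective Hilbert spaces; and there is a constant $C_{11}$, independent of $\varepsilon$, $\theta$ and $g$, such that for all $0<\varepsilon<1$ and all $g\in L^2(\Theta;(\mathcal H,d_\theta))$ $$d_\theta^{1/2}\big[\mathcal L_{\varepsilon,\theta}^{-1}g(\theta)-(A_\varepsilon^*\mathcal L^{-1}\mathcal PA_\varepsilon g)(\theta)\big]\le C_{11}\,\varepsilon\,d_\theta^{1/2}[g(\theta)]\qquad\text{for a.e. }\theta\in\Theta.$$ Moreover, for $0<\varepsilon<1$, $A_\varepsilon:L^2(\Theta;(\mathcal H,d_\theta))\to L^2(\mathbb R^n;(\mathcal H,d_0))$ is an isometry, $A_\varepsilon^*$ is its adjoint, and $$A_\varepsilon^*A_\varepsilon=I,\qquad A_\varepsilon A_\varepsilon^*=\Gamma_\varepsilon^{-1}\mathcal F^{-1}\chi_\Theta\mathcal F\,\Gamma_\varepsilon=\mathcal F^{-1}\Gamma_\varepsilon\chi_\Theta\Gamma_\varepsilon^{-1}\mathcal F .$$ -/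

import Mathlib

open MeasureTheory Set Filter
open scoped ENNReal InnerProductSpace Topology ContDiff

namespace Bivariate

/-- `ℝⁿ` with its Euclidean norm. -/
abbrev Pt (n : ℕ) := EuclideanSpace ℝ (Fin n)

/-- Bounded sesquilinear forms, linear in the first and antilinear in the second argument. -/
abbrev Form (V W : Type*) [NormedAddCommGroup V] [NormedSpace ℂ V]
    [NormedAddCommGroup W] [NormedSpace ℂ W] := V →L[ℂ] W →L⋆[ℂ] ℂ

/-- The quadratic form `B[u] = B(u,u)` of a (Hermitian) form, as a real number. -/
noncomputable def qf {V : Type*} [NormedAddCommGroup V] [NormedSpace ℂ V] (B : Form V V) (u : V) : ℝ :=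
  (B u u).re

section Lp

variable {n : ℕ} {F : Type*} [NormedAddCommGroup F] [NormedSpace ℂ F]

theorem memLp_dilate {ε : ℝ} (hε : 0 < ε) (f : Lp F 2 (volume : Measure (Pt n))) :
    MemLp (fun x : Pt n => ε ^ ((n : ℝ) / 2) • f (ε • x)) 2 volume := by
  have hmap := Measure.map_addHaar_smul (volume : Measure (Pt n)) hε.ne'
  have h1 : MemLp (f : Pt n → F) 2 (Measure.map (fun x : Pt n => ε • x) volume) := by
    rw [hmap]
    exact (Lp.memLp f).smul_measure ENNReal.ofReal_ne_top
  exact (h1.comp_of_map (measurable_const_smul ε).aemeasurable).const_smul _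

theorem norm_dilate {ε : ℝ} (hε : 0 < ε) (f : Lp F 2 (volume : Measure (Pt n))) :
    ‖(memLp_dilate hε f).toLp _‖ = ‖f‖ := by
  have hmap := Measure.map_addHaar_smul (volume : Measure (Pt n)) hε.ne'
  have h1 : AEStronglyMeasurable (f : Pt n → F)
      (Measure.map (fun x : Pt n => ε • x) volume) := by
    rw [hmap]
    exact (Lp.aestronglyMeasurable f).mono_ac Measure.smul_absolutelyContinuous
  have h2 := eLpNorm_map_measure (p := 2) h1 (measurable_const_smul ε).aemeasurable
  rw [hmap, eLpNorm_smul_measure_of_ne_top ENNReal.ofNat_ne_top] at h2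
  rw [Lp.norm_toLp, Lp.norm_def]
  congr 1
  have h3 : (fun x : Pt n => ε ^ ((n : ℝ) / 2) • f (ε • x))
      = (ε ^ ((n : ℝ) / 2)) • ((f : Pt n → F) ∘ fun x : Pt n => ε • x) := rfl
  rw [h3, eLpNorm_const_smul, ← h2, smul_eq_mul, ← mul_assoc]
  have h4 : ‖ε ^ ((n : ℝ) / 2)‖ₑ * ENNReal.ofReal |(ε ^ Module.finrank ℝ (Pt n))⁻¹| ^
      (1 / (2 : ℝ≥0∞)).toReal = 1 := by
    rw [Real.enorm_of_nonneg (by positivity), abs_of_pos (by positivity),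
      ENNReal.ofReal_rpow_of_pos (by positivity), ← ENNReal.ofReal_mul (by positivity)]
    rw [finrank_euclideanSpace_fin, ← Real.rpow_natCast, ← Real.rpow_neg hε.le,
      ← Real.rpow_mul hε.le, ← Real.rpow_add hε]
    have h5 : (n : ℝ) / 2 + -(n : ℝ) * (1 / (2 : ℝ≥0∞)).toReal = 0 := by
      norm_num
      ring
    rw [h5, Real.rpow_zero, ENNReal.ofReal_one]
  rw [h4, one_mul]

theorem ae_dilate {ε : ℝ} (hε : 0 < ε) {p : Pt n → Prop} (h : ∀ᵐ x : Pt n, p x) :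
    ∀ᵐ x : Pt n, p (ε • x) :=
  (Measure.quasiMeasurePreserving_smul (volume : Measure (Pt n)) hε.ne').ae h

/-- The dilation `f ↦ ε^{n/2} f(ε ·)` as a linear isometry of `L²(ℝⁿ; F)`. -/
noncomputable def dilateLI {ε : ℝ} (hε : 0 < ε) :
    Lp F 2 (volume : Measure (Pt n)) →ₗᵢ[ℂ] Lp F 2 (volume : Measure (Pt n)) where
  toFun f := (memLp_dilate hε f).toLp _
  map_add' f g := by
    rw [← MemLp.toLp_add]
    refine MemLp.toLp_congr _ _ ?_
    filter_upwards [ae_dilate hε (Lp.coeFn_add f g)] with x hx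
    simp only [Pi.add_apply] at hx ⊢
    rw [hx, smul_add]
  map_smul' c f := by
    rw [RingHom.id_apply, ← MemLp.toLp_const_smul]
    refine MemLp.toLp_congr _ _ ?_
    filter_upwards [ae_dilate hε (Lp.coeFn_smul c f)] with x hx
    simp only [Pi.smul_apply] at hx ⊢
    rw [hx, smul_comm c]
  norm_map' f := norm_dilate hε f

theorem dilate_dilate_inv {ε δ : ℝ} (hε : 0 < ε) (hδ : 0 < δ) (h : ε * δ = 1)
    (f : Lp F 2 (volume : Measure (Pt n))) : dilateLI hε (dilateLI hδ f) = f := by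
  apply Lp.ext
  filter_upwards [(memLp_dilate hε (dilateLI hδ f)).coeFn_toLp,
    ae_dilate hε (memLp_dilate hδ f).coeFn_toLp] with x h1 h2
  have h3 : (dilateLI hε (dilateLI hδ f) : Lp F 2 (volume : Measure (Pt n))) x
      = ε ^ ((n : ℝ) / 2) • (dilateLI hδ f : Lp F 2 (volume : Measure (Pt n))) (ε • x) := h1
  have h4 : (dilateLI hδ f : Lp F 2 (volume : Measure (Pt n))) (ε • x)
      = δ ^ ((n : ℝ) / 2) • f (δ • ε • x) := h2
  rw [h3, h4, smul_smul, smul_smul, ← Real.mul_rpow hε.le hδ.le, h, Real.one_rpow, one_smul,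
    mul_comm, h, one_smul]

/-- The unitary rescaling `(Γ_ε f)(x) = ε^{n/2} f(ε x)` of `L²(ℝⁿ; F)`; its inverse is
`(Γ_ε⁻¹ f)(x) = ε^{-n/2} f(ε⁻¹ x)`. -/
noncomputable def dilation {ε : ℝ} (hε : 0 < ε) :
    Lp F 2 (volume : Measure (Pt n)) ≃ₗᵢ[ℂ] Lp F 2 (volume : Measure (Pt n)) where
  toLinearEquiv :=
    { (dilateLI hε).toLinearMap with
      invFun := dilateLI (inv_pos.mpr hε)
      left_inv := dilate_dilate_inv _ _ (inv_mul_cancel₀ hε.ne')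
      right_inv := dilate_dilate_inv _ _ (mul_inv_cancel₀ hε.ne') }
  norm_map' := (dilateLI hε).norm_map

theorem memLp_extendZero {F : Type*} [NormedAddCommGroup F] {Θ : Set (Pt n)} (hΘ : MeasurableSet Θ)
    (f : Lp F 2 ((volume : Measure (Pt n)).restrict Θ)) :
    MemLp (Θ.indicator (f : Pt n → F)) 2 volume :=
  (memLp_indicator_iff_restrict hΘ).mpr (Lp.memLp f)

/-- Extension by zero `χ : L²(Θ; F) → L²(ℝⁿ; F)`. -/
noncomputable def extendZero {Θ : Set (Pt n)} (hΘ : MeasurableSet Θ) :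
    Lp F 2 ((volume : Measure (Pt n)).restrict Θ) →ₗᵢ[ℂ] Lp F 2 (volume : Measure (Pt n)) where
  toFun f := (memLp_extendZero hΘ f).toLp _
  map_add' f g := by
    rw [← MemLp.toLp_add]
    refine MemLp.toLp_congr _ _ ?_
    filter_upwards [(ae_restrict_iff' hΘ).mp (Lp.coeFn_add f g)] with x hx
    by_cases h : x ∈ Θ
    · rw [Pi.add_apply, indicator_of_mem h, indicator_of_mem h, indicator_of_mem h]
      exact hx h
    · simp [h]
  map_smul' c f := by
    rw [RingHom.id_apply, ← MemLp.toLp_const_smul]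
    refine MemLp.toLp_congr _ _ ?_
    filter_upwards [(ae_restrict_iff' hΘ).mp (Lp.coeFn_smul c f)] with x hx
    by_cases h : x ∈ Θ
    · simp [h, hx h]
    · simp [h]
  norm_map' f := by
    simp [Lp.norm_def, eLpNorm_congr_ae (MemLp.coeFn_toLp _),
      eLpNorm_indicator_eq_eLpNorm_restrict hΘ]

/-- Restriction `χ* : L²(ℝⁿ; F) → L²(Θ; F)`. -/
noncomputable def restrictTo (Θ : Set (Pt n)) :
    Lp F 2 (volume : Measure (Pt n)) →L[ℂ] Lp F 2 ((volume : Measure (Pt n)).restrict Θ) :=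
  LpToLpRestrictCLM (Pt n) F ℂ volume 2 Θ

/-- Multiplication `χ_Θ` by the characteristic function of `Θ` in `L²(ℝⁿ; F)`. -/
noncomputable def mulIndicator {Θ : Set (Pt n)} (hΘ : MeasurableSet Θ) :
    Lp F 2 (volume : Measure (Pt n)) →L[ℂ] Lp F 2 (volume : Measure (Pt n)) :=
  LinearMap.mkContinuous
    { toFun := fun f => ((Lp.memLp f).indicator hΘ).toLp (Θ.indicator (f : Pt n → F))
      map_add' := fun f g => by
        rw [← MemLp.toLp_add]
        refine MemLp.toLp_congr _ _ ?_
        filter_upwards [Lp.coeFn_add f g] with x hx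
        by_cases h : x ∈ Θ
        · rw [Pi.add_apply, indicator_of_mem h, indicator_of_mem h, indicator_of_mem h]
          exact hx
        · simp [h]
      map_smul' := fun c f => by
        rw [RingHom.id_apply, ← MemLp.toLp_const_smul]
        refine MemLp.toLp_congr _ _ ?_
        filter_upwards [Lp.coeFn_smul c f] with x hx
        by_cases h : x ∈ Θ
        · simp [h, hx]
        · simp [h] }
    1 (fun f => by
      rw [one_mul]
      refine Lp.norm_le_norm_of_ae_le ?_
      filter_upwards [((Lp.memLp f).indicator hΘ).coeFn_toLp] with x hx
      simp only [LinearMap.coe_mk, AddHom.coe_mk]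
      rw [hx]
      exact norm_indicator_le_norm_self _ _)

theorem memLp_fibrewise {Θ : Set (Pt n)} (hΘ : IsCompact Θ) {T : Pt n → F →L[ℂ] F}
    (hT : ContinuousOn T Θ) (f : Lp F 2 ((volume : Measure (Pt n)).restrict Θ)) :
    MemLp (fun θ => T θ (f θ)) 2 ((volume : Measure (Pt n)).restrict Θ) := by
  obtain ⟨C, hC⟩ := hΘ.exists_bound_of_continuousOn hT
  have hm : AEStronglyMeasurable (fun θ => T θ (f θ)) ((volume : Measure (Pt n)).restrict Θ) :=
    (ContinuousLinearMap.apply ℂ F).flip.aestronglyMeasurable_comp₂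
      (hT.aestronglyMeasurable hΘ.measurableSet) (Lp.aestronglyMeasurable f)
  refine MemLp.of_le_mul (c := C) (Lp.memLp f) hm ?_
  filter_upwards [ae_restrict_mem hΘ.measurableSet] with θ hθ
  exact (T θ).le_of_opNorm_le (hC θ hθ) _

/-- The operator `f ↦ (θ ↦ T_θ f(θ))` in `L²(Θ; F)` given by a continuous operator family on
the compact set `Θ`. -/
noncomputable def fibrewise {Θ : Set (Pt n)} (hΘ : IsCompact Θ) {T : Pt n → F →L[ℂ] F}
    (hT : ContinuousOn T Θ) :
    Lp F 2 ((volume : Measure (Pt n)).restrict Θ) →L[ℂ]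
      Lp F 2 ((volume : Measure (Pt n)).restrict Θ) :=
  LinearMap.mkContinuous
    { toFun := fun f => (memLp_fibrewise hΘ hT f).toLp (fun θ => T θ (f θ))
      map_add' := fun f g => by
        rw [← MemLp.toLp_add]
        refine MemLp.toLp_congr _ _ ?_
        filter_upwards [Lp.coeFn_add f g] with x hx
        simp only [Pi.add_apply] at hx ⊢
        rw [hx, map_add]
      map_smul' := fun c f => by
        rw [RingHom.id_apply, ← MemLp.toLp_const_smul]
        refine MemLp.toLp_congr _ _ ?_
        filter_upwards [Lp.coeFn_smul c f] with x hx
        simp [hx] }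
    (hΘ.exists_bound_of_continuousOn hT).choose (fun f => by
      refine Lp.norm_le_mul_norm_of_ae_le_mul ?_
      filter_upwards [(memLp_fibrewise hΘ hT f).coeFn_toLp,
        ae_restrict_mem hΘ.measurableSet] with θ h1 hθ
      simp only [LinearMap.coe_mk, AddHom.coe_mk]
      rw [h1]
      exact (T θ).le_of_opNorm_le ((hΘ.exists_bound_of_continuousOn hT).choose_spec θ hθ) _)

/-- The unitary Fourier transform `(𝓕 u)(ξ) = (2π)^{-n/2} ∫ e^{-i x·ξ} u(x) dx` of
`L²(ℝⁿ; F)`: Mathlib's transform `∫ e^{-2π i x·η} u(x) dx`, evaluated at `η = ξ/(2π)` and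
multiplied by `(2π)^{-n/2}`. -/
noncomputable def fourier {n : ℕ} {F : Type*} [NormedAddCommGroup F] [InnerProductSpace ℂ F]
    [CompleteSpace F] :
    Lp F 2 (volume : Measure (Pt n)) ≃ₗᵢ[ℂ] Lp F 2 (volume : Measure (Pt n)) :=
  (Lp.fourierTransformₗᵢ (Pt n) F).trans
    (dilation (ε := (2 * Real.pi)⁻¹) (inv_pos.mpr Real.two_pi_pos))

theorem integrable_form {V W : Type*} [NormedAddCommGroup V] [NormedSpace ℂ V]
    [NormedAddCommGroup W] [NormedSpace ℂ W] (B : Form V W)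
    (f : Lp V 2 (volume : Measure (Pt n))) (g : Lp W 2 (volume : Measure (Pt n))) :
    Integrable (fun x => B (f x) (g x)) volume := by
  have hm : AEStronglyMeasurable (fun x => B (f x) (g x)) (volume : Measure (Pt n)) := by
    have hc : Continuous (fun p : V × W => B p.1 p.2) := by
      let C : V →L⋆[ℂ] W →L[ℂ] ℂ := (ContinuousLinearMap.compSL W ℂ ℂ (starRingEnd ℂ)
        (starRingEnd ℂ) ((starL ℂ : ℂ ≃L⋆[ℂ] ℂ) : ℂ →L⋆[ℂ] ℂ)).comp B
      have h1 : Continuous (fun p : V × W => C p.1 p.2) :=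
        (C.continuous.comp continuous_fst).clm_apply continuous_snd
      have h2 : (fun p : V × W => B p.1 p.2) = fun p => star (C p.1 p.2) := by
        funext p
        exact (star_star (B p.1 p.2)).symm
      rw [h2]
      exact continuous_star.comp h1
    exact hc.comp_aestronglyMeasurable
      ((Lp.aestronglyMeasurable f).prodMk (Lp.aestronglyMeasurable g))
  have h1 : Integrable (fun x => ‖f x‖ * ‖g x‖) (volume : Measure (Pt n)) :=
    (Lp.memLp f).norm.integrable_mul (Lp.memLp g).norm
  refine (h1.const_mul ‖B‖).mono' hm (Eventually.of_forall fun x => ?_)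
  have := B.le_opNorm₂ (f x) (g x)
  rwa [mul_assoc] at this

/-- The integrated form `(f, g) ↦ ∫_{ℝⁿ} B(f(x), g(x)) dx` on `L²(ℝⁿ; V) × L²(ℝⁿ; W)`. -/
noncomputable def intForm {V W : Type*} [NormedAddCommGroup V] [NormedSpace ℂ V]
    [NormedAddCommGroup W] [NormedSpace ℂ W] (B : Form V W) :
    Lp V 2 (volume : Measure (Pt n)) →ₗ[ℂ] Lp W 2 (volume : Measure (Pt n)) →ₗ⋆[ℂ] ℂ :=
  LinearMap.mk₂'ₛₗ (RingHom.id ℂ) (starRingEnd ℂ) (fun f g => ∫ x, B (f x) (g x))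
    (fun f f' g => by
      rw [← integral_add (integrable_form B f g) (integrable_form B f' g)]
      refine integral_congr_ae ?_
      filter_upwards [Lp.coeFn_add f f'] with x hx
      simp only [Pi.add_apply] at hx ⊢
      rw [hx, map_add, add_apply])
    (fun c f g => by
      rw [RingHom.id_apply, ← integral_smul]
      refine integral_congr_ae ?_
      filter_upwards [Lp.coeFn_smul c f] with x hx
      simp [hx])
    (fun f g g' => by
      rw [← integral_add (integrable_form B f g) (integrable_form B f g')]
      refine integral_congr_ae ?_
      filter_upwards [Lp.coeFn_add g g'] with x hx
      simp only [Pi.add_apply] at hx ⊢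
      rw [hx, map_add])
    (fun c f g => by
      rw [← integral_smul]
      refine integral_congr_ae ?_
      filter_upwards [Lp.coeFn_smul c g] with x hx
      simp [hx])

end Lp

section Sobolev

variable {n : ℕ} {H : Type*} [NormedAddCommGroup H] [InnerProductSpace ℂ H]

theorem integrable_test {Z : Submodule ℂ H} (b : Form H H) (u : Lp Z 2 (volume : Measure (Pt n)))
    (z : Z) {φ : Pt n → ℝ} (hφ : Continuous φ) (hc : HasCompactSupport φ) :
    Integrable (fun x => (φ x : ℂ) * b (u x : H) (z : H)) volume := by
  have h1 : LocallyIntegrable (u : Pt n → Z) (volume : Measure (Pt n)) :=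
    (Lp.memLp u).locallyIntegrable (by norm_num)
  have h2 : Integrable (fun x => φ x • u x) (volume : Measure (Pt n)) :=
    h1.integrable_smul_left_of_hasCompactSupport hφ hc
  have h3 := ((b.flip (z : H)).comp Z.subtypeL).integrable_comp h2
  refine h3.congr (Eventually.of_forall fun x => ?_)
  have h4 : φ x • u x = (φ x : ℂ) • u x := (Complex.coe_smul (φ x) (u x)).symm
  change b ((φ x • u x : Z) : H) (z : H) = _
  rw [h4, Submodule.coe_smul, map_smul, smul_apply, smul_eq_mul]

/-- The Sobolev space `H¹(ℝⁿ; (Z, b))`, an element `u` being listed together with its generalised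
derivatives: the pairs `(u, (∂₁u, …, ∂ₙu))` in `L²` such that
`∫ b(u(x), z) ∂_jφ(x) dx = - ∫ b(∂_j u(x), z) φ(x) dx` for all test functions `φ` and `z ∈ Z`. -/
noncomputable def sobolev (n : ℕ) (Z : Submodule ℂ H) (b : Form H H) :
    Submodule ℂ (Lp Z 2 (volume : Measure (Pt n)) × (Fin n → Lp Z 2 (volume : Measure (Pt n)))) where
  carrier := {p | ∀ (j : Fin n) (φ : Pt n → ℝ), ContDiff ℝ ∞ φ → HasCompactSupport φ → ∀ z : Z,
    ∫ x, (fderiv ℝ φ x (EuclideanSpace.single j 1) : ℂ) * b (p.1 x : H) (z : H)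
      = - ∫ x, (φ x : ℂ) * b (p.2 j x : H) (z : H)}
  zero_mem' := by
    intro j φ hφ hc z
    have h0 : (0 : Lp Z 2 (volume : Measure (Pt n))) =ᵐ[volume] 0 := Lp.coeFn_zero _ _ _
    have h1 : ∀ ψ : Pt n → ℝ, ∫ x, (ψ x : ℂ) *
        b ((0 : Lp Z 2 (volume : Measure (Pt n))) x : H) (z : H) = 0 := by
      intro ψ
      rw [← integral_zero (Pt n) ℂ]
      refine integral_congr_ae ?_
      filter_upwards [h0] with x hx
      rw [hx]
      simp
    exact (h1 _).trans (by rw [← neg_zero]; exact congrArg Neg.neg (h1 φ).symm)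
  add_mem' := by
    intro p q hp hq j φ hφ hc z
    have hd : Continuous (fun x => fderiv ℝ φ x (EuclideanSpace.single j 1)) :=
      (hφ.continuous_fderiv (by simp)).clm_apply continuous_const
    have hdc : HasCompactSupport (fun x => fderiv ℝ φ x (EuclideanSpace.single j 1)) :=
      (hc.fderiv ℝ).comp_left (g := fun L : Pt n →L[ℝ] ℝ => L (EuclideanSpace.single j 1)) (by simp)
    have key : ∀ ψ : Pt n → ℝ, Continuous ψ → HasCompactSupport ψ →
        ∀ f g : Lp Z 2 (volume : Measure (Pt n)),
        ∫ x, (ψ x : ℂ) * b ((f + g : Lp Z 2 (volume : Measure (Pt n))) x : H) (z : H)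
          = (∫ x, (ψ x : ℂ) * b (f x : H) (z : H)) + ∫ x, (ψ x : ℂ) * b (g x : H) (z : H) := by
      intro ψ h1 h2 f g
      rw [← integral_add (integrable_test b f z h1 h2) (integrable_test b g z h1 h2)]
      refine integral_congr_ae ?_
      filter_upwards [Lp.coeFn_add f g] with x hx
      simp only [Pi.add_apply] at hx
      rw [hx, Submodule.coe_add, map_add, add_apply, mul_add]
    have e1 := key _ hd hdc p.1 q.1
    have e2 := key _ hφ.continuous hc (p.2 j) (q.2 j)
    have e3 := hp j φ hφ hc z
    have e4 := hq j φ hφ hc z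
    refine e1.trans ?_
    rw [e3, e4, ← neg_add]
    exact congrArg Neg.neg e2.symm
  smul_mem' := by
    intro c p hp j φ hφ hc z
    have key : ∀ (ψ : Pt n → ℝ) (f : Lp Z 2 (volume : Measure (Pt n))),
        ∫ x, (ψ x : ℂ) * b ((c • f : Lp Z 2 (volume : Measure (Pt n))) x : H) (z : H)
          = c * ∫ x, (ψ x : ℂ) * b (f x : H) (z : H) := by
      intro ψ f
      rw [← integral_const_mul]
      refine integral_congr_ae ?_
      filter_upwards [Lp.coeFn_smul c f] with x hx
      simp only [Pi.smul_apply] at hx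
      rw [hx, Submodule.coe_smul, map_smul, smul_apply, smul_eq_mul]
      ring
    refine (key _ p.1).trans ?_
    rw [hp j φ hφ hc z, mul_neg]
    exact congrArg Neg.neg (key φ (p.2 j)).symm

end Sobolev

section Operators

/-- The graph of the operator generated in the Hilbert space `(X, d)` by a sesquilinear form `B`
whose form domain `M` is mapped into `X` by `J`: the pairs `(J m, f)` with
`B(m, m') = d(f, J m')` for all `m'` in the form domain. -/
def formGraph {M X : Type*} [AddCommGroup M] [Module ℂ M] [NormedAddCommGroup X]
    [NormedSpace ℂ X] (B : M →ₗ[ℂ] M →ₗ⋆[ℂ] ℂ) (J : M →ₗ[ℂ] X) (d : Form X X) :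
    Submodule ℂ (X × X) where
  carrier := {p | ∃ m : M, J m = p.1 ∧ ∀ m' : M, B m m' = d p.2 (J m')}
  zero_mem' := ⟨0, by simp, by simp⟩
  add_mem' := by
    rintro p q ⟨m, h1, h2⟩ ⟨k, h3, h4⟩
    exact ⟨m + k, by simp [h1, h3], fun m' => by simp [h2, h4]⟩
  smul_mem' := by
    rintro c p ⟨m, h1, h2⟩
    exact ⟨c • m, by simp [h1], fun m' => by simp [h2]⟩

/-- The (unbounded) operator generated by a form. -/
noncomputable def formOperator {M X : Type*} [AddCommGroup M] [Module ℂ M] [NormedAddCommGroup X]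
    [NormedSpace ℂ X] (B : M →ₗ[ℂ] M →ₗ⋆[ℂ] ℂ) (J : M →ₗ[ℂ] X) (d : Form X X) : X →ₗ.[ℂ] X :=
  (formGraph B J d).toLinearPMap

open Classical in
/-- The inverse `T⁻¹ f` of an operator `T` that is a bijection of its domain onto `X`. -/
noncomputable def opInv {X : Type*} [NormedAddCommGroup X] [NormedSpace ℂ X] (T : X →ₗ.[ℂ] X)
    (f : X) : X :=
  if h : ∃ u : T.domain, T u = f then (h.choose : X) else 0

/-- A bounded form as a sesquilinear map. -/
noncomputable def Form.toSesq {V W : Type*} [NormedAddCommGroup V] [NormedSpace ℂ V]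
    [NormedAddCommGroup W] [NormedSpace ℂ W] (B : Form V W) : V →ₗ[ℂ] W →ₗ⋆[ℂ] ℂ :=
  LinearMap.mk₂'ₛₗ (RingHom.id ℂ) (starRingEnd ℂ) (fun v w => B v w)
    (fun v v' w => by simp) (fun c v w => by simp) (fun v w w' => by simp) (fun c v w => by simp)

variable {n : ℕ} {X : Type*} [NormedAddCommGroup X] [InnerProductSpace ℂ X]

/-- The inner product as a form which is linear in its first argument. -/
noncomputable def innerForm (X : Type*) [NormedAddCommGroup X] [InnerProductSpace ℂ X] :
    Form X X := (innerSL ℂ : X →L⋆[ℂ] X →L[ℂ] ℂ).flip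

/-- The subspace `L²(ℝⁿ; K)` of `L²(ℝⁿ; X)` for a subspace `K` of `X`. -/
def lpIn (n : ℕ) (K : Submodule ℂ X) : Submodule ℂ (Lp X 2 (volume : Measure (Pt n))) where
  carrier := {f | ∀ᵐ x, f x ∈ K}
  zero_mem' := by
    have h0 : (0 : Lp X 2 (volume : Measure (Pt n))) =ᵐ[volume] 0 := Lp.coeFn_zero _ _ _
    filter_upwards [h0] with x hx
    rw [hx]
    exact K.zero_mem
  add_mem' := by
    intro f g hf hg
    filter_upwards [hf, hg, Lp.coeFn_add f g] with x h1 h2 h3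
    rw [h3]
    exact K.add_mem h1 h2
  smul_mem' := by
    intro c f hf
    filter_upwards [hf, Lp.coeFn_smul c f] with x h1 h2
    rw [h2]
    exact K.smul_mem c h1

theorem isClosed_lpIn {K : Submodule ℂ X} (hK : IsClosed (K : Set X)) :
    IsClosed (lpIn n K : Set (Lp X 2 (volume : Measure (Pt n)))) := by
  refine isClosed_of_closure_subset fun f hf => ?_
  obtain ⟨u, hu, hl⟩ := mem_closure_iff_seq_limit.mp hf
  obtain ⟨ns, -, hns⟩ := (tendstoInMeasure_of_tendsto_Lp hl).exists_seq_tendsto_ae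
  have hall : ∀ᵐ x, ∀ i, u i x ∈ K := ae_all_iff.mpr hu
  have : ∀ᵐ x, f x ∈ K := by
    filter_upwards [hns, hall] with x h1 h2
    exact hK.mem_of_tendsto h1 (Eventually.of_forall fun i => h2 _)
  exact this

end Operators

section LaxMilgram

variable {W : Type*} [NormedAddCommGroup W] [InnerProductSpace ℂ W] [CompleteSpace W]

/-- Riesz representation of bounded antilinear functionals: `⟪w, riesz ℓ⟫ = ℓ w`. -/
noncomputable def riesz : (W →L⋆[ℂ] ℂ) →L[ℂ] W :=
  ((InnerProductSpace.toDual ℂ W).symm.toContinuousLinearEquiv : (W →L[ℂ] ℂ) →L⋆[ℂ] W).comp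
    (ContinuousLinearMap.compSL W ℂ ℂ (starRingEnd ℂ) (starRingEnd ℂ)
      ((starL ℂ : ℂ ≃L⋆[ℂ] ℂ) : ℂ →L⋆[ℂ] ℂ))

theorem inner_riesz (l : W →L⋆[ℂ] ℂ) (w : W) : inner ℂ w (riesz l) = l w := by
  rw [← inner_conj_symm]
  have h : inner ℂ (riesz l) w = (starRingEnd ℂ) (l w) :=
    InnerProductSpace.toDual_symm_apply
  rw [h, Complex.conj_conj]

theorem exists_solution {V : Type*} [NormedAddCommGroup V] [NormedSpace ℂ V] (A : Form W W)
    (l : Form V W) {c : ℝ} (hc : 0 < c) (hA : ∀ w, c * ‖w‖ ^ 2 ≤ qf A w) :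
    ∃ N : V →L[ℂ] W, ∀ v w, A (N v) w = l v w := by
  let T : W →L[ℂ] W := (riesz (W := W)).comp A
  have hT : ∀ v w, inner ℂ w (T v) = A v w := fun v w => inner_riesz (A v) w
  have hu : IsUnit T := by
    refine ContinuousLinearMap.isUnit_of_forall_le_norm_inner_map T
      (c := ⟨c, hc.le⟩) (by exact_mod_cast hc) (fun w => ?_)
    rw [norm_inner_symm, hT]
    have h1 := hA w
    have h2 : qf A w ≤ ‖A w w‖ := Complex.re_le_norm _
    change ‖w‖ ^ 2 * c ≤ _
    linarith
  obtain ⟨u, hu⟩ := hu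
  refine ⟨(↑u⁻¹ : W →L[ℂ] W).comp ((riesz (W := W)).comp l), fun v w => ?_⟩
  rw [← hT, ← hu]
  have : (u : W →L[ℂ] W) ((↑u⁻¹ : W →L[ℂ] W) (riesz (l v))) = riesz (l v) := by
    rw [← mul_apply_eq_comp, Units.mul_inv, one_apply_eq_self]
  exact (congrArg (inner ℂ w) this).trans (inner_riesz (l v) w)

end LaxMilgram

section Abstract

/-- The norm `(A[u] + B[u])^{1/2}`. -/
noncomputable def formNorm {H : Type*} [NormedAddCommGroup H] [NormedSpace ℂ H]
    (A B : Form H H) (u : H) : ℝ := √(qf A u + qf B u)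

variable {n : ℕ} {H 𝓗 : Type*} [NormedAddCommGroup H] [InnerProductSpace ℂ H]
  [NormedAddCommGroup 𝓗] [InnerProductSpace ℂ 𝓗]

/-- The abstract setting: a compact parameter set `Θ`, non-negative forms `a_θ, b_θ` on `H` such
that the `(·,·)_θ = a_θ + b_θ` are uniformly equivalent inner products of `H`, with `a_θ` Lipschitz
in `θ`; a compact and dense embedding `ι` of `H` into `𝓗`; and uniformly equivalent inner products
`d_θ` on `𝓗` with `d_θ ≤ b_θ` on `H`. The inner product of the Hilbert space `𝓗` itself
is `d_0`. -/
structure Setting (n : ℕ) (H 𝓗 : Type*) [NormedAddCommGroup H] [InnerProductSpace ℂ H]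
    [NormedAddCommGroup 𝓗] [InnerProductSpace ℂ 𝓗] where
  Θ : Set (Pt n)
  a : Pt n → Form H H
  b : Pt n → Form H H
  d : Pt n → Form 𝓗 𝓗
  ι : H →L[ℂ] 𝓗
  isCompact : IsCompact Θ
  zero_mem : 0 ∈ Θ
  a_nonneg : ∀ θ ∈ Θ, ∀ u, (a θ u u).im = 0 ∧ 0 ≤ (a θ u u).re
  b_nonneg : ∀ θ ∈ Θ, ∀ u, (b θ u u).im = 0 ∧ 0 ≤ (b θ u u).re
  norm_le : ∃ c > 0, ∀ θ ∈ Θ, ∀ u, ‖u‖ ≤ c * formNorm (a θ) (b θ) u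
  norm_equiv : ∃ K > 0, ∀ θ₁ ∈ Θ, ∀ θ₂ ∈ Θ, ∀ u,
    formNorm (a θ₁) (b θ₁) u ≤ K * formNorm (a θ₂) (b θ₂) u
  a_lipschitz : ∃ L > 0, ∀ θ₁ ∈ Θ, ∀ θ₂ ∈ Θ, ∀ u v, ‖a θ₁ u v - a θ₂ u v‖ ≤
    L * ‖θ₁ - θ₂‖ * formNorm (a θ₁) (b θ₁) u * formNorm (a θ₁) (b θ₁) v
  d_zero : ∀ u v, d 0 u v = inner ℂ v u
  d_nonneg : ∀ θ ∈ Θ, ∀ u, (d θ u u).im = 0 ∧ 0 ≤ (d θ u u).re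
  d_equiv : ∃ K > 0, ∀ θ₁ ∈ Θ, ∀ θ₂ ∈ Θ, ∀ u, qf (d θ₁) u ≤ K * qf (d θ₂) u
  ι_injective : Function.Injective ι
  ι_dense : DenseRange ι
  ι_compact : IsCompactOperator ι
  d_le : ∀ θ ∈ Θ, ∀ u, qf (d θ) (ι u) ≤ qf (b θ) u

namespace Setting

variable (S : Setting n H 𝓗)

/-- `‖u‖_θ`. -/
noncomputable def nrm (θ : Pt n) (u : H) : ℝ := formNorm (S.a θ) (S.b θ) u

/-- `V_θ = {v : a_θ[v] = 0}`. -/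
def V (θ : Pt n) : Set H := {v | S.a θ v v = 0}

/-- `W_θ`, the orthogonal complement of `V_θ` with respect to `(·,·)_θ`. -/
def W (θ : Pt n) : Submodule ℂ H where
  carrier := {w | ∀ v ∈ S.V θ, S.a θ w v + S.b θ w v = 0}
  zero_mem' := fun v _ => by simp
  add_mem' := fun {x y} hx hy v hv => by
    have h1 := hx v hv
    have h2 := hy v hv
    simp only [map_add, add_apply]
    linear_combination h1 + h2
  smul_mem' := fun c x hx v hv => by
    have h1 := hx v hv
    simp only [map_smul, smul_apply, smul_eq_mul]
    linear_combination c * h1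

/-- The spectral gap condition. -/
def H1 : Prop :=
  ∀ θ ∈ S.Θ, ∃ ν > 0, ∀ w ∈ S.W θ, ν * S.nrm θ w ^ 2 ≤ qf (S.a θ) w

open Classical in
/-- `V^⋆_θ`, which is `V_θ` for `θ ≠ 0` and `V_⋆` for `θ = 0`. -/
noncomputable def Vstar (Vs : Submodule ℂ H) (θ : Pt n) : Set H :=
  if θ = 0 then (Vs : Set H) else S.V θ

/-- `V_θ` has a removable singularity at `θ = 0`. -/
def H2 (Vs : Submodule ℂ H) : Prop :=
  IsClosed (Vs : Set H) ∧ ∃ L ≥ 0, ∀ θ₁ ∈ S.Θ, ∀ θ₂ ∈ S.Θ, ∀ v₁ ∈ S.Vstar Vs θ₁,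
    (⨅ v₂ : S.Vstar Vs θ₂, S.nrm θ₂ (v₁ - v₂)) ≤ L * ‖θ₁ - θ₂‖ * S.nrm θ₁ v₁

/-- `Z` is a defect subspace: `V_0 = V_⋆ ∔ Z` with the transversality condition. -/
def IsDefect (Vs Z : Submodule ℂ H) : Prop :=
  IsClosed (Z : Set H) ∧ ((Vs ⊔ Z : Submodule ℂ H) : Set H) = S.V 0 ∧ Disjoint Vs Z ∧
    ∃ K, 0 ≤ K ∧ K < 1 ∧ ∀ v ∈ Vs, ∀ z ∈ Z,
      ‖S.a 0 v z + S.b 0 v z‖ ≤ K * S.nrm 0 v * S.nrm 0 z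

/-- At most quadratic degeneration of the spectral gap. -/
def H3 : Prop :=
  ∃ γ > 0, ∀ θ ∈ S.Θ, ∀ w ∈ S.W θ, γ * ‖θ‖ ^ 2 * S.nrm θ w ^ 2 ≤ qf (S.a θ) w

/-- Differentiability of `a_θ` at `θ = 0`, with the forms `a'_0 = (a'_j)` on `V_0 × H` and
`a''_0 = (a''_{jk})` on `V_0 × V_0`. Here and below `V_0 = Vs ⊔ Z`. -/
def H4 (Vs Z : Submodule ℂ H) (a' : Fin n → Form ↥(Vs ⊔ Z) H)
    (a'' : Fin n → Fin n → Form ↥(Vs ⊔ Z) ↥(Vs ⊔ Z)) : Prop :=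
  0 ∈ interior S.Θ ∧
  (∃ K ≥ 0, ∀ θ ∈ S.Θ, ∀ (v : ↥(Vs ⊔ Z)) (u : H),
    ‖S.a θ (v : H) u - ∑ j, a' j v u * (θ j : ℂ)‖ ≤ K * ‖θ‖ ^ 2 * S.nrm 0 v * S.nrm 0 u) ∧
  (∃ K ≥ 0, ∀ θ ∈ S.Θ, ∀ v v' : ↥(Vs ⊔ Z),
    ‖S.a θ (v : H) (v' : H) - ∑ j, ∑ k, a'' j k v v' * (θ k : ℂ) * (θ j : ℂ)‖ ≤
      K * ‖θ‖ ^ 3 * S.nrm 0 v * S.nrm 0 v')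

/-- Lipschitz continuity of `b_θ` at `θ = 0`, with `Θ` connected. -/
def H5 : Prop :=
  IsConnected S.Θ ∧ ∃ L ≥ 0, ∀ θ ∈ S.Θ, ∀ v ∈ S.V 0, ∀ v' ∈ S.V 0,
    ‖S.b θ v v' - S.b 0 v v'‖ ≤ L * ‖θ‖ * S.nrm 0 v * S.nrm θ v'

/-- `e_θ : V_⋆ → V^⋆_θ` are transfer operators. -/
def IsTransfer (Vs Z : Submodule ℂ H) (e : Pt n → Vs →ₗ[ℂ] H) : Prop :=
  (∀ θ ∈ S.Θ, Function.Injective (e θ) ∧ range (e θ) = S.Vstar Vs θ) ∧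
  (∀ θ ∈ S.Θ, ∀ v v' : Vs, S.b θ (e θ v) (e θ v') = S.b 0 (v : H) (v' : H)) ∧
  ∃ K ≥ 0, ∀ θ ∈ S.Θ, ∀ v : Vs, ∀ z ∈ Z,
    ‖S.b θ (e θ v) z - S.b 0 (v : H) z‖ ≤ K * ‖θ‖ * S.nrm 0 v * S.nrm 0 z

/-- The transfer operators extend to unitary maps `E_θ : (𝓗, d_0) → (𝓗, d_θ)`, with `E_0 = I` and
Lipschitz continuous in `θ`. -/
def H6 (Vs : Submodule ℂ H) (e : Pt n → Vs →ₗ[ℂ] H) (E : Pt n → 𝓗 ≃L[ℂ] 𝓗) : Prop :=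
  (∀ θ ∈ S.Θ, ∀ v : Vs, E θ (S.ι v) = S.ι (e θ v)) ∧
  (∀ θ ∈ S.Θ, ∀ u u', S.d θ (E θ u) (E θ u') = S.d 0 u u') ∧
  (∀ u, E 0 u = u) ∧
  ∃ K ≥ 0, ∀ θ₁ ∈ S.Θ, ∀ θ₂ ∈ S.Θ, ∀ u,
    √(qf (S.d θ₁) (E θ₁ u - E θ₂ u)) ≤ K * ‖θ₁ - θ₂‖ * √(qf (S.d 0) u)

theorem isClosed_W (θ : Pt n) : IsClosed (S.W θ : Set H) := by
  have h : (S.W θ : Set H) =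
      ⋂ v ∈ S.V θ, {w | (S.a θ).flip v w + (S.b θ).flip v w = 0} := by
    ext w
    simp only [mem_iInter]
    exact Iff.rfl
  rw [h]
  refine isClosed_biInter fun v _ => isClosed_eq ?_ continuous_const
  exact ((S.a θ).flip v).continuous.add ((S.b θ).flip v).continuous

/-- `N^j v ∈ W_0` solves the cell problem `a_0(N^j v, w) = -a'_j(v, w)` for all `w ∈ W_0`. -/
def IsCorrector {V₀ : Submodule ℂ H} (a' : Fin n → Form V₀ H) (N : Fin n → V₀ →L[ℂ] H) : Prop :=
  ∀ j v, N j v ∈ S.W 0 ∧ ∀ w ∈ S.W 0, S.a 0 (N j v) w = - a' j v w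

theorem exists_corrector [CompleteSpace H] (h1 : S.H1) {V₀ : Submodule ℂ H} (a' : Fin n → Form V₀ H) :
    ∃ N, S.IsCorrector a' N := by
  obtain ⟨ν, hν, hW⟩ := h1 0 S.zero_mem
  obtain ⟨c, hc, hn⟩ := S.norm_le
  have : CompleteSpace (S.W 0) := (S.isClosed_W 0).completeSpace_coe
  have hA : ∀ w : S.W 0, ν / c ^ 2 * ‖w‖ ^ 2 ≤
      qf ((S.a 0).bilinearComp (S.W 0).subtypeL (S.W 0).subtypeL) w := by
    intro w
    have h2 := hn 0 S.zero_mem (w : H)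
    have h3 := hW w w.2
    have h4 : ‖(w : H)‖ ^ 2 ≤ c ^ 2 * S.nrm 0 w ^ 2 := by
      rw [← mul_pow]
      exact pow_le_pow_left₀ (norm_nonneg _) h2 2
    refine le_trans ?_ h3
    rw [div_mul_eq_mul_div, div_le_iff₀ (by positivity)]
    have h5 := mul_le_mul_of_nonneg_left h4 hν.le
    have h6 : ‖w‖ = ‖(w : H)‖ := rfl
    rw [h6]
    linarith
  have hex := fun j => exists_solution
    ((S.a 0).bilinearComp (S.W 0).subtypeL (S.W 0).subtypeL)
    (-(a' j).bilinearComp (ContinuousLinearMap.id ℂ V₀) (S.W 0).subtypeL)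
    (div_pos hν (pow_pos hc 2)) hA
  choose N hN using hex
  exact ⟨fun j => (S.W 0).subtypeL.comp (N j),
    fun j v => ⟨(N j v).2, fun w hw => hN j v ⟨w, hw⟩⟩⟩

/-- The correctors `N^j : V_0 → W_0`. -/
noncomputable def corrector [CompleteSpace H] (h1 : S.H1) {V₀ : Submodule ℂ H} (a' : Fin n → Form V₀ H) :
    Fin n → V₀ →L[ℂ] H := (S.exists_corrector h1 a').choose

/-- The inclusion of `Z` into `V_0`. -/
def inclZ (Vs Z : Submodule ℂ H) : Z →L[ℂ] ↥(Vs ⊔ Z) :=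
  Z.subtypeL.codRestrict (Vs ⊔ Z) (fun z => Submodule.mem_sup_right z.2)

/-- `a^h_{jk}(z, z') = a''_{jk}(z, z') - a_0(N^j z, N^k z')`. -/
noncomputable def ah [CompleteSpace H] (h1 : S.H1) {Vs Z : Submodule ℂ H} (a' : Fin n → Form ↥(Vs ⊔ Z) H)
    (a'' : Fin n → Fin n → Form ↥(Vs ⊔ Z) ↥(Vs ⊔ Z)) (j k : Fin n) : Form Z Z :=
  (a'' j k).bilinearComp (inclZ Vs Z) (inclZ Vs Z) -
    (S.a 0).bilinearComp ((S.corrector h1 a' j).comp (inclZ Vs Z))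
      ((S.corrector h1 a' k).comp (inclZ Vs Z))

/-- The form domain `H¹(ℝⁿ; (Z, b_0)) ∔ L²(ℝⁿ; V_⋆)`; an element of it is given by
`((u, ∇u), v)`. -/
abbrev FormDomain (Vs Z : Submodule ℂ H) : Type _ :=
  ↥(sobolev n Z (S.b 0)) × Lp Vs 2 (volume : Measure (Pt n))

/-- The function `u + v` in `L²(ℝⁿ; H)` of an element of the form domain. -/
noncomputable def value (Vs Z : Submodule ℂ H) :
    S.FormDomain Vs Z →ₗ[ℂ] Lp H 2 (volume : Measure (Pt n)) :=
  (Z.subtypeL.compLpL 2 (volume : Measure (Pt n))).toLinearMap ∘ₗ LinearMap.fst ℂ _ _ ∘ₗ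
      (sobolev n Z (S.b 0)).subtype ∘ₗ LinearMap.fst ℂ _ _ +
    (Vs.subtypeL.compLpL 2 (volume : Measure (Pt n))).toLinearMap ∘ₗ LinearMap.snd ℂ _ _

/-- The bivariate form
`Q(u + v, u' + v') = ∫ ∑_{jk} a^h_{jk}(∂_j u, ∂_k u') dx + ∫ b_0(u + v, u' + v') dx`. -/
noncomputable def Q [CompleteSpace H] (h1 : S.H1) {Vs Z : Submodule ℂ H} (a' : Fin n → Form ↥(Vs ⊔ Z) H)
    (a'' : Fin n → Fin n → Form ↥(Vs ⊔ Z) ↥(Vs ⊔ Z)) :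
    S.FormDomain Vs Z →ₗ[ℂ] S.FormDomain Vs Z →ₗ⋆[ℂ] ℂ :=
  LinearMap.mk₂'ₛₗ (RingHom.id ℂ) (starRingEnd ℂ)
    (fun m m' => (∑ j, ∑ k, intForm (S.ah h1 a' a'' j k) (m.1.1.2 j) (m'.1.1.2 k)) +
      intForm (S.b 0) (S.value Vs Z m) (S.value Vs Z m'))
    (fun m₁ m₂ m' => by
      simp only [Prod.fst_add, Submodule.coe_add, Prod.snd_add, Pi.add_apply, map_add,
        LinearMap.add_apply, Finset.sum_add_distrib]
      ring)
    (fun c m m' => by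
      simp only [Prod.smul_fst, Submodule.coe_smul, Prod.smul_snd, Pi.smul_apply, map_smul,
        LinearMap.smul_apply, smul_eq_mul, mul_add, Finset.mul_sum, RingHom.id_apply])
    (fun m m₁ m₂ => by
      simp only [Prod.fst_add, Submodule.coe_add, Prod.snd_add, Pi.add_apply, map_add,
        Finset.sum_add_distrib]
      ring)
    (fun c m m' => by
      simp only [Prod.smul_fst, Submodule.coe_smul, Prod.smul_snd, Pi.smul_apply, map_smul,
        LinearMap.map_smulₛₗ, smul_eq_mul, mul_add, Finset.mul_sum])

/-- `𝓗_0`, the closure of `V_0 = V_⋆ ∔ Z` in `𝓗`. -/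
abbrev H0 (Vs Z : Submodule ℂ H) : Submodule ℂ 𝓗 :=
  ((Vs ⊔ Z).map S.ι.toLinearMap).topologicalClosure

/-- The Hilbert space `L²(ℝⁿ; 𝓗_0)`, as a closed subspace of `L²(ℝⁿ; 𝓗)`. -/
abbrev LH0 (Vs Z : Submodule ℂ H) : Submodule ℂ (Lp 𝓗 2 (volume : Measure (Pt n))) :=
  lpIn n (S.H0 Vs Z)

instance completeSpace_LH0 [CompleteSpace 𝓗] (Vs Z : Submodule ℂ H) : CompleteSpace (S.LH0 Vs Z) :=
  (isClosed_lpIn (Submodule.isClosed_topologicalClosure _)).completeSpace_coe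

/-- The embedding of the form domain of `Q` into `L²(ℝⁿ; 𝓗_0)`. -/
noncomputable def embed (Vs Z : Submodule ℂ H) : S.FormDomain Vs Z →ₗ[ℂ] S.LH0 Vs Z :=
  LinearMap.codRestrict (S.LH0 Vs Z)
    ((S.ι.compLpL 2 (volume : Measure (Pt n))).toLinearMap ∘ₗ S.value Vs Z) (fun m => by
      have h1 := S.ι.coeFn_compLp (S.value Vs Z m)
      have h2 := Lp.coeFn_add (Z.subtypeL.compLp m.1.1.1) (Vs.subtypeL.compLp m.2)
      have h3 := Z.subtypeL.coeFn_compLp m.1.1.1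
      have h4 := Vs.subtypeL.coeFn_compLp m.2
      have : ∀ᵐ x, S.ι.compLp (S.value Vs Z m) x ∈ S.H0 Vs Z := by
        filter_upwards [h1, h2, h3, h4] with x e1 e2 e3 e4
        rw [e1]
        refine Submodule.le_topologicalClosure _ (Submodule.mem_map_of_mem ?_)
        have e5 : S.value Vs Z m x = (m.1.1.1 x : H) + (m.2 x : H) := by
          refine Eq.trans e2 ?_
          rw [Pi.add_apply, e3, e4]
          rfl
        rw [e5]
        exact Submodule.add_mem _ (Submodule.mem_sup_right (m.1.1.1 x).2)
          (Submodule.mem_sup_left (m.2 x).2)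
      exact this)

/-- The bivariate operator `𝓛` in `L²(ℝⁿ; 𝓗_0)`, generated by `Q`. -/
noncomputable def bivariate [CompleteSpace H] (h1 : S.H1) {Vs Z : Submodule ℂ H}
    (a' : Fin n → Form ↥(Vs ⊔ Z) H) (a'' : Fin n → Fin n → Form ↥(Vs ⊔ Z) ↥(Vs ⊔ Z)) :
    S.LH0 Vs Z →ₗ.[ℂ] S.LH0 Vs Z :=
  formOperator (S.Q h1 a' a'') (S.embed Vs Z) (innerForm (S.LH0 Vs Z))

/-- The orthogonal projection `𝓟` of `L²(ℝⁿ; (𝓗, d_0))` onto `L²(ℝⁿ; 𝓗_0)`. -/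
noncomputable def proj [CompleteSpace 𝓗] (Vs Z : Submodule ℂ H) :
    Lp 𝓗 2 (volume : Measure (Pt n)) →L[ℂ] S.LH0 Vs Z :=
  (S.LH0 Vs Z).orthogonalProjectionOnto

/-- The fibre operator `𝓛_{ε,θ}` in `(𝓗, d_θ)`, generated by the form `ε⁻² a_θ + b_θ` with form
domain `H`. -/
noncomputable def fibreOp (ε : ℝ) (θ : Pt n) : 𝓗 →ₗ.[ℂ] 𝓗 :=
  formOperator (Form.toSesq (((ε : ℂ) ^ 2)⁻¹ • S.a θ + S.b θ)) S.ι.toLinearMap (S.d θ)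

theorem norm_sq_le : ∃ K > 0, ∀ θ ∈ S.Θ, ∀ u, ‖u‖ ≤ K * √(qf (S.d θ) u) := by
  obtain ⟨K, hK, h⟩ := S.d_equiv
  refine ⟨√K, Real.sqrt_pos.mpr hK, fun θ hθ u => ?_⟩
  rw [← Real.sqrt_mul hK.le]
  refine Real.le_sqrt_of_sq_le ?_
  have h1 := h 0 S.zero_mem θ hθ u
  have h2 : qf (S.d 0) u = ‖u‖ ^ 2 := by
    rw [qf, S.d_zero]
    exact inner_self_eq_norm_sq (𝕜 := ℂ) u
  rwa [h2] at h1

theorem qf_zero (u : 𝓗) : √(qf (S.d 0) u) = ‖u‖ := by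
  rw [qf, S.d_zero]
  rw [show (inner ℂ u u).re = ‖u‖ ^ 2 from inner_self_eq_norm_sq (𝕜 := ℂ) u,
    Real.sqrt_sq (norm_nonneg _)]

variable {S} in
theorem H6.continuousOn {Vs : Submodule ℂ H} {e : Pt n → Vs →ₗ[ℂ] H} {E : Pt n → 𝓗 ≃L[ℂ] 𝓗}
    (h6 : S.H6 Vs e E) : ContinuousOn (fun θ => (E θ : 𝓗 →L[ℂ] 𝓗)) S.Θ := by
  obtain ⟨-, -, -, K, hK, h⟩ := h6
  obtain ⟨C, hC, hn⟩ := S.norm_sq_le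
  refine LipschitzOnWith.continuousOn (K := ⟨C * K, mul_nonneg hC.le hK⟩)
    (LipschitzOnWith.of_dist_le_mul fun θ₁ h₁ θ₂ h₂ => ?_)
  rw [dist_eq_norm, dist_eq_norm]
  refine ContinuousLinearMap.opNorm_le_bound _
    (mul_nonneg (mul_nonneg hC.le hK) (norm_nonneg _)) fun u => ?_
  refine (hn θ₁ h₁ _).trans ?_
  have h3 := h θ₁ h₁ θ₂ h₂ u
  rw [S.qf_zero] at h3
  calc C * √(qf (S.d θ₁) (E θ₁ u - E θ₂ u)) ≤ C * (K * ‖θ₁ - θ₂‖ * ‖u‖) := by gcongr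
    _ = (C * K) * ‖θ₁ - θ₂‖ * ‖u‖ := by ring

variable {S} in
theorem H6.continuousOn_symm [CompleteSpace 𝓗] {Vs : Submodule ℂ H} {e : Pt n → Vs →ₗ[ℂ] H}
    {E : Pt n → 𝓗 ≃L[ℂ] 𝓗} (h6 : S.H6 Vs e E) :
    ContinuousOn (fun θ => ((E θ).symm : 𝓗 →L[ℂ] 𝓗)) S.Θ := by
  intro θ hθ
  have h1 := h6.continuousOn θ hθ
  have h2 : ContinuousAt ContinuousLinearMap.inverse (E θ : 𝓗 →L[ℂ] 𝓗) :=
    (contDiffAt_map_inverse (𝕜 := ℂ) (n := 0) (E θ)).continuousAt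
  have h3 : ContinuousWithinAt
      (fun x => ContinuousLinearMap.inverse (E x : 𝓗 →L[ℂ] 𝓗)) S.Θ θ := h2.tendsto.comp h1
  refine h3.congr (fun x _ => ?_) ?_
  · exact (ContinuousLinearMap.inverse_equiv (E x)).symm
  · exact (ContinuousLinearMap.inverse_equiv (E θ)).symm

/-- The connecting operator `A_ε = Γ_ε⁻¹ 𝓕⁻¹ χ 𝓔⁻¹`, with `𝓔` the operator of multiplication
by `E_θ`. -/
noncomputable def connect [CompleteSpace 𝓗] {Vs : Submodule ℂ H} {e : Pt n → Vs →ₗ[ℂ] H} {E : Pt n → 𝓗 ≃L[ℂ] 𝓗}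
    (h6 : S.H6 Vs e E) {ε : ℝ} (hε : 0 < ε)
    (g : Lp 𝓗 2 ((volume : Measure (Pt n)).restrict S.Θ)) : Lp 𝓗 2 (volume : Measure (Pt n)) :=
  (dilation hε).symm (fourier.symm
    (extendZero S.isCompact.measurableSet (fibrewise S.isCompact h6.continuousOn_symm g)))

/-- The operator `A_ε^* = 𝓔 χ^* 𝓕 Γ_ε`. -/
noncomputable def connectAdj [CompleteSpace 𝓗] {Vs : Submodule ℂ H} {e : Pt n → Vs →ₗ[ℂ] H}
    {E : Pt n → 𝓗 ≃L[ℂ] 𝓗} (h6 : S.H6 Vs e E) {ε : ℝ} (hε : 0 < ε)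
    (f : Lp 𝓗 2 (volume : Measure (Pt n))) : Lp 𝓗 2 ((volume : Measure (Pt n)).restrict S.Θ) :=
  fibrewise S.isCompact h6.continuousOn (restrictTo S.Θ (fourier (dilation hε f)))

end Setting

end Abstract

end Bivariate

open Bivariate

/-! After rescaling and Fourier transform every operator in the statement acts fibrewise. The limit
operator decouples into one problem for each frequency `ξ`: find `v` in `V_⋆` and `z` in `Z` with
`s_ξ(z, z') + b_0(v + z, v' + z') = d_0(f, v' + z')`, where `s_ξ = ∑ ξ_j ξ_k a^h_{jk}` is the symbol
(`IsFibreSol`). The operator `A_ε` puts `E_θ⁻¹ g(θ)` at the frequency `ξ = θ/ε`, and `A_ε^*` brings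
the solution back. Everything therefore reduces to one uniform estimate (`exists_fibre_estimate`):
for `θ ≠ 0`, the solution `u` of `ε⁻² a_θ(u, ·) + b_θ(u, ·) = d_θ(f, ·)` and `E_θ(v + z)` differ by
at most `C ε ‖f‖`.

For small `θ` the approximation of `u` is `e_θ v + z + ∑ θ_j N^j z`. The term `e_θ v` lies in the
kernel of `a_θ`, so the large factor `ε⁻²` does not see it. The corrector cancels the first order
term of `a_θ(z, w)` for `w` in `W_0`, and against `Z` it turns `ε⁻² a_θ` into the symbol at `θ/ε` up
to a cubic error. The residual is tested on the dense sum of `V^⋆_θ`, `Z` and `W_0`, and in each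
direction it gains one factor `ε`: - on `V^⋆_θ` it is `O(‖θ‖ ‖z‖)`, and ellipticity of the symbol
gives `‖θ‖ ‖z‖ = O(ε ‖f‖)` (`exists_fibreSol_le`); - on `Z` and `W_0` it is bounded by `‖f‖` times
`‖θ‖ ‖z'‖` and `‖w'‖` respectively, and both of these are at most `C ε` times the energy norm of the
test function (`exists_coercive_near`).

Coercivity near zero combines the quadratic gap on `W_θ`, the gap of `a_0` on `W_0`, and the fact
that the three subspaces stay uniformly transversal for small `θ`. Applied to `z + ∑ θ_j N^j z` and
rescaled, it also yields ellipticity of the symbol (`exists_symbol_coercive`). Away from `θ = 0` the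
gap is uniform, `z` itself is `O(ε)`, and `e_θ v` alone is close enough.

Self-adjointness and bijectivity of the limit operator need no closedness argument: the fibre
problems are solved explicitly, so the operator is symmetric and onto, and a symmetric operator
which is onto is self-adjoint. -/

namespace Bivariate

/-! ### Dilations and the Fourier transform of vector-valued `L²` functions -/

section Fourier

open scoped SchwartzMap FourierTransform

variable {n : ℕ}

section Dilation

variable {F G : Type*} [NormedAddCommGroup F] [NormedSpace ℂ F] [NormedAddCommGroup G]
  [NormedSpace ℂ G]

theorem coeFn_dilation {ε : ℝ} (hε : 0 < ε) (f : Lp F 2 (volume : Measure (Pt n))) :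
    dilation hε f =ᵐ[volume] fun x => ε ^ ((n : ℝ) / 2) • f (ε • x) :=
  (memLp_dilate hε f).coeFn_toLp

theorem dilation_symm {ε : ℝ} (hε : 0 < ε) (f : Lp F 2 (volume : Measure (Pt n))) :
    (dilation hε).symm f = dilation (inv_pos.mpr hε) f := rfl

theorem dilation_compLp {ε : ℝ} (hε : 0 < ε) (T : F →L[ℂ] G)
    (f : Lp F 2 (volume : Measure (Pt n))) :
    dilation hε (T.compLp f) = T.compLp (dilation hε f) := by
  apply Lp.ext
  filter_upwards [coeFn_dilation hε (T.compLp f), coeFn_dilation hε f,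
    T.coeFn_compLp (dilation hε f), ae_dilate hε (T.coeFn_compLp f)] with x h1 h2 h3 h4
  rw [h1, h3, h2, h4, ← Complex.coe_smul, ← Complex.coe_smul, map_smul]

theorem dilation_comm {ε δ : ℝ} (hε : 0 < ε) (hδ : 0 < δ)
    (f : Lp F 2 (volume : Measure (Pt n))) :
    dilation hε (dilation hδ f) = dilation hδ (dilation hε f) := by
  apply Lp.ext
  filter_upwards [coeFn_dilation hε (dilation hδ f), coeFn_dilation hδ (dilation hε f),
    ae_dilate hε (coeFn_dilation hδ f), ae_dilate hδ (coeFn_dilation hε f)] with x h1 h2 h3 h4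
  rw [h1, h2, h3, h4, smul_comm, smul_comm ε δ x]

end Dilation

/-- Riesz representation in the values turns the form into a bounded operator. Plancherel for the
inner product then gives Plancherel for every bounded form, as soon as bounded operators commute
with the Fourier transform. -/
theorem intForm_eq_inner {F G : Type*} [NormedAddCommGroup F] [NormedSpace ℂ F]
    [NormedAddCommGroup G] [InnerProductSpace ℂ G] [CompleteSpace G] (B : Form F G) (f : Lp F 2 (volume : Measure (Pt n)))
    (g : Lp G 2 (volume : Measure (Pt n))) :
    intForm B f g = inner ℂ g (((riesz (W := G)).comp B).compLp f) := by
  rw [L2.inner_def]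
  refine integral_congr_ae ?_
  filter_upwards [((riesz (W := G)).comp B).coeFn_compLp f] with x hx
  rw [hx]
  exact (inner_riesz (B (f x)) (g x)).symm

/-- Written as a fixed point equation of a pointwise operator, the condition is visibly preserved by
the Fourier transform. -/
theorem mem_lpIn {F : Type*} [NormedAddCommGroup F] [InnerProductSpace ℂ F] {K : Submodule ℂ F} [K.HasOrthogonalProjection]
    {f : Lp F 2 (volume : Measure (Pt n))} : f ∈ lpIn n K ↔ K.starProjection.compLp f = f := by
  constructor
  · intro h
    apply Lp.ext
    have h' : ∀ᵐ x, f x ∈ K := h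
    filter_upwards [K.starProjection.coeFn_compLp f, h'] with x h1 h2
    rw [h1, Submodule.starProjection_eq_self_iff.mpr h2]
  · intro h
    have : ∀ᵐ x, f x ∈ K := by
      filter_upwards [K.starProjection.coeFn_compLp f] with x h1
      rw [h] at h1
      rw [h1]
      exact Submodule.starProjection_apply_mem _ _
    exact this

variable {F G : Type*} [NormedAddCommGroup F] [InnerProductSpace ℂ F] [CompleteSpace F]
  [NormedAddCommGroup G] [InnerProductSpace ℂ G] [CompleteSpace G]

/-- On Schwartz functions `T` can be pulled out of the Fourier integral. Both sides are continuous
in `f` and Schwartz functions are dense in `L²`. -/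
theorem fourierTransform_compLp (T : F →L[ℂ] G) (f : Lp F 2 (volume : Measure (Pt n))) :
    Lp.fourierTransformₗᵢ (Pt n) G (T.compLp f) = T.compLp (Lp.fourierTransformₗᵢ (Pt n) F f) := by
  refine DenseRange.induction_on
    (p := fun f => Lp.fourierTransformₗᵢ (Pt n) G (T.compLp f) =
      T.compLp (Lp.fourierTransformₗᵢ (Pt n) F f))
    (SchwartzMap.denseRange_toLpCLM (p := 2) ENNReal.ofNat_ne_top) f ?_ ?_
  · exact isClosed_eq
      ((Lp.fourierTransformₗᵢ (Pt n) G).continuous.comp (T.compLpL 2 volume).continuous)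
      ((T.compLpL 2 volume).continuous.comp (Lp.fourierTransformₗᵢ (Pt n) F).continuous)
  · intro f
    have key : ∀ f : 𝓢(Pt n, F), T.compLp (f.toLp 2 (volume : Measure (Pt n))) =
        (SchwartzMap.postcompCLM T f).toLp 2 volume := by
      intro f
      apply Lp.ext
      filter_upwards [T.coeFn_compLp (f.toLp 2 (volume : Measure (Pt n))),
        f.coeFn_toLp 2 (volume : Measure (Pt n)),
        (SchwartzMap.postcompCLM T f).coeFn_toLp 2 (volume : Measure (Pt n))] with x h1 h2 h3
      rw [h1, h2, h3, SchwartzMap.postcompCLM_apply]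
    have hF : ∀ f : 𝓢(Pt n, F), Lp.fourierTransformₗᵢ (Pt n) F (f.toLp 2 volume) =
      (𝓕 f).toLp 2 volume := fun f => SchwartzMap.toLp_fourier_eq f
    have hG : ∀ f : 𝓢(Pt n, G), Lp.fourierTransformₗᵢ (Pt n) G (f.toLp 2 volume) =
      (𝓕 f).toLp 2 volume := fun f => SchwartzMap.toLp_fourier_eq f
    rw [SchwartzMap.toLpCLM_apply, key, hG, hF, key]
    congr 1
    ext ξ
    rw [SchwartzMap.postcompCLM_apply, SchwartzMap.fourier_coe, SchwartzMap.fourier_coe,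
      Real.fourier_eq, Real.fourier_eq, ← T.integral_comp_comm]
    · refine integral_congr_ae (Eventually.of_forall fun x => ?_)
      simp only [SchwartzMap.postcompCLM_apply, Circle.smul_def, map_smul]
    · exact (Real.fourierIntegral_convergent_iff ξ).2 f.integrable

/-- A change of variables on Schwartz functions, extended by density. The Jacobian `ε^{-n}` turns
the normalisation `ε^{n/2}` into `ε^{-n/2}`, that of the inverse dilation. -/
theorem fourierTransform_dilation {ε : ℝ} (hε : 0 < ε) (f : Lp F 2 (volume : Measure (Pt n))) :
    Lp.fourierTransformₗᵢ (Pt n) F (dilation hε f) =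
      (dilation hε).symm (Lp.fourierTransformₗᵢ (Pt n) F f) := by
  refine DenseRange.induction_on
    (p := fun f => Lp.fourierTransformₗᵢ (Pt n) F (dilation hε f) =
      (dilation hε).symm (Lp.fourierTransformₗᵢ (Pt n) F f))
    (SchwartzMap.denseRange_toLpCLM (p := 2) ENNReal.ofNat_ne_top) f ?_ ?_
  · exact isClosed_eq
      ((Lp.fourierTransformₗᵢ (Pt n) F).continuous.comp (dilation hε).continuous)
      ((dilation hε).symm.continuous.comp (Lp.fourierTransformₗᵢ (Pt n) F).continuous)
  · intro f
    have hF : ∀ f : 𝓢(Pt n, F), Lp.fourierTransformₗᵢ (Pt n) F (f.toLp 2 volume) =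
      (𝓕 f).toLp 2 volume := fun f => SchwartzMap.toLp_fourier_eq f
    let D : Pt n ≃L[ℝ] Pt n := ContinuousLinearEquiv.smulLeft (Units.mk0 ε hε.ne')
    let g : 𝓢(Pt n, F) := (ε ^ ((n : ℝ) / 2)) • SchwartzMap.compCLMOfContinuousLinearEquiv ℂ D f
    have hg : ∀ x, g x = ε ^ ((n : ℝ) / 2) • f (ε • x) := fun x => rfl
    have h1 : dilation hε (f.toLp 2 (volume : Measure (Pt n))) = g.toLp 2 volume := by
      apply Lp.ext
      filter_upwards [coeFn_dilation hε (f.toLp 2 (volume : Measure (Pt n))),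
        ae_dilate hε (f.coeFn_toLp 2 (volume : Measure (Pt n))),
        g.coeFn_toLp 2 (volume : Measure (Pt n))] with x h1 h2 h3
      rw [h1, h2, h3, hg]
    rw [SchwartzMap.toLpCLM_apply, h1, hF, hF, dilation_symm]
    apply Lp.ext
    filter_upwards [coeFn_dilation (inv_pos.mpr hε) ((𝓕 f).toLp 2 (volume : Measure (Pt n))),
        ae_dilate (inv_pos.mpr hε) ((𝓕 f).coeFn_toLp 2 (volume : Measure (Pt n))),
        (𝓕 g).coeFn_toLp 2 (volume : Measure (Pt n))] with x h1 h2 h3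
    rw [h1, h2, h3, SchwartzMap.fourier_coe, SchwartzMap.fourier_coe, Real.fourier_eq,
      Real.fourier_eq]
    have h4 := Measure.integral_comp_smul_of_nonneg (volume : Measure (Pt n))
      (fun v => Real.fourierChar (-inner ℝ v (ε⁻¹ • x)) • f v) ε (hR := hε.le)
    have h5 : ∀ v : Pt n, inner ℝ (ε • v) (ε⁻¹ • x) = inner ℝ v x := by
      intro v
      rw [real_inner_smul_left, real_inner_smul_right, ← mul_assoc, mul_inv_cancel₀ hε.ne', one_mul]
    simp only [h5, finrank_euclideanSpace_fin] at h4
    simp only [hg]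
    have h6 : ∀ v : Pt n, Real.fourierChar (-inner ℝ v x) • ε ^ ((n : ℝ) / 2) • f (ε • v) =
        ε ^ ((n : ℝ) / 2) • Real.fourierChar (-inner ℝ v x) • f (ε • v) :=
      fun v => smul_comm _ _ _
    simp only [h6]
    rw [integral_smul, h4, smul_smul]
    congr 1
    rw [Real.inv_rpow hε.le, ← Real.rpow_natCast, ← Real.rpow_neg hε.le, ← Real.rpow_neg hε.le,
      ← Real.rpow_add hε]
    congr 1
    ring

theorem fourier_eq_dilation (f : Lp F 2 (volume : Measure (Pt n))) :
    fourier f = dilation (inv_pos.mpr Real.two_pi_pos) (Lp.fourierTransformₗᵢ (Pt n) F f) := rfl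

theorem fourier_compLp (T : F →L[ℂ] G) (f : Lp F 2 (volume : Measure (Pt n))) :
    fourier (T.compLp f) = T.compLp (fourier f) := by
  rw [fourier_eq_dilation, fourierTransform_compLp, dilation_compLp, fourier_eq_dilation]

theorem fourier_dilation {ε : ℝ} (hε : 0 < ε) (f : Lp F 2 (volume : Measure (Pt n))) :
    fourier (dilation hε f) = (dilation hε).symm (fourier f) := by
  rw [fourier_eq_dilation, fourierTransform_dilation, dilation_symm, dilation_comm,
    fourier_eq_dilation, dilation_symm]

/-- Plancherel's identity for integrated forms. -/
theorem intForm_fourier (B : Form F G) (f : Lp F 2 (volume : Measure (Pt n)))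
    (g : Lp G 2 (volume : Measure (Pt n))) :
    intForm B (fourier f) (fourier g) = intForm B f g := by
  rw [intForm_eq_inner, intForm_eq_inner, ← fourier_compLp, LinearIsometryEquiv.inner_map_map]

theorem fourier_mem_lpIn {K : Submodule ℂ F} [K.HasOrthogonalProjection]
    {f : Lp F 2 (volume : Measure (Pt n))} (hf : f ∈ lpIn n K) : fourier f ∈ lpIn n K := by
  rw [mem_lpIn] at hf ⊢
  rw [← fourier_compLp, hf]

end Fourier

/-! ### Weak derivatives as distributional derivatives -/

section WeakDerivative

open scoped SchwartzMap FourierTransform LineDeriv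

variable {n : ℕ} {F : Type*} [NormedAddCommGroup F] [NormedSpace ℂ F]

/-- `w` is the generalised derivative of `u` in direction `m`. -/
def IsWeakDeriv (u w : Lp F 2 (volume : Measure (Pt n))) (m : Pt n) : Prop :=
  ∀ φ : Pt n → ℝ, ContDiff ℝ ∞ φ → HasCompactSupport φ →
    ∫ x, fderiv ℝ φ x m • u x = - ∫ x, φ x • w x

theorem integrable_smul_lp {ρ : Pt n → ℝ} (hρ : MemLp ρ 2 volume)
    (u : Lp F 2 (volume : Measure (Pt n))) : Integrable (fun x => ρ x • u x) volume := by
  have h : MemLp (fun x => (ρ x : ℂ)) 2 volume := Complex.ofRealCLM.comp_memLp' hρ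
  have h1 : Integrable ((fun x => (ρ x : ℂ)) • (u : Pt n → F)) volume :=
    memLp_one_iff_integrable.mp ((Lp.memLp u).smul h)
  exact h1.congr (Eventually.of_forall fun x => Complex.coe_smul (ρ x) (u x))

theorem integrable_continuous_smul (u : Lp F 2 (volume : Measure (Pt n))) {φ : Pt n → ℝ}
    (hφ : Continuous φ) (hc : HasCompactSupport φ) : Integrable (fun x => φ x • u x) volume :=
  ((Lp.memLp u).locallyIntegrable (by norm_num)).integrable_smul_left_of_hasCompactSupport hφ hc

/-- Removes the compact support of the test function, so that Schwartz functions become admissible.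
Multiply `ρ` by the cut-off `χ(c_k x)` with `c_k → 0` and use dominated convergence. The term in
which the cut-off is differentiated carries a factor `c_k` and disappears. -/
theorem IsWeakDeriv.integral_eq {u w : Lp F 2 (volume : Measure (Pt n))} {m : Pt n}
    (h : IsWeakDeriv u w m) {ρ : Pt n → ℝ} (hρ : ContDiff ℝ ∞ ρ) (h0 : MemLp ρ 2 volume)
    (h1 : MemLp (fun x => fderiv ℝ ρ x m) 2 volume) :
    ∫ x, fderiv ℝ ρ x m • u x = - ∫ x, ρ x • w x := by
  let χ : ContDiffBump (0 : Pt n) := ⟨1, 2, one_pos, one_lt_two⟩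
  have hχ : ContDiff ℝ ∞ χ := χ.contDiff
  have hχd : Continuous (fun x => fderiv ℝ χ x m) :=
    (hχ.continuous_fderiv (by simp)).clm_apply continuous_const
  obtain ⟨M, hM⟩ : ∃ M, ∀ x, ‖fderiv ℝ χ x m‖ ≤ M :=
    ((χ.hasCompactSupport.fderiv ℝ).comp_left
      (g := fun L : Pt n →L[ℝ] ℝ => L m) (by simp)).exists_bound_of_continuous hχd
  have hM0 : 0 ≤ M := (norm_nonneg _).trans (hM 0)
  let c : ℕ → ℝ := fun k => 1 / ((k : ℝ) + 1)
  have hc : Tendsto c atTop (𝓝 0) := tendsto_one_div_add_atTop_nhds_zero_nat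
  have hc0 : ∀ k, 0 < c k := fun k => by positivity
  have hc1 : ∀ k, c k ≤ 1 := fun k => by
    rw [div_le_one (by positivity)]
    linarith [(Nat.cast_nonneg k : (0 : ℝ) ≤ k)]
  let φ : ℕ → Pt n → ℝ := fun k x => χ (c k • x) * ρ x
  have hφ : ∀ k, ContDiff ℝ ∞ (φ k) := fun k => (hχ.comp (contDiff_const_smul (c k))).mul hρ
  have hφc : ∀ k, HasCompactSupport (φ k) := fun k =>
    HasCompactSupport.mul_right (χ.hasCompactSupport.comp_smul (hc0 k).ne')
  have hφd : ∀ k x, fderiv ℝ (φ k) x m =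
      χ (c k • x) * fderiv ℝ ρ x m + c k * fderiv ℝ χ (c k • x) m * ρ x := by
    intro k x
    have e1 : HasFDerivAt (fun x => χ (c k • x))
        ((fderiv ℝ χ (c k • x)).comp (c k • ContinuousLinearMap.id ℝ (Pt n))) x :=
      HasFDerivAt.comp (g := χ) x ((hχ.differentiable (by simp)) (c k • x)).hasFDerivAt
        ((hasFDerivAt_id x).const_smul (c k))
    have e2 : HasFDerivAt (φ k) _ x := e1.mul ((hρ.differentiable (by simp)) x).hasFDerivAt
    rw [e2.fderiv]
    simp
    ring
  have hx : ∀ x : Pt n, Tendsto (fun k => c k • x) atTop (𝓝 0) := fun x => by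
    simpa using hc.smul_const x
  have hχt : ∀ x : Pt n, Tendsto (fun k => χ (c k • x)) atTop (𝓝 1) := fun x => by
    have := (χ.continuous.tendsto 0).comp (hx x)
    rwa [χ.one_of_mem_closedBall (by simp [χ.rIn_pos.le])] at this
  have hχ1 : ∀ x, ‖χ x‖ ≤ 1 := fun x => by
    rw [Real.norm_of_nonneg χ.nonneg]
    exact χ.le_one
  have l1 : Tendsto (fun k => ∫ x, φ k x • w x) atTop (𝓝 (∫ x, ρ x • w x)) := by
    refine tendsto_integral_of_dominated_convergence (fun x => ‖ρ x • w x‖) (fun k => ?_)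
      (integrable_smul_lp h0 w).norm (fun k => Eventually.of_forall fun x => ?_)
      (Eventually.of_forall fun x => ?_)
    · exact (hφ k).continuous.aestronglyMeasurable.smul (Lp.aestronglyMeasurable w)
    · rw [norm_smul, norm_smul, norm_mul]
      gcongr
      exact mul_le_of_le_one_left (norm_nonneg _) (hχ1 _)
    · simpa using ((hχt x).mul_const (ρ x)).smul_const (w x)
  have l2 : Tendsto (fun k => ∫ x, fderiv ℝ (φ k) x m • u x) atTop
      (𝓝 (∫ x, fderiv ℝ ρ x m • u x)) := by
    refine tendsto_integral_of_dominated_convergence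
      (fun x => ‖fderiv ℝ ρ x m • u x‖ + M * ‖ρ x • u x‖) (fun k => ?_)
      ((integrable_smul_lp h1 u).norm.add ((integrable_smul_lp h0 u).norm.const_mul M))
      (fun k => Eventually.of_forall fun x => ?_)
      (Eventually.of_forall fun x => ?_)
    · exact (((hφ k).continuous_fderiv (by simp)).clm_apply
        continuous_const).aestronglyMeasurable.smul (Lp.aestronglyMeasurable u)
    · rw [hφd, add_smul]
      refine (norm_add_le _ _).trans (add_le_add ?_ ?_)
      · rw [norm_smul, norm_smul, norm_mul]
        gcongr
        exact mul_le_of_le_one_left (norm_nonneg _) (hχ1 _)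
      · rw [norm_smul, norm_smul, norm_mul, norm_mul, ← mul_assoc]
        gcongr
        rw [← one_mul M]
        exact mul_le_mul (by rw [Real.norm_of_nonneg (hc0 k).le]; exact hc1 k) (hM _)
          (norm_nonneg _) zero_le_one
    · have e1 : Tendsto (fun k => c k * fderiv ℝ χ (c k • x) m * ρ x) atTop (𝓝 0) := by
        have := (hc.mul ((hχd.tendsto 0).comp (hx x))).mul_const (ρ x)
        simpa using this
      have e2 := (((hχt x).mul_const (fderiv ℝ ρ x m)).add e1).smul_const (u x)
      simp only [hφd]
      simpa using e2
  refine tendsto_nhds_unique l2 ?_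
  refine l1.neg.congr fun k => ?_
  exact (h (φ k) (hφ k) (hφc k)).symm

/-- The two notions differ in their test functions: real with compact support on one side, complex
Schwartz functions on the other. The former embed into the latter. Conversely, the real and
imaginary parts of a Schwartz function and their derivatives are in `L²`, hence admissible by the
cut-off argument. -/
theorem isWeakDeriv_iff [CompleteSpace F] {u w : Lp F 2 (volume : Measure (Pt n))} {m : Pt n} :
    IsWeakDeriv u w m ↔ ∂_{m} (u : 𝓢'(Pt n, F)) = (w : 𝓢'(Pt n, F)) := by
  constructor
  · intro h
    ext φ
    rw [TemperedDistribution.lineDerivOp_apply_apply, Lp.toTemperedDistribution_apply,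
      Lp.toTemperedDistribution_apply]
    have hφ : ContDiff ℝ ∞ φ := φ.smooth'
    -- The functional `L` stands for the real part or the imaginary part; both are treated at once.
    have key : ∀ L : ℂ →L[ℝ] ℝ,
        MemLp (fun x => L (φ x)) 2 volume ∧ MemLp (fun x => L ((∂_{m} φ) x)) 2 volume ∧
        ∫ x, L ((∂_{m} φ) x) • u x = - ∫ x, L (φ x) • w x := by
      intro L
      have m0 : MemLp (fun x => L (φ x)) 2 volume :=
        L.comp_memLp' (φ.memLp 2 volume)
      have m1 : MemLp (fun x => L ((∂_{m} φ) x)) 2 volume :=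
        L.comp_memLp' ((∂_{m} φ).memLp 2 volume)
      have e : (fun x => L ((∂_{m} φ) x)) = fun x => fderiv ℝ (fun x => L (φ x)) x m := by
        funext x
        have := L.hasFDerivAt.comp x ((hφ.differentiable (by simp)) x).hasFDerivAt
        rw [SchwartzMap.lineDerivOp_apply_eq_fderiv]
        exact congrArg (fun T => T m) this.fderiv.symm
      refine ⟨m0, m1, ?_⟩
      rw [e] at m1
      refine Eq.trans ?_ (h.integral_eq (L.contDiff.comp hφ) m0 m1)
      exact congrArg (fun g : Pt n → ℝ => ∫ x, g x • u x) e
    have split : ∀ (ψ : Pt n → ℂ) (g : Lp F 2 (volume : Measure (Pt n))),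
        MemLp (fun x => Complex.reCLM (ψ x)) 2 volume →
        MemLp (fun x => Complex.imCLM (ψ x)) 2 volume →
        ∫ x, ψ x • g x = (∫ x, Complex.reCLM (ψ x) • g x) +
          Complex.I • ∫ x, Complex.imCLM (ψ x) • g x := by
      intro ψ g h1 h2
      rw [← integral_smul]
      refine Eq.trans ?_ (integral_add (integrable_smul_lp h1 g)
        ((integrable_smul_lp h2 g).smul Complex.I))
      refine integral_congr_ae (Eventually.of_forall fun x => ?_)
      simp only [Complex.reCLM_apply, Complex.imCLM_apply]
      rw [← Complex.coe_smul (ψ x).re, ← Complex.coe_smul (ψ x).im, smul_smul, ← add_smul]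
      congr 1
      rw [mul_comm]
      exact (Complex.re_add_im _).symm
    obtain ⟨a0, a1, a2⟩ := key Complex.reCLM
    obtain ⟨b0, b1, b2⟩ := key Complex.imCLM
    have e1 : ∫ x, (-∂_{m} φ) x • u x = - ∫ x, (∂_{m} φ) x • u x := by
      rw [← integral_neg]
      simp
    rw [e1, split _ _ a1 b1, split _ _ a0 b0, a2, b2]
    simp [add_comm]
  · intro h φ hφ hc
    have hg₁ : HasCompactSupport (Complex.ofRealCLM ∘ φ) := hc.comp_left rfl
    have hg₂ : ContDiff ℝ ∞ (Complex.ofRealCLM ∘ φ) := by fun_prop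
    let ψ : 𝓢(Pt n, ℂ) := hg₁.toSchwartzMap hg₂
    have hψ : ∀ x, ψ x = (φ x : ℂ) := fun x => rfl
    have hψd : ∀ x, (∂_{m} ψ) x = (fderiv ℝ φ x m : ℂ) := by
      intro x
      rw [SchwartzMap.lineDerivOp_apply_eq_fderiv]
      have := Complex.ofRealCLM.hasFDerivAt.comp x ((hφ.differentiable (by simp)) x).hasFDerivAt
      exact congrArg (fun T => T m) this.fderiv
    have h1 := congrArg (fun T : 𝓢'(Pt n, F) => T ψ) h
    simp only [TemperedDistribution.lineDerivOp_apply_apply, Lp.toTemperedDistribution_apply] at h1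
    have e1 : ∫ x, (-∂_{m} ψ) x • u x = - ∫ x, (∂_{m} ψ) x • u x := by
      rw [← integral_neg]
      simp
    rw [e1] at h1
    simp only [hψ, hψd, Complex.coe_smul] at h1
    rw [← h1, neg_neg]

end WeakDerivative

/-! ### The Sobolev space in Fourier variables -/

section SobolevFourier

open scoped SchwartzMap FourierTransform LineDeriv

variable {n : ℕ} {F : Type*} [NormedAddCommGroup F] [InnerProductSpace ℂ F] [CompleteSpace F]

/-- The product of `g` and `u` need not be in `L²`, but it is locally integrable, so equality as
distributions gives equality almost everywhere by testing with smooth functions of compact support.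
-/
theorem smulLeftCLM_eq_iff {g : Pt n → ℂ} (hg : g.HasTemperateGrowth)
    {u w : Lp F 2 (volume : Measure (Pt n))} :
    TemperedDistribution.smulLeftCLM F g (u : 𝓢'(Pt n, F)) = (w : 𝓢'(Pt n, F)) ↔
      ∀ᵐ x, w x = g x • u x := by
  constructor
  · intro h
    have hgc : Continuous g := hg.1.continuous
    have hu : LocallyIntegrable (fun x => g x • u x) (volume : Measure (Pt n)) := by
      rw [locallyIntegrable_iff]
      intro k hk
      exact IntegrableOn.continuousOn_smul
        (((Lp.memLp u).locallyIntegrable (by norm_num)).integrableOn_isCompact hk)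
        hgc.continuousOn hk
    refine ae_eq_of_integral_contDiff_smul_eq
      ((Lp.memLp w).locallyIntegrable (by norm_num)) hu fun φ hφ hc => ?_
    have hg₁ : HasCompactSupport (Complex.ofRealCLM ∘ φ) := hc.comp_left rfl
    have hg₂ : ContDiff ℝ ∞ (Complex.ofRealCLM ∘ φ) := by fun_prop
    let ψ : 𝓢(Pt n, ℂ) := hg₁.toSchwartzMap hg₂
    have hψ : ∀ x, ψ x = (φ x : ℂ) := fun x => rfl
    have h1 := congrArg (fun T : 𝓢'(Pt n, F) => T ψ) h
    simp only [TemperedDistribution.smulLeftCLM_apply_apply, Lp.toTemperedDistribution_apply,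
      SchwartzMap.smulLeftCLM_apply_apply hg, hψ, smul_eq_mul] at h1
    simp only [← Complex.coe_smul, smul_smul]
    rw [← h1]
    simp only [mul_comm]
  · intro h
    ext φ
    rw [TemperedDistribution.smulLeftCLM_apply_apply, Lp.toTemperedDistribution_apply,
      Lp.toTemperedDistribution_apply]
    refine integral_congr_ae ?_
    filter_upwards [h] with x hx
    rw [hx, SchwartzMap.smulLeftCLM_apply_apply hg, smul_eq_mul, smul_smul, mul_comm]

/-- The Fourier transform is injective on tempered distributions and turns the derivative into
multiplication by `2π i η_j`. Since this multiplier has temperate growth, the identity of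
distributions is a pointwise one. -/
theorem isWeakDeriv_iff_fourier {u w : Lp F 2 (volume : Measure (Pt n))} {j : Fin n} :
    IsWeakDeriv u w (EuclideanSpace.single j 1) ↔
      ∀ᵐ ξ, fourier w ξ = (Complex.I * (ξ j : ℂ)) • fourier u ξ := by
  let m : Pt n := EuclideanSpace.single j 1
  have hm : ∀ x : Pt n, inner ℝ x m = x j := fun x => by
    simp [m, EuclideanSpace.inner_single_right]
  let g : Pt n → ℂ := fun x => ((2 * Real.pi * Complex.I) * ((inner ℝ x m : ℝ) : ℂ))
  have hg0 : (fun x : Pt n => ((inner ℝ x m : ℝ) : ℂ)).HasTemperateGrowth := by fun_prop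
  have hg : g.HasTemperateGrowth := by fun_prop
  let δ : ℝ := (2 * Real.pi)⁻¹
  have hδ : 0 < δ := inv_pos.mpr Real.two_pi_pos
  have step1 : IsWeakDeriv u w m ↔
      ∀ᵐ η, Lp.fourierTransformₗᵢ (Pt n) F w η = g η • Lp.fourierTransformₗᵢ (Pt n) F u η := by
    rw [isWeakDeriv_iff, ← smulLeftCLM_eq_iff hg]
    have e1 : ((Lp.fourierTransformₗᵢ (Pt n) F w : Lp F 2 (volume : Measure (Pt n))) :
        𝓢'(Pt n, F)) = 𝓕 (w : 𝓢'(Pt n, F)) := (Lp.fourier_toTemperedDistribution_eq w).symm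
    have e2 : TemperedDistribution.smulLeftCLM F g
        ((Lp.fourierTransformₗᵢ (Pt n) F u : Lp F 2 (volume : Measure (Pt n))) : 𝓢'(Pt n, F)) =
        𝓕 (∂_{m} (u : 𝓢'(Pt n, F))) := by
      rw [TemperedDistribution.fourier_lineDerivOp_eq, Lp.fourier_toTemperedDistribution_eq]
      have := TemperedDistribution.smulLeftCLM_smul (F := F) hg0 (2 * Real.pi * Complex.I)
      exact congrArg (fun T => T ((Lp.fourierTransformₗᵢ (Pt n) F u :
        Lp F 2 (volume : Measure (Pt n))) : 𝓢'(Pt n, F))) this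
    rw [e1, e2]
    constructor
    · intro h
      rw [h]
    · intro h
      have := congrArg (fun T : 𝓢'(Pt n, F) => 𝓕⁻ T) h
      simpa using this
  refine step1.trans ?_
  -- The substitution `η = ξ/(2π)` in the unitary transform removes the factor `2π` of the
  -- multiplier.
  have hgδ : ∀ ξ : Pt n, g (δ • ξ) = Complex.I * (ξ j : ℂ) := by
    intro ξ
    have h2 : (Real.pi : ℂ) ≠ 0 := Complex.ofReal_ne_zero.mpr Real.pi_ne_zero
    simp only [g, hm, δ]
    simp
    field_simp
  constructor
  · intro h
    filter_upwards [coeFn_dilation hδ (Lp.fourierTransformₗᵢ (Pt n) F u),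
      coeFn_dilation hδ (Lp.fourierTransformₗᵢ (Pt n) F w), ae_dilate hδ h] with ξ h1 h2 h3
    rw [fourier_eq_dilation, fourier_eq_dilation, h1, h2, h3, hgδ, smul_comm]
  · intro h
    have h' : ∀ᵐ ξ, Lp.fourierTransformₗᵢ (Pt n) F w (δ • ξ) =
        g (δ • ξ) • Lp.fourierTransformₗᵢ (Pt n) F u (δ • ξ) := by
      filter_upwards [coeFn_dilation hδ (Lp.fourierTransformₗᵢ (Pt n) F u),
        coeFn_dilation hδ (Lp.fourierTransformₗᵢ (Pt n) F w), h] with ξ h1 h2 h3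
      rw [fourier_eq_dilation, fourier_eq_dilation, h1, h2, smul_comm] at h3
      rw [hgδ]
      exact smul_right_injective F (Real.rpow_pos_of_pos hδ _).ne' h3
    have h3 := ae_dilate (inv_pos.mpr hδ) h'
    simpa only [smul_smul, mul_inv_cancel₀ hδ.ne', one_smul] using h3

variable {H : Type*} [NormedAddCommGroup H] [InnerProductSpace ℂ H]

/-- The space is defined by scalar identities tested with `b(·, z)`. Nondegeneracy of `b` on `Z`
collects them into one identity of `Z`-valued integrals, that is, a weak derivative in `Z`. -/
theorem mem_sobolev_iff {Z : Submodule ℂ H} [CompleteSpace Z] {b : Form H H}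
    (hb : ∀ z : Z, (∀ z' : Z, b (z : H) (z' : H) = 0) → z = 0)
    {p : Lp Z 2 (volume : Measure (Pt n)) × (Fin n → Lp Z 2 (volume : Measure (Pt n)))} :
    p ∈ sobolev n Z b ↔
      ∀ j, ∀ᵐ ξ, fourier (p.2 j) ξ = (Complex.I * (ξ j : ℂ)) • fourier p.1 ξ := by
  simp only [← isWeakDeriv_iff_fourier]
  have key : ∀ (z : Z) (φ : Pt n → ℝ) (u : Lp Z 2 (volume : Measure (Pt n))), Continuous φ →
      HasCompactSupport φ → ∫ x, (φ x : ℂ) * b (u x : H) (z : H) =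
        b ((∫ x, φ x • u x : Z) : H) (z : H) := by
    intro z φ u hφ hc
    have h3 := ((b.flip (z : H)).comp Z.subtypeL).integral_comp_comm
      (integrable_continuous_smul u hφ hc)
    refine Eq.trans ?_ h3
    refine integral_congr_ae (Eventually.of_forall fun x => ?_)
    change _ = b ((φ x • u x : Z) : H) (z : H)
    rw [← Complex.coe_smul, Submodule.coe_smul, map_smul, smul_apply, smul_eq_mul]
  have hd : ∀ (j : Fin n) (φ : Pt n → ℝ), ContDiff ℝ ∞ φ → HasCompactSupport φ →
      Continuous (fun x => fderiv ℝ φ x (EuclideanSpace.single j 1)) ∧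
      HasCompactSupport (fun x => fderiv ℝ φ x (EuclideanSpace.single j 1)) := fun j φ hφ hc =>
    ⟨(hφ.continuous_fderiv (by simp)).clm_apply continuous_const,
      (hc.fderiv ℝ).comp_left (g := fun L : Pt n →L[ℝ] ℝ => L (EuclideanSpace.single j 1)) (by simp)⟩
  constructor
  · intro h j φ hφ hc
    rw [← sub_eq_zero, sub_neg_eq_add]
    apply hb
    intro z
    have h1 := h j φ hφ hc z
    rw [key z _ p.1 (hd j φ hφ hc).1 (hd j φ hφ hc).2, key z φ (p.2 j) hφ.continuous hc] at h1
    rw [Submodule.coe_add, map_add, add_apply, h1, neg_add_cancel]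
  · intro h j φ hφ hc z
    rw [key z _ p.1 (hd j φ hφ hc).1 (hd j φ hφ hc).2, key z φ (p.2 j) hφ.continuous hc,
      h j φ hφ hc]
    simp

end SobolevFourier

/-! ### Operators generated by forms -/

section FormOperator

variable {M X : Type*} [AddCommGroup M] [Module ℂ M]

section Normed

variable [NormedAddCommGroup X] [NormedSpace ℂ X] {B : M →ₗ[ℂ] M →ₗ⋆[ℂ] ℂ} {J : M →ₗ[ℂ] X}
  {d : Form X X}

/-- The relation is single-valued: a pair `(0, f)` comes from `m = 0` by injectivity of `J`, and
then `f` annihilates the range of `J`. -/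
theorem formOperator_graph (hJ : Function.Injective J) (hd : ∀ f, (∀ m, d f (J m) = 0) → f = 0) :
    (formOperator B J d).graph = formGraph B J d := by
  refine Submodule.toLinearPMap_graph_eq _ ?_
  rintro ⟨x, f⟩ ⟨m, h1, h2⟩ (h3 : x = 0)
  have h4 : m = 0 := hJ (by rw [h1, map_zero]; exact h3)
  refine hd f fun m' => ?_
  rw [← h2, h4, map_zero, LinearMap.zero_apply]

theorem formOperator_spec (hJ : Function.Injective J) (hd : ∀ f, (∀ m, d f (J m) = 0) → f = 0)
    (u : (formOperator B J d).domain) :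
    ∃ m, J m = u ∧ ∀ m', B m m' = d (formOperator B J d u) (J m') := by
  have h := LinearPMap.mem_graph (formOperator B J d) u
  rw [formOperator_graph hJ hd] at h
  exact h

theorem exists_formOperator_eq (hJ : Function.Injective J)
    (hd : ∀ f, (∀ m, d f (J m) = 0) → f = 0) {m : M} {f : X} (h : ∀ m', B m m' = d f (J m')) :
    ∃ u : (formOperator B J d).domain, (u : X) = J m ∧ formOperator B J d u = f := by
  have h1 : (J m, f) ∈ (formOperator B J d).graph := by
    rw [formOperator_graph hJ hd]
    exact ⟨m, rfl, h⟩
  exact (LinearPMap.mem_graph_iff _).mp h1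

theorem formOperator_injective (hJ : Function.Injective J)
    (hd : ∀ f, (∀ m, d f (J m) = 0) → f = 0) (hB : ∀ m, B m m = 0 → m = 0) :
    Function.Injective (formOperator B J d) := by
  intro u v huv
  obtain ⟨m, h1, h2⟩ := formOperator_spec hJ hd u
  obtain ⟨k, h3, h4⟩ := formOperator_spec hJ hd v
  have h5 : m - k = 0 := hB _ (by
    rw [B.map_sub, LinearMap.sub_apply, h2, h4, huv, sub_self])
  apply Subtype.ext
  rw [← h1, ← h3, sub_eq_zero.mp h5]

theorem formOperator_bijective (hJ : Function.Injective J)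
    (hd : ∀ f, (∀ m, d f (J m) = 0) → f = 0) (hB : ∀ m, B m m = 0 → m = 0)
    (hs : ∀ f, ∃ m, ∀ m', B m m' = d f (J m')) : Function.Bijective (formOperator B J d) := by
  refine ⟨formOperator_injective hJ hd hB, fun f => ?_⟩
  obtain ⟨m, hm⟩ := hs f
  obtain ⟨u, -, hu⟩ := exists_formOperator_eq hJ hd hm
  exact ⟨u, hu⟩

/-- Identifies the inverse with the solution of the variational problem; injectivity makes the
choice of a preimage in `opInv` irrelevant. -/
theorem opInv_formOperator (hJ : Function.Injective J)
    (hd : ∀ f, (∀ m, d f (J m) = 0) → f = 0) (hB : ∀ m, B m m = 0 → m = 0) {m : M} {f : X}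
    (h : ∀ m', B m m' = d f (J m')) : opInv (formOperator B J d) f = J m := by
  obtain ⟨u, h1, h2⟩ := exists_formOperator_eq hJ hd h
  have h3 : ∃ u, formOperator B J d u = f := ⟨u, h2⟩
  rw [opInv, dif_pos h3, ← h1]
  exact congrArg Subtype.val (formOperator_injective hJ hd hB (h3.choose_spec.trans h2.symm))

end Normed

/-- A symmetric operator which is onto is densely defined and self-adjoint. Symmetry comes from the
Hermitian form and surjectivity from solvability of the variational problem; neither closedness nor
coercivity of the form is needed. -/
theorem isSelfAdjoint_formOperator [NormedAddCommGroup X] [InnerProductSpace ℂ X] [CompleteSpace X]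
    {B : M →ₗ[ℂ] M →ₗ⋆[ℂ] ℂ} {J : M →ₗ[ℂ] X} (hJ : Function.Injective J)
    (hd : ∀ f, (∀ m, innerForm X f (J m) = 0) → f = 0)
    (hh : ∀ m m', B m m' = (starRingEnd ℂ) (B m' m))
    (hs : ∀ f, ∃ m, ∀ m', B m m' = innerForm X f (J m')) :
    IsSelfAdjoint (formOperator B J (innerForm X)) := by
  set T := formOperator B J (innerForm X) with hT
  have hdef : ∀ f g : X, innerForm X f g = inner ℂ g f := fun f g => rfl
  have hsymm : ∀ u v : T.domain, inner ℂ (T u) (v : X) = inner ℂ (u : X) (T v) := by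
    intro u v
    obtain ⟨m, h1, h2⟩ := formOperator_spec hJ hd u
    obtain ⟨k, h3, h4⟩ := formOperator_spec hJ hd v
    have h5 := hh m k
    rw [h2, h4, hdef, hdef, h1, h3] at h5
    rw [← inner_conj_symm, h5, Complex.conj_conj]
  have hsurj : Function.Surjective T := by
    intro f
    obtain ⟨m, hm⟩ := hs f
    obtain ⟨u, -, hu⟩ := exists_formOperator_eq hJ hd hm
    exact ⟨u, hu⟩
  -- Let `x = T y` be orthogonal to the domain. By symmetry `y` is orthogonal to the range of `T`,
  -- which is everything, so `y = 0` and `x = 0`.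
  have hdense : Dense (T.domain : Set X) := by
    rw [Submodule.dense_iff_topologicalClosure_eq_top, Submodule.topologicalClosure_eq_top_iff,
      Submodule.eq_bot_iff]
    intro x hx
    obtain ⟨y, rfl⟩ := hsurj x
    have h1 : ∀ u : T.domain, inner ℂ (y : X) (T u) = 0 := fun u => by
      rw [← hsymm, ← inner_conj_symm, (Submodule.mem_orthogonal _ _).mp hx u u.2, map_zero]
    obtain ⟨u, hu⟩ := hsurj y
    have h2 := h1 u
    rw [hu, inner_self_eq_zero] at h2
    have h3 : y = 0 := Subtype.ext h2
    rw [h3, LinearPMap.map_zero]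
  rw [LinearPMap.isSelfAdjoint_def]
  have hle : T ≤ T.adjoint := LinearPMap.IsFormalAdjoint.le_adjoint hdense
    (fun u v => hsymm u v)
  refine le_antisymm ?_ hle
  have hfa := LinearPMap.adjoint_isFormalAdjoint hdense
  -- Choose `x` with `T x = T^* y`. Then `x - y` is orthogonal to the range of `T`, hence zero.
  have hval : ∀ y : T.adjoint.domain, ∃ x : T.domain, (x : X) = y ∧ T x = T.adjoint y := by
    intro y
    obtain ⟨x, hx⟩ := hsurj (T.adjoint y)
    refine ⟨x, ?_, hx⟩
    have h1 : ∀ u : T.domain, inner ℂ ((x : X) - y) (T u) = 0 := fun u => by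
      have := hfa y u
      rw [inner_sub_left, ← hsymm, hx, this, sub_self]
    obtain ⟨u, hu⟩ := hsurj (x - y)
    have h2 := h1 u
    rw [hu, inner_self_eq_zero, sub_eq_zero] at h2
    exact h2
  refine ⟨fun y hy => ?_, fun y x hyx => ?_⟩
  · obtain ⟨x, hx, -⟩ := hval ⟨y, hy⟩
    have h2 : (x : X) = y := hx
    rw [← h2]
    exact x.2
  · obtain ⟨x', hx', h2⟩ := hval y
    rw [← h2]
    congr 1
    exact Subtype.ext (hx'.trans hyx)

end FormOperator

/-! ### Non-negative forms -/

section Forms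

variable {V : Type*} [NormedAddCommGroup V] [NormedSpace ℂ V] {B : Form V V}

/-- A non-negative form. -/
def Form.IsNonneg (B : Form V V) : Prop := ∀ u, (B u u).im = 0 ∧ 0 ≤ (B u u).re

/-- Polarisation: the imaginary parts of `B[u + v]` and `B[u + i v]` vanish, which gives the
imaginary and the real part of the identity. -/
theorem Form.IsNonneg.conj_symm (hB : B.IsNonneg) (u v : V) :
    (starRingEnd ℂ) (B v u) = B u v := by
  have h1 := (hB (u + v)).1
  have h2 := (hB (u + Complex.I • v)).1
  have h3 := (hB u).1
  have h4 := (hB v).1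
  simp only [map_add, add_apply, map_smul, smul_apply, map_smulₛₗ, Complex.conj_I, smul_eq_mul,
    Complex.add_im, Complex.add_re, Complex.mul_im, Complex.mul_re, Complex.neg_re, Complex.neg_im, Complex.I_re,
    Complex.I_im, h3, h4] at h1 h2
  apply Complex.ext
  · rw [Complex.conj_re]
    linarith
  · rw [Complex.conj_im]
    linarith

theorem Form.IsNonneg.qf_nonneg (hB : B.IsNonneg) (u : V) : 0 ≤ qf B u := (hB u).2

theorem Form.IsNonneg.apply_self (hB : B.IsNonneg) (u : V) : B u u = (qf B u : ℂ) :=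
  Complex.ext rfl (by simpa using (hB u).1)

theorem Form.IsNonneg.norm_apply_le (hB : B.IsNonneg) (u v : V) :
    ‖B u v‖ ≤ √(qf B u) * √(qf B v) := by
  -- Cauchy–Schwarz for a semi-definite inner product; the arguments are swapped because that inner
  -- product is antilinear in its first entry.
  let c : PreInnerProductSpace.Core ℂ V :=
    { inner := fun x y => B y x
      conj_inner_symm := fun x y => hB.conj_symm y x
      re_inner_nonneg := fun x => (hB x).2
      add_left := fun x y z => by simp
      smul_left := fun x y r => by simp }
  have h : ‖B v u‖ * ‖B u v‖ ≤ qf B u * qf B v :=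
    @InnerProductSpace.Core.inner_mul_inner_self_le ℂ V _ _ _ c u v
  rw [← hB.conj_symm v u, RCLike.norm_conj] at h
  rw [← Real.sqrt_mul (hB.qf_nonneg u)]
  exact Real.le_sqrt_of_sq_le (by rw [sq]; exact h)

theorem Form.IsNonneg.apply_eq_zero (hB : B.IsNonneg) {u : V} (hu : B u u = 0) (v : V) :
    B u v = 0 := by
  have h := hB.norm_apply_le u v
  rw [qf, hu, Complex.zero_re, Real.sqrt_zero, zero_mul] at h
  exact norm_le_zero_iff.mp h

theorem Form.IsNonneg.apply_eq_zero' (hB : B.IsNonneg) {u : V} (hu : B u u = 0) (v : V) :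
    B v u = 0 := by
  rw [← hB.conj_symm, hB.apply_eq_zero hu, map_zero]

theorem Form.IsNonneg.qf_add (hB : B.IsNonneg) (u v : V) :
    qf B (u + v) = qf B u + 2 * (B u v).re + qf B v := by
  have h := congrArg Complex.re (hB.conj_symm u v)
  rw [Complex.conj_re] at h
  simp only [qf, map_add, add_apply, Complex.add_re]
  linarith

theorem qf_neg (u : V) : qf B (-u) = qf B u := by simp [qf]

theorem Form.IsNonneg.qf_add_le (hB : B.IsNonneg) (u v : V) :
    qf B (u + v) ≤ 2 * qf B u + 2 * qf B v := by
  have h1 := hB.qf_add u v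
  have h2 := hB.qf_add u (-v)
  have h3 := hB.qf_nonneg (u + -v)
  rw [map_neg, Complex.neg_re, qf_neg] at h2
  linarith

theorem Form.IsNonneg.qf_add_of_ker (hB : B.IsNonneg) {u : V} (hu : B u u = 0) (v : V) :
    qf B (u + v) = qf B v := by
  rw [hB.qf_add, hB.apply_eq_zero hu, qf, hu]
  simp

theorem Form.IsNonneg.add {A : Form V V} (hA : A.IsNonneg) (hB : B.IsNonneg) :
    (A + B).IsNonneg := fun u => by
  simp only [add_apply, Complex.add_im, Complex.add_re]
  exact ⟨by rw [(hA u).1, (hB u).1, add_zero], add_nonneg (hA u).2 (hB u).2⟩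

theorem Form.continuous_qf (B : Form V V) : Continuous (qf B) := by
  have h : Continuous fun u : V => (B u u) := by
    let C : V →L⋆[ℂ] V →L[ℂ] ℂ := (ContinuousLinearMap.compSL V ℂ ℂ (starRingEnd ℂ)
      (starRingEnd ℂ) ((starL ℂ : ℂ ≃L⋆[ℂ] ℂ) : ℂ →L⋆[ℂ] ℂ)).comp B
    have h1 : Continuous (fun u : V => C u u) := C.continuous.clm_apply continuous_id
    have h2 : (fun u : V => B u u) = fun u => star (C u u) := by
      funext u
      exact (star_star (B u u)).symm
    rw [h2]
    exact continuous_star.comp h1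
  exact Complex.continuous_re.comp h

/-- A bound for the energy norm of `x` by testing with a dense set. -/
theorem Form.IsNonneg.sqrt_qf_le (hB : B.IsNonneg) {D : Set V} (hD : Dense D) {x : V} {ρ : ℝ}
    (hρ : 0 ≤ ρ) (h : ∀ w ∈ D, ‖B x w‖ ≤ ρ * √(qf B w)) : √(qf B x) ≤ ρ := by
  have hcl : IsClosed {w | ‖B x w‖ ≤ ρ * √(qf B w)} :=
    isClosed_le (B x).continuous.norm
      (continuous_const.mul (Real.continuous_sqrt.comp B.continuous_qf))
  have h1 : ∀ w, ‖B x w‖ ≤ ρ * √(qf B w) := fun w =>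
    hcl.closure_subset_iff.mpr h (hD w)
  -- By continuity the bound holds for all test vectors, in particular for `x` itself; dividing by
  -- the energy norm of `x` finishes.
  have h2 := h1 x
  rw [hB.apply_self, Complex.norm_real, Real.norm_of_nonneg (hB.qf_nonneg x)] at h2
  rcases (Real.sqrt_nonneg (qf B x)).eq_or_lt with h0 | h0
  · rw [← h0]
    exact hρ
  · nth_rewrite 1 [← Real.mul_self_sqrt (hB.qf_nonneg x)] at h2
    exact le_of_mul_le_mul_right h2 h0

end Forms

/-! ### Uniform bounds and the splittings of the energy space -/

namespace Setting

variable {n : ℕ} {H 𝓗 : Type*} [NormedAddCommGroup H] [InnerProductSpace ℂ H]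
  [NormedAddCommGroup 𝓗] [InnerProductSpace ℂ 𝓗] (S : Setting n H 𝓗)

theorem isNonneg_a {θ : Pt n} (hθ : θ ∈ S.Θ) : (S.a θ).IsNonneg := S.a_nonneg θ hθ

theorem isNonneg_b {θ : Pt n} (hθ : θ ∈ S.Θ) : (S.b θ).IsNonneg := S.b_nonneg θ hθ

theorem isNonneg_d {θ : Pt n} (hθ : θ ∈ S.Θ) : (S.d θ).IsNonneg := S.d_nonneg θ hθ

theorem sq_nrm {θ : Pt n} (hθ : θ ∈ S.Θ) (u : H) : S.nrm θ u ^ 2 = qf (S.a θ) u + qf (S.b θ) u :=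
  Real.sq_sqrt (add_nonneg ((S.isNonneg_a hθ).qf_nonneg u) ((S.isNonneg_b hθ).qf_nonneg u))

theorem nrm_nonneg (θ : Pt n) (u : H) : 0 ≤ S.nrm θ u := Real.sqrt_nonneg _

theorem exists_nrm_equiv : ∃ M, 1 ≤ M ∧ ∀ θ ∈ S.Θ, ∀ u, S.nrm θ u ≤ M * ‖u‖ ∧
    ‖u‖ ≤ M * S.nrm θ u := by
  obtain ⟨c, hc, h1⟩ := S.norm_le
  obtain ⟨K, hK, h2⟩ := S.norm_equiv
  have h3 : ∀ u, S.nrm 0 u ≤ √(‖S.a 0‖ + ‖S.b 0‖) * ‖u‖ := by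
    intro u
    rw [← Real.sqrt_sq (norm_nonneg u), ← Real.sqrt_mul (by positivity)]
    refine Real.sqrt_le_sqrt ?_
    have e1 : qf (S.a 0) u ≤ ‖S.a 0‖ * ‖u‖ * ‖u‖ :=
      (Complex.re_le_norm _).trans ((S.a 0).le_opNorm₂ u u)
    have e2 : qf (S.b 0) u ≤ ‖S.b 0‖ * ‖u‖ * ‖u‖ :=
      (Complex.re_le_norm _).trans ((S.b 0).le_opNorm₂ u u)
    nlinarith
  refine ⟨max 1 (max c (K * √(‖S.a 0‖ + ‖S.b 0‖))), le_max_left _ _, fun θ hθ u => ⟨?_, ?_⟩⟩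
  · calc S.nrm θ u ≤ K * S.nrm 0 u := h2 θ hθ 0 S.zero_mem u
      _ ≤ K * (√(‖S.a 0‖ + ‖S.b 0‖) * ‖u‖) := by gcongr; exact h3 u
      _ = (K * √(‖S.a 0‖ + ‖S.b 0‖)) * ‖u‖ := by ring
      _ ≤ _ := by
        gcongr
        exact (le_max_right _ _).trans (le_max_right _ _)
  · refine (h1 θ hθ u).trans ?_
    exact mul_le_mul_of_nonneg_right ((le_max_left _ _).trans (le_max_right _ _))
      (S.nrm_nonneg θ u)

theorem norm_a_le_nrm {θ : Pt n} (hθ : θ ∈ S.Θ) (u v : H) :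
    ‖S.a θ u v‖ ≤ S.nrm θ u * S.nrm θ v := by
  refine ((S.isNonneg_a hθ).norm_apply_le u v).trans ?_
  refine mul_le_mul (Real.sqrt_le_sqrt ?_) (Real.sqrt_le_sqrt ?_) (Real.sqrt_nonneg _)
    (Real.sqrt_nonneg _)
  · exact le_add_of_nonneg_right ((S.isNonneg_b hθ).qf_nonneg u)
  · exact le_add_of_nonneg_right ((S.isNonneg_b hθ).qf_nonneg v)

theorem norm_b_le_nrm {θ : Pt n} (hθ : θ ∈ S.Θ) (u v : H) :
    ‖S.b θ u v‖ ≤ S.nrm θ u * S.nrm θ v := by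
  refine ((S.isNonneg_b hθ).norm_apply_le u v).trans ?_
  refine mul_le_mul (Real.sqrt_le_sqrt ?_) (Real.sqrt_le_sqrt ?_) (Real.sqrt_nonneg _)
    (Real.sqrt_nonneg _)
  · exact le_add_of_nonneg_left ((S.isNonneg_a hθ).qf_nonneg u)
  · exact le_add_of_nonneg_left ((S.isNonneg_a hθ).qf_nonneg v)

/-- Uniform bounds of the forms in the norm of `H`. -/
theorem exists_bounds : ∃ M, 1 ≤ M ∧ ∀ θ ∈ S.Θ,
    (∀ u v, ‖S.a θ u v‖ ≤ M * ‖u‖ * ‖v‖) ∧ (∀ u v, ‖S.b θ u v‖ ≤ M * ‖u‖ * ‖v‖) ∧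
    (∀ u, ‖u‖ ^ 2 ≤ M * (qf (S.a θ) u + qf (S.b θ) u)) ∧
    (∀ u, S.nrm θ u ≤ M * ‖u‖) ∧ (∀ u, ‖u‖ ≤ M * S.nrm θ u) ∧
    ∀ θ' ∈ S.Θ, ∀ u v, ‖S.a θ' u v - S.a θ u v‖ ≤ M * ‖θ' - θ‖ * ‖u‖ * ‖v‖ := by
  obtain ⟨M, hM, h⟩ := S.exists_nrm_equiv
  obtain ⟨L, hL, hl⟩ := S.a_lipschitz
  have hM0 : 0 ≤ M := zero_le_one.trans hM
  have hMM : M ≤ M * M := le_mul_of_one_le_left hM0 hM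
  have hN : M * M ≤ (1 + L) * (M * M) :=
    le_mul_of_one_le_left (by positivity) (by linarith)
  refine ⟨(1 + L) * (M * M), (hM.trans hMM).trans hN, fun θ hθ => ⟨fun u v => ?_, fun u v => ?_,
    fun u => ?_, fun u => ?_, fun u => ?_, fun θ' hθ' u v => ?_⟩⟩
  · calc ‖S.a θ u v‖ ≤ S.nrm θ u * S.nrm θ v := S.norm_a_le_nrm hθ u v
      _ ≤ (M * ‖u‖) * (M * ‖v‖) :=
        mul_le_mul (h θ hθ u).1 (h θ hθ v).1 (S.nrm_nonneg _ _) (by positivity)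
      _ = (M * M) * ‖u‖ * ‖v‖ := by ring
      _ ≤ _ := by gcongr
  · calc ‖S.b θ u v‖ ≤ S.nrm θ u * S.nrm θ v := S.norm_b_le_nrm hθ u v
      _ ≤ (M * ‖u‖) * (M * ‖v‖) :=
        mul_le_mul (h θ hθ u).1 (h θ hθ v).1 (S.nrm_nonneg _ _) (by positivity)
      _ = (M * M) * ‖u‖ * ‖v‖ := by ring
      _ ≤ _ := by gcongr
  · rw [← S.sq_nrm hθ]
    calc ‖u‖ ^ 2 ≤ (M * S.nrm θ u) ^ 2 := pow_le_pow_left₀ (norm_nonneg _) (h θ hθ u).2 2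
      _ = (M * M) * S.nrm θ u ^ 2 := by ring
      _ ≤ _ := by gcongr
  · refine (h θ hθ u).1.trans ?_
    gcongr
    exact hMM.trans hN
  · refine (h θ hθ u).2.trans ?_
    exact mul_le_mul_of_nonneg_right (hMM.trans hN) (S.nrm_nonneg _ _)
  · calc ‖S.a θ' u v - S.a θ u v‖ ≤ L * ‖θ' - θ‖ * S.nrm θ' u * S.nrm θ' v := hl θ' hθ' θ hθ u v
      _ ≤ L * ‖θ' - θ‖ * (M * ‖u‖) * (M * ‖v‖) := by
        have e1 := (h θ' hθ' u).1
        have e2 := (h θ' hθ' v).1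
        have e3 := S.nrm_nonneg θ' u
        have e4 := S.nrm_nonneg θ' v
        gcongr
      _ = (L * (M * M)) * ‖θ' - θ‖ * ‖u‖ * ‖v‖ := by ring
      _ ≤ _ := by
        gcongr
        linarith

/-- By Cauchy–Schwarz an isotropic vector of a non-negative form lies in its kernel. This makes
`V_θ` a closed subspace. -/
theorem mem_V_iff {θ : Pt n} (hθ : θ ∈ S.Θ) {v : H} : v ∈ S.V θ ↔ S.a θ v = 0 := by
  constructor
  · intro h
    ext w
    exact (S.isNonneg_a hθ).apply_eq_zero h w
  · intro h
    change S.a θ v v = 0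
    rw [h, zero_apply]

variable {S}

theorem Vstar_subset_V {Vs Z : Submodule ℂ H} (hZ : S.IsDefect Vs Z) (θ : Pt n) :
    S.Vstar Vs θ ⊆ S.V θ := by
  intro v hv
  by_cases h : θ = 0
  · rw [Vstar, if_pos h] at hv
    rw [h, ← hZ.2.1]
    exact Submodule.mem_sup_left hv
  · rwa [Vstar, if_neg h] at hv

theorem exists_Vstar_submodule (Vs : Submodule ℂ H) {θ : Pt n} (hθ : θ ∈ S.Θ) :
    ∃ V' : Submodule ℂ H, (V' : Set H) = S.Vstar Vs θ := by
  by_cases h : θ = 0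
  · exact ⟨Vs, by rw [Vstar, if_pos h]⟩
  · refine ⟨(S.a θ : H →ₗ[ℂ] H →L⋆[ℂ] ℂ).ker, ?_⟩
    ext v
    rw [Vstar, if_neg h, S.mem_V_iff hθ]
    rfl

theorem Vstar_zero (Vs : Submodule ℂ H) : S.Vstar Vs 0 = Vs := by rw [Vstar, if_pos rfl]

/-- The infimum need not be attained, so `L` is enlarged to `L + 1`. This creates slack unless `θ₁ =
θ₂` or `v₁ = 0`, where a neighbour at distance zero is at hand. -/
theorem H2.exists_near {Vs : Submodule ℂ H} (h2 : S.H2 Vs) : ∃ C ≥ 0, ∀ θ₁ ∈ S.Θ, ∀ θ₂ ∈ S.Θ,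
    ∀ v₁ ∈ S.Vstar Vs θ₁, ∃ v₂ ∈ S.Vstar Vs θ₂, ‖v₁ - v₂‖ ≤ C * ‖θ₁ - θ₂‖ * ‖v₁‖ := by
  obtain ⟨-, L, hL, h⟩ := h2
  obtain ⟨M, hM, hb⟩ := S.exists_bounds
  have hM0 : 0 ≤ M := zero_le_one.trans hM
  refine ⟨M * ((L + 1) * M), by positivity, fun θ₁ h₁ θ₂ h₂ v₁ hv => ?_⟩
  obtain ⟨V', hV'⟩ := exists_Vstar_submodule Vs h₂
  have hz : (0 : H) ∈ S.Vstar Vs θ₂ := hV' ▸ V'.zero_mem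
  by_cases hθ : θ₁ = θ₂
  · exact ⟨v₁, hθ ▸ hv, by simp [hθ]⟩
  by_cases hv0 : v₁ = 0
  · exact ⟨0, hz, by simp [hv0]⟩
  have e1 : 0 < ‖θ₁ - θ₂‖ := norm_pos_iff.mpr (sub_ne_zero.mpr hθ)
  obtain ⟨-, -, -, hu, hl, -⟩ := hb θ₁ h₁
  have e2 : 0 < S.nrm θ₁ v₁ := by
    have h5 := hl v₁
    have h6 := norm_pos_iff.mpr hv0
    by_contra h7
    have h8 : S.nrm θ₁ v₁ = 0 := le_antisymm (not_lt.mp h7) (S.nrm_nonneg _ _)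
    rw [h8, mul_zero] at h5
    linarith
  have e3 : (⨅ v₂ : S.Vstar Vs θ₂, S.nrm θ₂ (v₁ - v₂)) < (L + 1) * ‖θ₁ - θ₂‖ * S.nrm θ₁ v₁ := by
    refine (h θ₁ h₁ θ₂ h₂ v₁ hv).trans_lt ?_
    gcongr
    linarith
  have : Nonempty (S.Vstar Vs θ₂) := ⟨⟨0, hz⟩⟩
  obtain ⟨v₂, hv₂⟩ := exists_lt_of_ciInf_lt e3
  refine ⟨v₂, v₂.2, ?_⟩
  obtain ⟨-, -, -, -, hl2, -⟩ := hb θ₂ h₂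
  calc ‖v₁ - v₂‖ ≤ M * S.nrm θ₂ (v₁ - v₂) := hl2 _
    _ ≤ M * ((L + 1) * ‖θ₁ - θ₂‖ * (M * ‖v₁‖)) := by
      gcongr
      refine hv₂.le.trans ?_
      gcongr
      exact hu v₁
    _ = _ := by ring

/-- The splitting `H = V_θ ∔ W_θ`. -/
theorem exists_V_W [CompleteSpace H] {θ : Pt n} (hθ : θ ∈ S.Θ) (u : H) :
    ∃ v ∈ S.V θ, ∃ w ∈ S.W θ, u = v + w := by
  obtain ⟨M, hM, hb⟩ := S.exists_bounds
  have hM0 : 0 < M := zero_lt_one.trans_le hM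
  let K : Submodule ℂ H := (S.a θ : H →ₗ[ℂ] H →L⋆[ℂ] ℂ).ker
  have hK : ∀ v, v ∈ K ↔ v ∈ S.V θ := fun v => (S.mem_V_iff hθ).symm
  have hKc : IsClosed (K : Set H) := (S.a θ).isClosed_ker
  have : CompleteSpace K := hKc.completeSpace_coe
  -- `N` is the projection onto `V_θ` that is orthogonal for `(·,·)_θ`. The norm of `H` is only
  -- equivalent to that of `(·,·)_θ`, hence the variational construction.
  obtain ⟨N, hN⟩ := exists_solution (W := K)
    ((S.a θ + S.b θ).bilinearComp K.subtypeL K.subtypeL)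
    ((S.a θ + S.b θ).bilinearComp (ContinuousLinearMap.id ℂ H) K.subtypeL) (c := M⁻¹)
    (inv_pos.mpr hM0) (fun w => by
      have h1 := (hb θ hθ).2.2.1 (w : H)
      rw [inv_mul_le_iff₀ hM0]
      exact h1)
  refine ⟨N u, (hK _).mp (N u).2, u - N u, fun v hv => ?_, by simp⟩
  have h1 := hN u ⟨v, (hK v).mpr hv⟩
  have h2 : S.a θ (N u) v + S.b θ (N u) v = S.a θ u v + S.b θ u v := h1
  simp only [map_sub, sub_apply]
  linear_combination -h2

/-- The splitting `H = V_⋆ ∔ Z ∔ W_0`. -/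
theorem exists_split [CompleteSpace H] {Vs Z : Submodule ℂ H} (hZ : S.IsDefect Vs Z) (u : H) :
    ∃ v ∈ Vs, ∃ z ∈ Z, ∃ w ∈ S.W 0, u = v + z + w := by
  obtain ⟨x, hx, w, hw, rfl⟩ := exists_V_W S.zero_mem u
  rw [← hZ.2.1] at hx
  obtain ⟨v, hv, z, hz, rfl⟩ := Submodule.mem_sup.mp hx
  exact ⟨v, hv, z, hz, w, hw, rfl⟩

/-- At `θ = 0` the space `W_0` is orthogonal to `V_0`, and `K < 1` gives `(1 - K)(‖v‖_0² + ‖z‖_0²) ≤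
‖v + z‖_0²` since `2 ‖v‖_0 ‖z‖_0 ≤ ‖v‖_0² + ‖z‖_0²`. -/
theorem IsDefect.exists_norm_le {Vs Z : Submodule ℂ H} (hZ : S.IsDefect Vs Z) :
    ∃ C ≥ 0, ∀ v ∈ Vs, ∀ z ∈ Z, ∀ w ∈ S.W 0, ‖v‖ + ‖z‖ + ‖w‖ ≤ C * ‖v + z + w‖ := by
  obtain ⟨-, hV0, -, K, hK0, hK1, hK⟩ := hZ
  obtain ⟨M, hM, hb⟩ := S.exists_bounds
  have hM0 : 0 ≤ M := zero_le_one.trans hM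
  obtain ⟨-, -, -, hu, hl, -⟩ := hb 0 S.zero_mem
  have h1K : 0 < 1 - K := by linarith
  let G : Form H H := S.a 0 + S.b 0
  have hG : G.IsNonneg := (S.isNonneg_a S.zero_mem).add (S.isNonneg_b S.zero_mem)
  have hq : ∀ u, qf G u = S.nrm 0 u ^ 2 := fun u => by
    rw [S.sq_nrm S.zero_mem]
    rfl
  refine ⟨3 * (M * M / √(1 - K)), by positivity, fun v hv z hz w hw => ?_⟩
  have e1 : qf G (v + z + w) = qf G (v + z) + qf G w := by
    have h1 : G w (v + z) = 0 := hw _ (by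
      rw [← hV0]
      exact (Vs ⊔ Z).add_mem (Submodule.mem_sup_left hv) (Submodule.mem_sup_right hz))
    rw [hG.qf_add, ← hG.conj_symm, h1]
    simp
  have e2 : (1 - K) * (S.nrm 0 v ^ 2 + S.nrm 0 z ^ 2) ≤ qf G (v + z) := by
    have h1 := hK v hv z hz
    have h2 : -(K * S.nrm 0 v * S.nrm 0 z) ≤ (G v z).re :=
      (neg_le_neg h1).trans (neg_le_of_abs_le (Complex.abs_re_le_norm _))
    rw [hG.qf_add, hq, hq]
    nlinarith [mul_nonneg hK0 (sq_nonneg (S.nrm 0 v - S.nrm 0 z))]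
  have e3 : (1 - K) * (S.nrm 0 v ^ 2 + S.nrm 0 z ^ 2 + S.nrm 0 w ^ 2) ≤
      (M * ‖v + z + w‖) ^ 2 := by
    have h1 : qf G (v + z + w) ≤ (M * ‖v + z + w‖) ^ 2 := by
      rw [hq]
      exact pow_le_pow_left₀ (S.nrm_nonneg _ _) (hu _) 2
    rw [e1] at h1
    have h2 : (1 - K) * S.nrm 0 w ^ 2 ≤ qf G w := by
      rw [hq]
      exact mul_le_of_le_one_left (sq_nonneg _) (by linarith)
    linarith
  have key : ∀ x, S.nrm 0 x ^ 2 ≤ S.nrm 0 v ^ 2 + S.nrm 0 z ^ 2 + S.nrm 0 w ^ 2 →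
      ‖x‖ ≤ M * M / √(1 - K) * ‖v + z + w‖ := by
    intro x hx
    have h1 : √(1 - K) * S.nrm 0 x ≤ M * ‖v + z + w‖ := by
      refine le_of_sq_le_sq ?_ (by positivity)
      rw [mul_pow, Real.sq_sqrt h1K.le]
      exact (mul_le_mul_of_nonneg_left hx h1K.le).trans e3
    have h2 : S.nrm 0 x ≤ M * ‖v + z + w‖ / √(1 - K) := by
      rw [le_div_iff₀ (Real.sqrt_pos.mpr h1K), mul_comm]
      exact h1
    calc ‖x‖ ≤ M * S.nrm 0 x := hl x
      _ ≤ M * (M * ‖v + z + w‖ / √(1 - K)) := by gcongr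
      _ = _ := by ring
  have k1 := key v (by nlinarith [sq_nonneg (S.nrm 0 z), sq_nonneg (S.nrm 0 w)])
  have k2 := key z (by nlinarith [sq_nonneg (S.nrm 0 v), sq_nonneg (S.nrm 0 w)])
  have k3 := key w (by nlinarith [sq_nonneg (S.nrm 0 z), sq_nonneg (S.nrm 0 v)])
  linarith

/-- The sum `V^⋆_θ + Z + W_0` is uniformly direct for small `θ`. -/
theorem exists_norm_le_near {Vs Z : Submodule ℂ H} (h2 : S.H2 Vs) (hZ : S.IsDefect Vs Z) :
    ∃ C ≥ 0, ∃ δ > 0, ∀ θ ∈ S.Θ, ‖θ‖ ≤ δ → ∀ v ∈ S.Vstar Vs θ, ∀ z ∈ Z, ∀ w ∈ S.W 0,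
      ‖v‖ + ‖z‖ + ‖w‖ ≤ C * ‖v + z + w‖ := by
  obtain ⟨C, hC, h⟩ := hZ.exists_norm_le
  obtain ⟨L, hL, hn⟩ := h2.exists_near
  -- The radius makes `(1 + C) L ‖θ‖ ≤ 1/2`. Replacing `v` by its neighbour `v₂` in `V_⋆` then costs
  -- at most `‖v‖/2`, which is absorbed on the left.
  refine ⟨2 * C, by positivity, 1 / (2 * (1 + C) * (L + 1)), by positivity,
    fun θ hθ hδ v hv z hz w hw => ?_⟩
  obtain ⟨v₂, hv₂, hvv⟩ := hn θ hθ 0 S.zero_mem v hv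
  rw [Vstar_zero] at hv₂
  rw [sub_zero] at hvv
  have h1 := h v₂ hv₂ z hz w hw
  have h3 : (1 + C) * ‖v - v₂‖ ≤ ‖v‖ / 2 := by
    calc (1 + C) * ‖v - v₂‖ ≤ (1 + C) * (L * ‖θ‖ * ‖v‖) := by gcongr
      _ ≤ (1 + C) * ((L + 1) * (1 / (2 * (1 + C) * (L + 1))) * ‖v‖) := by gcongr; linarith
      _ = ‖v‖ / 2 := by field_simp
  have h4 : ‖v₂ + z + w‖ ≤ ‖v + z + w‖ + ‖v - v₂‖ := by
    have : v₂ + z + w = (v + z + w) - (v - v₂) := by abel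
    rw [this]
    exact norm_sub_le _ _
  have h5 : ‖v‖ ≤ ‖v - v₂‖ + ‖v₂‖ := by
    have : v = (v - v₂) + v₂ := by abel
    nth_rewrite 1 [this]
    exact norm_add_le _ _
  have h6 := mul_le_mul_of_nonneg_left h4 hC
  nlinarith [norm_nonneg z, norm_nonneg w]

/-- The sum `V^⋆_θ + Z + W_0` is dense for small `θ`. -/
theorem exists_dense_near [CompleteSpace H] {Vs Z : Submodule ℂ H} (h2 : S.H2 Vs)
    (hZ : S.IsDefect Vs Z) : ∃ δ > 0, ∀ θ ∈ S.Θ, ‖θ‖ ≤ δ →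
      Dense {u : H | ∃ v ∈ S.Vstar Vs θ, ∃ z ∈ Z, ∃ w ∈ S.W 0, u = v + z + w} := by
  obtain ⟨C, hC, h⟩ := hZ.exists_norm_le
  obtain ⟨L, hL, hn⟩ := h2.exists_near
  refine ⟨1 / (2 * (1 + C) * (L + 1)), by positivity, fun θ hθ hδ => ?_⟩
  obtain ⟨V', hV'⟩ := exists_Vstar_submodule Vs hθ
  have hR : {u : H | ∃ v ∈ S.Vstar Vs θ, ∃ z ∈ Z, ∃ w ∈ S.W 0, u = v + z + w} =
      ((V' ⊔ Z ⊔ S.W 0 : Submodule ℂ H) : Set H) := by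
    ext u
    constructor
    · rintro ⟨v, hv, z, hz, w, hw, rfl⟩
      rw [← hV'] at hv
      exact Submodule.add_mem_sup (Submodule.add_mem_sup hv hz) hw
    · intro hu
      obtain ⟨x, hx, w, hw, rfl⟩ := Submodule.mem_sup.mp hu
      obtain ⟨v, hv, z, hz, rfl⟩ := Submodule.mem_sup.mp hx
      exact ⟨v, hV' ▸ hv, z, hz, w, hw, rfl⟩
  rw [hR, Submodule.dense_iff_topologicalClosure_eq_top, Submodule.topologicalClosure_eq_top_iff,
    Submodule.eq_bot_iff]
  -- Let `u` be orthogonal to the sum. Split `u = v + z + w` at `θ = 0` and move `v` to a neighbour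
  -- `v₂` in `V^⋆_θ`. Then `⟪u, u⟫ = ⟪v - v₂, u⟫ ≤ ‖u‖²/2`, so `u = 0`.
  intro u hu
  obtain ⟨v, hv, z, hz, w, hw, huv⟩ := exists_split hZ u
  obtain ⟨v₂, hv₂, hvv⟩ := hn 0 S.zero_mem θ hθ v (by rw [Vstar_zero]; exact hv)
  rw [zero_sub, norm_neg] at hvv
  have h1 := h v hv z hz w hw
  rw [← huv] at h1
  have h3 : ‖v - v₂‖ ≤ ‖u‖ / 2 := by
    calc ‖v - v₂‖ ≤ L * ‖θ‖ * ‖v‖ := hvv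
      _ ≤ (L + 1) * (1 / (2 * (1 + C) * (L + 1))) * ((1 + C) * ‖u‖) := by
        gcongr
        · linarith
        · nlinarith [norm_nonneg z, norm_nonneg w, norm_nonneg u]
      _ = ‖u‖ / 2 := by field_simp
  have h4 : inner ℂ (v₂ + z + w) u = 0 := (Submodule.mem_orthogonal _ _).mp hu _
    (Submodule.add_mem_sup (Submodule.add_mem_sup (by rw [← SetLike.mem_coe, hV']; exact hv₂) hz) hw)
  have h5 : inner ℂ u u = inner ℂ (v - v₂) u := by
    have : u = (v - v₂) + (v₂ + z + w) := by rw [huv]; abel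
    nth_rewrite 1 [this]
    rw [inner_add_left, h4, add_zero]
  have h6 : ‖u‖ * ‖u‖ ≤ ‖u‖ / 2 * ‖u‖ := by
    rw [← inner_self_eq_norm_mul_norm (𝕜 := ℂ), h5]
    exact (Complex.re_le_norm _).trans ((norm_inner_le_norm _ _).trans
      (mul_le_mul_of_nonneg_right h3 (norm_nonneg _)))
  by_contra h7
  have h8 := norm_pos_iff.mpr h7
  nlinarith

end Setting

/-! ### Correctors, the homogenised symbol, and the expansion of `a_θ` at zero -/

theorem abs_coord_le {n : ℕ} (θ : Pt n) (j : Fin n) : |θ j| ≤ ‖θ‖ :=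
  PiLp.norm_apply_le (p := 2) θ j

namespace Setting

variable {n : ℕ} {H 𝓗 : Type*} [NormedAddCommGroup H] [InnerProductSpace ℂ H]
  [NormedAddCommGroup 𝓗] [InnerProductSpace ℂ 𝓗] (S : Setting n H 𝓗)

/-- The first derivative `∑_j θ_j a'_j` of the form in direction `θ`. -/
noncomputable def dirForm {V₀ : Submodule ℂ H} (a' : Fin n → Form V₀ H) (θ : Pt n) : Form V₀ H :=
  ∑ j, (θ j : ℂ) • a' j

theorem dirForm_apply {V₀ : Submodule ℂ H} (a' : Fin n → Form V₀ H) (θ : Pt n) (v : V₀) (u : H) :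
    dirForm a' θ v u = ∑ j, a' j v u * (θ j : ℂ) := by
  simp [dirForm, sum_apply, mul_comm]

section Corrector

variable [CompleteSpace H] (h1 : S.H1)

/-- The corrector `∑_j θ_j N^j` in direction `θ`. -/
noncomputable def dirCorrector {V₀ : Submodule ℂ H} (a' : Fin n → Form V₀ H) (θ : Pt n) :
    V₀ →L[ℂ] H :=
  ∑ j, (θ j : ℂ) • S.corrector h1 a' j

/-- The symbol `∑_{jk} ξ_j ξ_k a^h_{jk}`. -/
noncomputable def symbol {Vs Z : Submodule ℂ H} (a' : Fin n → Form ↥(Vs ⊔ Z) H)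
    (a'' : Fin n → Fin n → Form ↥(Vs ⊔ Z) ↥(Vs ⊔ Z)) (ξ : Pt n) : Form Z Z :=
  ∑ j, ∑ k, ((ξ j : ℂ) * (ξ k : ℂ)) • S.ah h1 a' a'' j k

theorem dirCorrector_apply {V₀ : Submodule ℂ H} (a' : Fin n → Form V₀ H) (θ : Pt n) (v : V₀) :
    S.dirCorrector h1 a' θ v = ∑ j, (θ j : ℂ) • S.corrector h1 a' j v := by
  simp [dirCorrector, sum_apply]

theorem dirCorrector_mem {V₀ : Submodule ℂ H} (a' : Fin n → Form V₀ H) (θ : Pt n) (v : V₀) :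
    S.dirCorrector h1 a' θ v ∈ S.W 0 := by
  rw [dirCorrector_apply]
  exact Submodule.sum_mem _ fun j _ =>
    Submodule.smul_mem _ _ ((S.exists_corrector h1 a').choose_spec j v).1

theorem a_dirCorrector {V₀ : Submodule ℂ H} (a' : Fin n → Form V₀ H) (θ : Pt n) (v : V₀)
    {w : H} (hw : w ∈ S.W 0) :
    S.a 0 (S.dirCorrector h1 a' θ v) w = - dirForm a' θ v w := by
  rw [dirCorrector_apply, dirForm_apply, map_sum, sum_apply, ← Finset.sum_neg_distrib]
  refine Finset.sum_congr rfl fun j _ => ?_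
  have h := ((S.exists_corrector h1 a').choose_spec j v).2 w hw
  change S.a 0 (S.corrector h1 a' j v) w = _ at h
  rw [map_smul, smul_apply, h, smul_eq_mul]
  ring

theorem exists_dirCorrector_le {V₀ : Submodule ℂ H} (a' : Fin n → Form V₀ H) :
    ∃ C ≥ 0, ∀ θ v, ‖S.dirCorrector h1 a' θ v‖ ≤ C * ‖θ‖ * ‖v‖ := by
  refine ⟨∑ j, ‖S.corrector h1 a' j‖, by positivity, fun θ v => ?_⟩
  rw [dirCorrector_apply, Finset.sum_mul, Finset.sum_mul]
  refine (norm_sum_le _ _).trans (Finset.sum_le_sum fun j _ => ?_)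
  rw [norm_smul, Complex.norm_real, Real.norm_eq_abs]
  calc |θ j| * ‖S.corrector h1 a' j v‖ ≤ ‖θ‖ * (‖S.corrector h1 a' j‖ * ‖v‖) := by
        gcongr
        · exact abs_coord_le θ j
        · exact (S.corrector h1 a' j).le_opNorm v
    _ = _ := by ring

/-- The corrector is linear in the direction, so the subtracted terms add up to a single
`a_0`-product. In this form the symbol can be compared with the expansion of `a_θ`. -/
theorem symbol_apply {Vs Z : Submodule ℂ H} (a' : Fin n → Form ↥(Vs ⊔ Z) H)
    (a'' : Fin n → Fin n → Form ↥(Vs ⊔ Z) ↥(Vs ⊔ Z)) (ξ : Pt n) (z z' : Z) :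
    S.symbol h1 a' a'' ξ z z' =
      (∑ j, ∑ k, a'' j k (inclZ Vs Z z) (inclZ Vs Z z') * (ξ k : ℂ) * (ξ j : ℂ)) -
        S.a 0 (S.dirCorrector h1 a' ξ (inclZ Vs Z z)) (S.dirCorrector h1 a' ξ (inclZ Vs Z z')) := by
  have h : S.a 0 (S.dirCorrector h1 a' ξ (inclZ Vs Z z)) (S.dirCorrector h1 a' ξ (inclZ Vs Z z')) =
      ∑ j, ∑ k, (ξ j : ℂ) * (ξ k : ℂ) * S.a 0 (S.corrector h1 a' j (inclZ Vs Z z))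
        (S.corrector h1 a' k (inclZ Vs Z z')) := by
    simp only [dirCorrector_apply, sum_apply, map_sum, smul_apply, map_smul, map_smulₛₗ,
      Complex.conj_ofReal, smul_eq_mul, Finset.mul_sum]
    rw [Finset.sum_comm]
    exact Finset.sum_congr rfl fun j _ => Finset.sum_congr rfl fun k _ => by ring
  rw [h, ← Finset.sum_sub_distrib]
  simp only [symbol, sum_apply]
  refine Finset.sum_congr rfl fun j _ => ?_
  rw [← Finset.sum_sub_distrib]
  refine Finset.sum_congr rfl fun k _ => ?_
  change _ * (a'' j k (inclZ Vs Z z) (inclZ Vs Z z') - S.a 0 (S.corrector h1 a' j (inclZ Vs Z z))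
    (S.corrector h1 a' k (inclZ Vs Z z'))) = _
  ring

theorem symbol_smul {Vs Z : Submodule ℂ H} (a' : Fin n → Form ↥(Vs ⊔ Z) H)
    (a'' : Fin n → Fin n → Form ↥(Vs ⊔ Z) ↥(Vs ⊔ Z)) (t : ℝ) (ξ : Pt n) :
    S.symbol h1 a' a'' (t • ξ) = ((t : ℂ) ^ 2) • S.symbol h1 a' a'' ξ := by
  simp only [symbol, Finset.smul_sum, smul_smul]
  refine Finset.sum_congr rfl fun j _ => Finset.sum_congr rfl fun k _ => ?_
  congr 1
  simp
  ring

end Corrector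

variable {S} {Vs Z : Submodule ℂ H} {a' : Fin n → Form ↥(Vs ⊔ Z) H}
    {a'' : Fin n → Fin n → Form ↥(Vs ⊔ Z) ↥(Vs ⊔ Z)}

theorem H4.exists_first (h4 : S.H4 Vs Z a' a'') : ∃ C ≥ 0, ∀ θ ∈ S.Θ, ∀ (v : ↥(Vs ⊔ Z)) (u : H),
    ‖S.a θ (v : H) u - dirForm a' θ v u‖ ≤ C * ‖θ‖ ^ 2 * ‖v‖ * ‖u‖ := by
  obtain ⟨-, ⟨K, hK, h⟩, -⟩ := h4
  obtain ⟨M, hM, hb⟩ := S.exists_bounds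
  have hM0 : 0 ≤ M := zero_le_one.trans hM
  refine ⟨K * M * M, by positivity, fun θ hθ v u => ?_⟩
  rw [dirForm_apply]
  calc _ ≤ K * ‖θ‖ ^ 2 * S.nrm 0 v * S.nrm 0 u := h θ hθ v u
    _ ≤ K * ‖θ‖ ^ 2 * (M * ‖v‖) * (M * ‖u‖) := by
      have e1 := (hb 0 S.zero_mem).2.2.2.1 (v : H)
      have e2 := (hb 0 S.zero_mem).2.2.2.1 u
      have e3 := S.nrm_nonneg 0 u
      gcongr
      exact e1
    _ = _ := by ring

theorem H4.exists_second (h4 : S.H4 Vs Z a' a'') : ∃ C ≥ 0, ∀ θ ∈ S.Θ, ∀ v v' : ↥(Vs ⊔ Z),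
    ‖S.a θ (v : H) (v' : H) - ∑ j, ∑ k, a'' j k v v' * (θ k : ℂ) * (θ j : ℂ)‖ ≤
      C * ‖θ‖ ^ 3 * ‖v‖ * ‖v'‖ := by
  obtain ⟨-, -, ⟨K, hK, h⟩⟩ := h4
  obtain ⟨M, hM, hb⟩ := S.exists_bounds
  have hM0 : 0 ≤ M := zero_le_one.trans hM
  refine ⟨K * M * M, by positivity, fun θ hθ v u => ?_⟩
  calc _ ≤ K * ‖θ‖ ^ 3 * S.nrm 0 v * S.nrm 0 u := h θ hθ v u
    _ ≤ K * ‖θ‖ ^ 3 * (M * ‖v‖) * (M * ‖u‖) := by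
      have e1 := (hb 0 S.zero_mem).2.2.2.1 (v : H)
      have e2 := (hb 0 S.zero_mem).2.2.2.1 (u : H)
      have e3 := S.nrm_nonneg 0 (u : H)
      gcongr
      · exact e1
      · exact e2
    _ = _ := by ring

theorem exists_norm_le_of_mem : ∃ R ≥ 0, ∀ θ ∈ S.Θ, ‖θ‖ ≤ R := by
  obtain ⟨R, hR⟩ := S.isCompact.isBounded.exists_norm_le
  exact ⟨max R 0, le_max_right _ _, fun θ hθ => (hR θ hθ).trans (le_max_left _ _)⟩

/-- On `V_0` the expansion starts with the quadratic term; boundedness of `Θ` absorbs the cubic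
remainder. -/
theorem H4.exists_a_le (h4 : S.H4 Vs Z a' a'') : ∃ C ≥ 0, ∀ θ ∈ S.Θ, ∀ v v' : ↥(Vs ⊔ Z),
    ‖S.a θ (v : H) (v' : H)‖ ≤ C * ‖θ‖ ^ 2 * ‖v‖ * ‖v'‖ := by
  obtain ⟨K, hK, h⟩ := h4.exists_second
  obtain ⟨R, hR, hΘ⟩ := S.exists_norm_le_of_mem
  refine ⟨K * R + ∑ j, ∑ k, ‖a'' j k‖, by positivity, fun θ hθ v v' => ?_⟩
  have e1 : ‖∑ j, ∑ k, a'' j k v v' * (θ k : ℂ) * (θ j : ℂ)‖ ≤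
      (∑ j, ∑ k, ‖a'' j k‖) * ‖θ‖ ^ 2 * ‖v‖ * ‖v'‖ := by
    simp only [Finset.sum_mul]
    refine norm_sum_le_of_le _ fun j _ => norm_sum_le_of_le _ fun k _ => ?_
    rw [norm_mul, norm_mul, Complex.norm_real, Complex.norm_real, Real.norm_eq_abs,
      Real.norm_eq_abs]
    calc ‖a'' j k v v'‖ * |θ k| * |θ j| ≤ (‖a'' j k‖ * ‖v‖ * ‖v'‖) * ‖θ‖ * ‖θ‖ := by
          gcongr
          · exact (a'' j k).le_opNorm₂ v v'
          · exact abs_coord_le θ k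
          · exact abs_coord_le θ j
      _ = _ := by ring
  have e2 : K * ‖θ‖ ^ 3 * ‖v‖ * ‖v'‖ ≤ K * R * ‖θ‖ ^ 2 * ‖v‖ * ‖v'‖ := by
    have : K * ‖θ‖ ^ 3 = K * ‖θ‖ * ‖θ‖ ^ 2 := by ring
    rw [this]
    gcongr
    exact hΘ θ hθ
  have e3 := (norm_le_norm_sub_add _ _).trans (add_le_add (h θ hθ v v') e1)
  refine e3.trans ?_
  rw [add_mul, add_mul, add_mul]
  linarith

variable [CompleteSpace H]

/-- The cell problem is made for this: the first order term of `a_θ(v, w)` cancels against `a_0(N_θ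
v, w)`, and replacing `a_0` by `a_θ` on `N_θ v = O(‖θ‖)` costs another factor `‖θ‖`. -/
theorem H4.exists_corrected_W (h1 : S.H1) (h4 : S.H4 Vs Z a' a'') : ∃ C ≥ 0, ∀ θ ∈ S.Θ,
    ∀ v : ↥(Vs ⊔ Z), ∀ w ∈ S.W 0,
    ‖S.a θ ((v : H) + S.dirCorrector h1 a' θ v) w‖ ≤ C * ‖θ‖ ^ 2 * ‖v‖ * ‖w‖ := by
  obtain ⟨K, hK, h⟩ := h4.exists_first
  obtain ⟨C, hC, hN⟩ := S.exists_dirCorrector_le h1 a'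
  obtain ⟨M, hM, hb⟩ := S.exists_bounds
  have hM0 : 0 ≤ M := zero_le_one.trans hM
  refine ⟨K + M * C, by positivity, fun θ hθ v w hw => ?_⟩
  have e1 := h θ hθ v w
  have e2 : ‖S.a θ (S.dirCorrector h1 a' θ v) w - S.a 0 (S.dirCorrector h1 a' θ v) w‖ ≤
      M * C * ‖θ‖ ^ 2 * ‖v‖ * ‖w‖ := by
    calc _ ≤ M * ‖θ - 0‖ * ‖S.dirCorrector h1 a' θ v‖ * ‖w‖ :=
          (hb 0 S.zero_mem).2.2.2.2.2 θ hθ _ _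
      _ ≤ M * ‖θ‖ * (C * ‖θ‖ * ‖v‖) * ‖w‖ := by
        rw [sub_zero]
        gcongr
        exact hN θ v
      _ = _ := by ring
  have e3 : S.a θ ((v : H) + S.dirCorrector h1 a' θ v) w = (S.a θ (v : H) w - dirForm a' θ v w) +
      (S.a θ (S.dirCorrector h1 a' θ v) w - S.a 0 (S.dirCorrector h1 a' θ v) w) := by
    rw [a_dirCorrector _ _ _ _ _ hw, map_add, add_apply]
    ring
  rw [e3]
  refine (norm_add_le _ _).trans ((add_le_add e1 e2).trans (le_of_eq ?_))
  ring

/-- Against `Z` the term `a_θ(z, z')` yields the `a''` part. By Hermitian symmetry `a_θ(N_θ z, z')`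
is, up to a cubic error, the conjugate of the first derivative at `(z', N_θ z)`, which the cell
problem for `z'` identifies with `-a_0(N_θ z, N_θ z')`. -/
theorem H4.exists_corrected_Z (h1 : S.H1) (h4 : S.H4 Vs Z a' a'') : ∃ C ≥ 0, ∀ θ ∈ S.Θ,
    ∀ z z' : Z, ‖S.a θ ((z : H) + S.dirCorrector h1 a' θ (inclZ Vs Z z)) (z' : H) -
      S.symbol h1 a' a'' θ z z'‖ ≤ C * ‖θ‖ ^ 3 * ‖z‖ * ‖z'‖ := by
  obtain ⟨K, hK, h⟩ := h4.exists_first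
  obtain ⟨K', hK', h'⟩ := h4.exists_second
  obtain ⟨C, hC, hN⟩ := S.exists_dirCorrector_le h1 a'
  refine ⟨K' + K * C, by positivity, fun θ hθ z z' => ?_⟩
  have e1 := h' θ hθ (inclZ Vs Z z) (inclZ Vs Z z')
  set N := S.dirCorrector h1 a' θ (inclZ Vs Z z) with hNdef
  set N' := S.dirCorrector h1 a' θ (inclZ Vs Z z') with hNdef'
  have e2 : ‖S.a θ (z' : H) N - dirForm a' θ (inclZ Vs Z z') N‖ ≤
      K * C * ‖θ‖ ^ 3 * ‖z‖ * ‖z'‖ := by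
    calc _ ≤ K * ‖θ‖ ^ 2 * ‖z'‖ * ‖N‖ := h θ hθ (inclZ Vs Z z') N
      _ ≤ K * ‖θ‖ ^ 2 * ‖z'‖ * (C * ‖θ‖ * ‖z‖) := by
        gcongr
        exact hN θ (inclZ Vs Z z)
      _ = _ := by ring
  have e3 : S.a θ ((z : H) + N) (z' : H) - S.symbol h1 a' a'' θ z z' =
      (S.a θ (z : H) (z' : H) -
        ∑ j, ∑ k, a'' j k (inclZ Vs Z z) (inclZ Vs Z z') * (θ k : ℂ) * (θ j : ℂ)) +
      (starRingEnd ℂ) (S.a θ (z' : H) N - dirForm a' θ (inclZ Vs Z z') N) := by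
    have := S.a_dirCorrector h1 a' θ (inclZ Vs Z z') (S.dirCorrector_mem h1 a' θ (inclZ Vs Z z))
    rw [← hNdef, ← hNdef'] at this
    rw [symbol_apply, ← hNdef, ← hNdef', map_sub, (S.isNonneg_a hθ).conj_symm,
      neg_eq_iff_eq_neg.mp this.symm, map_neg, (S.isNonneg_a S.zero_mem).conj_symm, map_add,
      add_apply]
    ring
  rw [e3]
  refine (norm_add_le _ _).trans ?_
  rw [RCLike.norm_conj]
  refine (add_le_add e1 e2).trans (le_of_eq ?_)
  change K' * ‖θ‖ ^ 3 * ‖z‖ * ‖z'‖ + _ = _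
  ring

end Setting

/-! ### Coercivity near zero, ellipticity of the symbol, bounds for the limit problem -/

theorem le_of_sq_le_mul {x c : ℝ} (hc : 0 ≤ c) (h : x ^ 2 ≤ c * x) : x ≤ c := by
  by_contra h1
  nlinarith [not_le.mp h1]

namespace Setting

variable {n : ℕ} {H 𝓗 : Type*} [NormedAddCommGroup H] [InnerProductSpace ℂ H]
  [NormedAddCommGroup 𝓗] [InnerProductSpace ℂ 𝓗] {S : Setting n H 𝓗}
  {Vs Z : Submodule ℂ H} {a' : Fin n → Form ↥(Vs ⊔ Z) H}
  {a'' : Fin n → Fin n → Form ↥(Vs ⊔ Z) ↥(Vs ⊔ Z)}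

theorem H4.exists_ball_subset (h4 : S.H4 Vs Z a' a'') : ∃ r > 0, ∀ ξ : Pt n, ‖ξ‖ ≤ r → ξ ∈ S.Θ := by
  obtain ⟨r, hr, h⟩ := Metric.isOpen_iff.mp isOpen_interior 0 h4.1
  exact ⟨r / 2, by positivity, fun ξ hξ => interior_subset (h (by
    rw [mem_ball_zero_iff]
    linarith))⟩

theorem norm_d_zero_le (f g : 𝓗) : ‖S.d 0 f g‖ ≤ ‖f‖ * ‖g‖ := by
  rw [S.d_zero, mul_comm]
  exact norm_inner_le_norm _ _

/-- The form `b_0` is coercive on `V_⋆ ∔ Z`. -/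
theorem IsDefect.exists_b_coercive (hZ : S.IsDefect Vs Z) : ∃ c > 0, ∀ v ∈ Vs, ∀ z ∈ Z,
    c * (‖v‖ ^ 2 + ‖z‖ ^ 2) ≤ qf (S.b 0) (v + z) := by
  obtain ⟨C, hC, h⟩ := hZ.exists_norm_le
  obtain ⟨M, hM, hb⟩ := S.exists_bounds
  have hM0 : 0 < M := zero_lt_one.trans_le hM
  refine ⟨1 / (M * (C + 1) ^ 2), by positivity, fun v hv z hz => ?_⟩
  have e1 := h v hv z hz 0 (S.W 0).zero_mem
  rw [norm_zero, add_zero, add_zero] at e1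
  have e2 := (hb 0 S.zero_mem).2.2.1 (v + z)
  -- On `V_0` the form `a_0` vanishes, so `b_0` alone controls the full norm there.
  have e3 : qf (S.a 0) (v + z) = 0 := by
    have : v + z ∈ S.V 0 := by
      rw [← hZ.2.1]
      exact Submodule.add_mem_sup hv hz
    rw [qf, show S.a 0 (v + z) (v + z) = 0 from this, Complex.zero_re]
  rw [e3, zero_add] at e2
  rw [one_div, inv_mul_le_iff₀ (by positivity)]
  calc ‖v‖ ^ 2 + ‖z‖ ^ 2 ≤ (‖v‖ + ‖z‖) ^ 2 := by
        nlinarith [norm_nonneg v, norm_nonneg z, mul_nonneg (norm_nonneg v) (norm_nonneg z)]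
    _ ≤ ((C + 1) * ‖v + z‖) ^ 2 := by
        gcongr
        linarith [norm_nonneg (v + z)]
    _ = (C + 1) ^ 2 * ‖v + z‖ ^ 2 := by ring
    _ ≤ (C + 1) ^ 2 * (M * qf (S.b 0) (v + z)) := by gcongr
    _ = _ := by ring

section Coercivity

variable [CompleteSpace H]

/-- Let `p` be the `W_θ`-component of `x = v + z + w`. Since `x - p` lies in `V_θ`, uniform
transversality bounds `‖z‖` by `‖p‖`, and the quadratic gap bounds `‖θ‖ ‖p‖` by the square root of
`a_θ[p] = a_θ[x]`. For `w`, discard `v` and estimate `a_θ[w] ≤ 2 a_θ[x] + 2 a_θ[z]` with `a_θ[z] =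
O(‖θ‖² ‖z‖²)`; the gap of `a_0` on `W_0` survives for `a_θ` with small `θ`. The case `θ = 0` is
excluded because there `V^⋆_θ` is `V_⋆` instead of `V_0`. -/
theorem exists_coercive_near (h1 : S.H1) (h2 : S.H2 Vs) (hZ : S.IsDefect Vs Z) (h3 : S.H3)
    (h4 : S.H4 Vs Z a' a'') : ∃ C > 0, ∃ δ > 0, ∀ θ ∈ S.Θ, θ ≠ 0 → ‖θ‖ ≤ δ →
      ∀ v ∈ S.Vstar Vs θ, ∀ z ∈ Z, ∀ w ∈ S.W 0,
        (‖θ‖ * ‖z‖) ^ 2 ≤ C * qf (S.a θ) (v + z + w) ∧ ‖w‖ ^ 2 ≤ C * qf (S.a θ) (v + z + w) := by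
  obtain ⟨C, hC, δ, hδ, h⟩ := exists_norm_le_near h2 hZ
  obtain ⟨M, hM, hb⟩ := S.exists_bounds
  obtain ⟨γ, hγ, hg⟩ := h3
  obtain ⟨ν, hν, hW⟩ := h1 0 S.zero_mem
  obtain ⟨K, hK, ha⟩ := h4.exists_a_le
  have hM0 : 0 < M := zero_lt_one.trans_le hM
  let A : ℝ := C ^ 2 * M ^ 2 / γ
  have hA : 0 ≤ A := by positivity
  let B : ℝ := 2 * M ^ 2 / ν * (2 + 2 * (K * A))
  have hB : 0 ≤ B := by positivity
  -- The second radius makes the Lipschitz perturbation `M ‖θ‖ ‖w‖²` at most half of the gap `(ν /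
  -- M²) ‖w‖²` of `a_0` on `W_0`.
  refine ⟨A + B + 1, by positivity, min δ (ν / (2 * M ^ 3)), by positivity,
    fun θ hθ hθ0 hθδ v hv z hz w hw => ?_⟩
  have hvV : v ∈ S.V θ := Vstar_subset_V hZ θ hv
  have hna := S.isNonneg_a hθ
  set x := v + z + w with hx
  have hq0 : 0 ≤ qf (S.a θ) x := hna.qf_nonneg x
  have b1 : (‖θ‖ * ‖z‖) ^ 2 ≤ A * qf (S.a θ) x := by
    obtain ⟨v₁, hv₁, p, hp, hxp⟩ := exists_V_W hθ x
    obtain ⟨V', hV'⟩ := exists_Vstar_submodule Vs hθ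
    have hv₁' : v - v₁ ∈ S.Vstar Vs θ := by
      have e1 : v₁ ∈ S.Vstar Vs θ := by rwa [Vstar, if_neg hθ0]
      rw [← hV'] at hv e1 ⊢
      exact V'.sub_mem hv e1
    have e2 := h θ hθ (hθδ.trans (min_le_left _ _)) _ hv₁' z hz w hw
    have e3 : v - v₁ + z + w = p := by
      rw [← sub_eq_of_eq_add' hxp, hx]
      abel
    rw [e3] at e2
    have e4 : ‖z‖ ≤ C * ‖p‖ := by linarith [norm_nonneg (v - v₁), norm_nonneg w]
    have e5 : qf (S.a θ) x = qf (S.a θ) p := by rw [hxp, hna.qf_add_of_ker hv₁]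
    have e6 := hg θ hθ p hp
    have e7 := (hb θ hθ).2.2.2.2.1 p
    rw [e5]
    calc (‖θ‖ * ‖z‖) ^ 2 ≤ (‖θ‖ * (C * (M * S.nrm θ p))) ^ 2 := by
          gcongr
          refine e4.trans ?_
          gcongr
      _ = A * (γ * ‖θ‖ ^ 2 * S.nrm θ p ^ 2) := by
          simp only [A]
          field_simp
      _ ≤ _ := by gcongr
  refine ⟨b1.trans ?_, ?_⟩
  · gcongr
    linarith
  have e1 : qf (S.a θ) x = qf (S.a θ) (z + w) := by
    rw [hx, add_assoc, hna.qf_add_of_ker hvV]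
  have e2 : qf (S.a θ) w ≤ 2 * qf (S.a θ) x + 2 * qf (S.a θ) z := by
    have e3 : w = (z + w) + -z := by abel
    have e4 := hna.qf_add_le (z + w) (-z)
    rw [← e3, qf_neg] at e4
    rw [e1]
    exact e4
  have e3 : qf (S.a θ) z ≤ K * (‖θ‖ * ‖z‖) ^ 2 := by
    have e4 := ha θ hθ ⟨z, Submodule.mem_sup_right hz⟩ ⟨z, Submodule.mem_sup_right hz⟩
    refine (Complex.re_le_norm _).trans (e4.trans (le_of_eq ?_))
    simp only [Submodule.coe_norm]
    ring
  have e4 : qf (S.a 0) w - qf (S.a θ) w ≤ M * ‖θ‖ * ‖w‖ * ‖w‖ := by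
    have e5 := (hb θ hθ).2.2.2.2.2 0 S.zero_mem w w
    rw [zero_sub, norm_neg] at e5
    refine le_trans ?_ e5
    rw [qf, qf, ← Complex.sub_re]
    exact Complex.re_le_norm _
  have e5 : ν / M ^ 2 * ‖w‖ ^ 2 ≤ qf (S.a 0) w := by
    refine le_trans ?_ (hW w hw)
    have e6 := (hb 0 S.zero_mem).2.2.2.2.1 w
    calc ν / M ^ 2 * ‖w‖ ^ 2 ≤ ν / M ^ 2 * (M * S.nrm 0 w) ^ 2 := by gcongr
      _ = _ := by field_simp
  have e6 : M * ‖θ‖ * ‖w‖ * ‖w‖ ≤ ν / (2 * M ^ 2) * ‖w‖ ^ 2 := by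
    calc M * ‖θ‖ * ‖w‖ * ‖w‖ ≤ M * (ν / (2 * M ^ 3)) * ‖w‖ * ‖w‖ := by
          gcongr
          exact hθδ.trans (min_le_right _ _)
      _ = _ := by field_simp
  have e7 : ν / (2 * M ^ 2) * ‖w‖ ^ 2 ≤ (2 + 2 * (K * A)) * qf (S.a θ) x := by
    have e8 : ν / M ^ 2 * ‖w‖ ^ 2 = 2 * (ν / (2 * M ^ 2) * ‖w‖ ^ 2) := by field_simp
    have e9 := mul_le_mul_of_nonneg_left b1 hK
    linarith
  calc ‖w‖ ^ 2 = 2 * M ^ 2 / ν * (ν / (2 * M ^ 2) * ‖w‖ ^ 2) := by field_simp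
    _ ≤ 2 * M ^ 2 / ν * ((2 + 2 * (K * A)) * qf (S.a θ) x) := by gcongr
    _ = B * qf (S.a θ) x := by simp only [B]; ring
    _ ≤ _ := by
      gcongr
      linarith

/-- The symbol is the leading part of the `a_θ`-energy of a corrected `z`. The extra pairing with
the corrector is negligible, because the corrector lies in `W_0` and is itself `O(‖θ‖)`. -/
theorem H4.exists_corrected_self (h1 : S.H1) (h4 : S.H4 Vs Z a' a'') : ∃ C ≥ 0, ∀ θ ∈ S.Θ,
    ∀ z : Z, ‖S.a θ ((z : H) + S.dirCorrector h1 a' θ (inclZ Vs Z z))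
      ((z : H) + S.dirCorrector h1 a' θ (inclZ Vs Z z)) - S.symbol h1 a' a'' θ z z‖ ≤
        C * ‖θ‖ ^ 3 * ‖z‖ ^ 2 := by
  obtain ⟨K, hK, hz⟩ := h4.exists_corrected_Z h1
  obtain ⟨L, hL, hw⟩ := h4.exists_corrected_W h1
  obtain ⟨C, hC, hN⟩ := S.exists_dirCorrector_le h1 a'
  refine ⟨K + L * C, by positivity, fun θ hθ z => ?_⟩
  set N := S.dirCorrector h1 a' θ (inclZ Vs Z z) with hNdef
  have e1 := hz θ hθ z z
  rw [← hNdef] at e1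
  have e2 : ‖S.a θ ((z : H) + N) N‖ ≤ L * C * ‖θ‖ ^ 3 * ‖z‖ ^ 2 := by
    calc _ ≤ L * ‖θ‖ ^ 2 * ‖z‖ * ‖N‖ :=
          hw θ hθ (inclZ Vs Z z) N (S.dirCorrector_mem h1 a' θ (inclZ Vs Z z))
      _ ≤ L * ‖θ‖ ^ 2 * ‖z‖ * (C * ‖θ‖ * ‖z‖) := by
        gcongr
        exact hN θ (inclZ Vs Z z)
      _ = _ := by ring
  have e3 : S.a θ ((z : H) + N) ((z : H) + N) - S.symbol h1 a' a'' θ z z =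
      (S.a θ ((z : H) + N) (z : H) - S.symbol h1 a' a'' θ z z) + S.a θ ((z : H) + N) N := by
    rw [map_add (S.a θ ((z : H) + N))]
    ring
  rw [e3]
  refine (norm_add_le _ _).trans ((add_le_add e1 e2).trans (le_of_eq ?_))
  ring

/-- Ellipticity of the homogenised symbol. -/
theorem exists_symbol_coercive (h1 : S.H1) (h2 : S.H2 Vs) (hZ : S.IsDefect Vs Z) (h3 : S.H3)
    (h4 : S.H4 Vs Z a' a'') :
    ∃ c > 0, ∀ (ξ : Pt n) (z : Z), c * (‖ξ‖ * ‖z‖) ^ 2 ≤ qf (S.symbol h1 a' a'' ξ) z := by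
  obtain ⟨C, hC, δ, hδ, h⟩ := exists_coercive_near h1 h2 hZ h3 h4
  obtain ⟨K, hK, hs⟩ := h4.exists_corrected_self h1
  obtain ⟨r, hr, hΘ⟩ := h4.exists_ball_subset
  refine ⟨1 / (2 * C), by positivity, fun ξ z => ?_⟩
  by_cases hξ : ξ = 0
  · rw [hξ, norm_zero, zero_mul, zero_pow two_ne_zero, mul_zero, ← zero_smul ℝ (0 : Pt n),
      symbol_smul]
    simp [qf]
  have hξ0 : 0 < ‖ξ‖ := norm_pos_iff.mpr hξ
  -- `ξ` is rescaled to the length `s`: inside `Θ`, within the range of coercivity, and small enough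
  -- for the cubic error to take at most half of the lower bound. Homogeneity of degree two undoes
  -- the scaling.
  let s : ℝ := min r (min δ (1 / (2 * C * (K + 1))))
  have hs0 : 0 < s := by positivity
  have hsK : C * K * s ≤ 1 / 2 := by
    calc C * K * s ≤ C * (K + 1) * (1 / (2 * C * (K + 1))) := by
          gcongr
          · linarith
          · exact (min_le_right _ _).trans (min_le_right _ _)
      _ = 1 / 2 := by field_simp
  let t : ℝ := s / ‖ξ‖
  have ht : 0 < t := by positivity
  have hθn : ‖t • ξ‖ = s := by
    rw [norm_smul, Real.norm_of_nonneg ht.le]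
    exact div_mul_cancel₀ _ hξ0.ne'
  have hθ : t • ξ ∈ S.Θ := hΘ _ (by rw [hθn]; exact min_le_left _ _)
  have hθ0 : t • ξ ≠ 0 := smul_ne_zero ht.ne' hξ
  obtain ⟨V', hV'⟩ := exists_Vstar_submodule Vs hθ
  -- Coercivity with `v = 0` and the corrector as the component in `W_0`.
  have e1 := (h _ hθ hθ0 (by
    rw [hθn]
    exact (min_le_right _ _).trans (min_le_left _ _)) 0 (by rw [← hV']; exact V'.zero_mem) z z.2 _
    (S.dirCorrector_mem h1 a' (t • ξ) (inclZ Vs Z z))).1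
  rw [zero_add] at e1
  have e2 : qf (S.a (t • ξ)) ((z : H) + S.dirCorrector h1 a' (t • ξ) (inclZ Vs Z z)) ≤
      qf (S.symbol h1 a' a'' (t • ξ)) z + K * ‖t • ξ‖ ^ 3 * ‖z‖ ^ 2 := by
    have e3 := (Complex.re_le_norm _).trans (hs _ hθ z)
    rw [Complex.sub_re] at e3
    rw [qf, qf]
    linarith
  have e3 : qf (S.symbol h1 a' a'' (t • ξ)) z = t ^ 2 * qf (S.symbol h1 a' a'' ξ) z := by
    rw [symbol_smul, qf, smul_apply, smul_apply, smul_eq_mul, ← Complex.ofReal_pow,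
      Complex.re_ofReal_mul, qf]
  have e4 : ‖t • ξ‖ = t * ‖ξ‖ := by rw [norm_smul, Real.norm_of_nonneg ht.le]
  have e5 : C * (K * ‖t • ξ‖ ^ 3 * ‖z‖ ^ 2) ≤ 1 / 2 * (‖t • ξ‖ * ‖z‖) ^ 2 := by
    calc C * (K * ‖t • ξ‖ ^ 3 * ‖z‖ ^ 2) = C * K * ‖t • ξ‖ * (‖t • ξ‖ * ‖z‖) ^ 2 := by ring
      _ ≤ _ := by
        gcongr
        rw [hθn]
        exact hsK
  have e6 := e1.trans (mul_le_mul_of_nonneg_left e2 hC.le)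
  have e7 : 1 / (2 * C) * (‖t • ξ‖ * ‖z‖) ^ 2 ≤ t ^ 2 * qf (S.symbol h1 a' a'' ξ) z := by
    rw [← e3, one_div, inv_mul_le_iff₀ (by positivity)]
    change (‖t • ξ‖ * ‖z‖) ^ 2 ≤ _ at e6
    linarith
  have e8 : t ^ 2 * (1 / (2 * C) * (‖ξ‖ * ‖z‖) ^ 2) ≤ t ^ 2 * qf (S.symbol h1 a' a'' ξ) z := by
    rw [e4] at e7
    calc _ = 1 / (2 * C) * (t * ‖ξ‖ * ‖z‖) ^ 2 := by ring
      _ ≤ _ := e7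
  exact le_of_mul_le_mul_left e8 (by positivity)

/-- The forms `a''_{jk}` are not assumed Hermitian, so reality has to be proved. As `a_θ` is real on
the diagonal, the imaginary part of the symbol at `t ξ` is `O(t³)`; it is also homogeneous of degree
two in `t`, hence zero. -/
theorem isNonneg_symbol (h1 : S.H1) (h2 : S.H2 Vs) (hZ : S.IsDefect Vs Z) (h3 : S.H3)
    (h4 : S.H4 Vs Z a' a'') (ξ : Pt n) : (S.symbol h1 a' a'' ξ).IsNonneg := by
  intro z
  obtain ⟨c, hc, h⟩ := exists_symbol_coercive h1 h2 hZ h3 h4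
  refine ⟨?_, le_trans (by positivity) (h ξ z)⟩
  obtain ⟨K, hK, hs⟩ := h4.exists_corrected_self h1
  obtain ⟨r, hr, hΘ⟩ := h4.exists_ball_subset
  have key : ∀ t : ℝ, 0 < t → t * ‖ξ‖ ≤ r →
      |(S.symbol h1 a' a'' ξ z z).im| ≤ t * (K * ‖ξ‖ ^ 3 * ‖z‖ ^ 2) := by
    intro t ht htr
    have e4 : ‖t • ξ‖ = t * ‖ξ‖ := by rw [norm_smul, Real.norm_of_nonneg ht.le]
    have hθ : t • ξ ∈ S.Θ := hΘ _ (by rw [e4]; exact htr)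
    have e1 := (Complex.abs_im_le_norm _).trans (hs _ hθ z)
    rw [Complex.sub_im, (S.isNonneg_a hθ _).1, zero_sub, abs_neg, symbol_smul, smul_apply,
      smul_apply, smul_eq_mul, ← Complex.ofReal_pow, Complex.im_ofReal_mul, abs_mul,
      abs_of_pos (by positivity), e4] at e1
    have e2 : t ^ 2 * |(S.symbol h1 a' a'' ξ z z).im| ≤
        t ^ 2 * (t * (K * ‖ξ‖ ^ 3 * ‖z‖ ^ 2)) := by
      refine e1.trans (le_of_eq ?_)
      ring
    exact le_of_mul_le_mul_left e2 (by positivity)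
  rw [← abs_nonpos_iff]
  refine ge_of_tendsto (f := fun t : ℝ => t * (K * ‖ξ‖ ^ 3 * ‖z‖ ^ 2)) (x := 𝓝[>] 0) ?_ ?_
  · have : Tendsto (fun t : ℝ => t * (K * ‖ξ‖ ^ 3 * ‖z‖ ^ 2)) (𝓝 0) (𝓝 (0 * _)) :=
      tendsto_id.mul_const _
    rw [zero_mul] at this
    exact this.mono_left nhdsWithin_le_nhds
  · have e1 : ∀ᶠ t : ℝ in 𝓝[>] 0, t * ‖ξ‖ ≤ r := by
      have : Tendsto (fun t : ℝ => t * ‖ξ‖) (𝓝[>] 0) (𝓝 (0 * _)) :=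
        (tendsto_id.mul_const _).mono_left nhdsWithin_le_nhds
      rw [zero_mul] at this
      exact this.eventually_le_const hr
    filter_upwards [e1, self_mem_nhdsWithin] with t h5 h6
    exact key t h6 h5

/-- `(v, z)` solves the limit problem on the Fourier fibre `ξ` with right-hand side `f`. -/
def IsFibreSol (h1 : S.H1) (a' : Fin n → Form ↥(Vs ⊔ Z) H)
    (a'' : Fin n → Fin n → Form ↥(Vs ⊔ Z) ↥(Vs ⊔ Z)) (ξ : Pt n) (f : 𝓗) (v : Vs) (z : Z) : Prop :=
  ∀ (v' : Vs) (z' : Z), S.symbol h1 a' a'' ξ z z' + S.b 0 ((v : H) + (z : H)) ((v' : H) + (z' : H))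
    = S.d 0 f (S.ι ((v' : H) + (z' : H)))

/-- Testing with the solution itself and coercivity of `b_0` bound `v` and `z`. Testing with `(0,
z)` and ellipticity give `‖ξ‖² ‖z‖² ≤ C ‖f‖ ‖z‖`, a gain of two derivatives. At `ξ = θ/ε` these are
the powers of `ε` in the final estimate. -/
theorem exists_fibreSol_le (h1 : S.H1) (h2 : S.H2 Vs) (hZ : S.IsDefect Vs Z) (h3 : S.H3)
    (h4 : S.H4 Vs Z a' a'') : ∃ C ≥ 0, ∀ (ξ : Pt n) (f : 𝓗) (v : Vs) (z : Z),
      S.IsFibreSol h1 a' a'' ξ f v z →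
        ‖v‖ ≤ C * ‖f‖ ∧ ‖z‖ ≤ C * ‖f‖ ∧ ‖ξ‖ * ‖z‖ ≤ C * ‖f‖ ∧ ‖ξ‖ ^ 2 * ‖z‖ ≤ C * ‖f‖ := by
  obtain ⟨c, hc, hs⟩ := exists_symbol_coercive h1 h2 hZ h3 h4
  obtain ⟨κ, hκ, hb0⟩ := hZ.exists_b_coercive
  obtain ⟨M, hM, hb⟩ := S.exists_bounds
  have hM0 : 0 < M := zero_lt_one.trans_le hM
  let A : ℝ := 2 * ‖S.ι‖ / κ
  have hA : 0 ≤ A := by positivity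
  let B : ℝ := (‖S.ι‖ + M * (2 * A)) / c
  have hB : 0 ≤ B := by positivity
  refine ⟨A + B, by positivity, fun ξ f v z h => ?_⟩
  have hι : ∀ x : H, ‖S.d 0 f (S.ι x)‖ ≤ ‖S.ι‖ * ‖f‖ * ‖x‖ := fun x =>
    calc _ ≤ ‖f‖ * ‖S.ι x‖ := S.norm_d_zero_le f _
      _ ≤ ‖f‖ * (‖S.ι‖ * ‖x‖) := by gcongr; exact S.ι.le_opNorm x
      _ = _ := by ring
  have e1 : qf (S.b 0) ((v : H) + z) ≤ ‖S.ι‖ * ‖f‖ * (‖v‖ + ‖z‖) := by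
    have e2 := congrArg Complex.re (h v z)
    rw [Complex.add_re] at e2
    have e3 := (isNonneg_symbol h1 h2 hZ h3 h4 ξ z).2
    have e4 := (Complex.re_le_norm _).trans (hι ((v : H) + z))
    have e5 : ‖S.ι‖ * ‖f‖ * ‖(v : H) + (z : H)‖ ≤ ‖S.ι‖ * ‖f‖ * (‖v‖ + ‖z‖) := by
      gcongr
      exact norm_add_le _ _
    rw [qf]
    linarith
  have e2 : ‖v‖ + ‖z‖ ≤ A * ‖f‖ := by
    refine le_of_sq_le_mul (by positivity) ?_
    have e3 := hb0 v v.2 z z.2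
    change κ * (‖v‖ ^ 2 + ‖z‖ ^ 2) ≤ _ at e3
    calc (‖v‖ + ‖z‖) ^ 2 ≤ 2 / κ * (κ * (‖v‖ ^ 2 + ‖z‖ ^ 2)) := by
          rw [← mul_assoc, div_mul_cancel₀ _ hκ.ne']
          nlinarith [sq_nonneg (‖v‖ - ‖z‖)]
      _ ≤ 2 / κ * (‖S.ι‖ * ‖f‖ * (‖v‖ + ‖z‖)) := by
          exact mul_le_mul_of_nonneg_left (e3.trans e1) (by positivity)
      _ = _ := by simp only [A]; ring
  have hv : ‖v‖ ≤ A * ‖f‖ := by linarith [norm_nonneg z]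
  have hz : ‖z‖ ≤ A * ‖f‖ := by linarith [norm_nonneg v]
  have e3 : ‖ξ‖ ^ 2 * ‖z‖ ≤ B * ‖f‖ := by
    have e4 : c * (‖ξ‖ * ‖z‖) ^ 2 ≤ (‖S.ι‖ + M * (2 * A)) * ‖f‖ * ‖z‖ := by
      refine (hs ξ z).trans ?_
      have e5 := congrArg Complex.re (h 0 z)
      rw [Complex.add_re] at e5
      simp only [ZeroMemClass.coe_zero, zero_add] at e5
      have e6 := (Complex.re_le_norm _).trans (hι z)
      have e7 := neg_le_of_abs_le ((Complex.abs_re_le_norm _).trans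
        ((hb 0 S.zero_mem).2.1 ((v : H) + z) z))
      have e8 : M * ‖(v : H) + z‖ * ‖(z : H)‖ ≤ M * (2 * A * ‖f‖) * ‖z‖ := by
        have : ‖(v : H) + z‖ ≤ ‖v‖ + ‖z‖ := norm_add_le _ _
        have e9 : ‖(v : H) + z‖ ≤ 2 * A * ‖f‖ := by linarith
        gcongr
        exact le_rfl
      rw [qf]
      change _ ≤ ‖S.ι‖ * ‖f‖ * ‖z‖ at e6
      linarith
    rcases (norm_nonneg z).eq_or_lt with h0 | h0
    · rw [← h0, mul_zero]
      positivity
    · have e5 : ‖z‖ * (‖ξ‖ ^ 2 * ‖z‖) ≤ ‖z‖ * (B * ‖f‖) := by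
        calc ‖z‖ * (‖ξ‖ ^ 2 * ‖z‖) = c⁻¹ * (c * (‖ξ‖ * ‖z‖) ^ 2) := by field_simp
          _ ≤ c⁻¹ * ((‖S.ι‖ + M * (2 * A)) * ‖f‖ * ‖z‖) := by gcongr
          _ = _ := by simp only [B]; ring
      exact le_of_mul_le_mul_left e5 h0
  have hAf : 0 ≤ A * ‖f‖ := by positivity
  have hBf : 0 ≤ B * ‖f‖ := by positivity
  rw [add_mul]
  refine ⟨by linarith, by linarith, ?_, by linarith⟩
  -- Interpolation: `2 ‖ξ‖ ≤ 1 + ‖ξ‖²`.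
  nlinarith [norm_nonneg z, sq_nonneg (‖ξ‖ - 1)]

end Coercivity

end Setting

/-! ### The energy form, the transfer operators, and the residual of the approximation -/

namespace Setting

variable {n : ℕ} {H 𝓗 : Type*} [NormedAddCommGroup H] [InnerProductSpace ℂ H]
  [NormedAddCommGroup 𝓗] [InnerProductSpace ℂ 𝓗] {S : Setting n H 𝓗}
  {Vs Z : Submodule ℂ H} {a' : Fin n → Form ↥(Vs ⊔ Z) H}
  {a'' : Fin n → Fin n → Form ↥(Vs ⊔ Z) ↥(Vs ⊔ Z)}
  {e : Pt n → Vs →ₗ[ℂ] H} {E : Pt n → 𝓗 ≃L[ℂ] 𝓗}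

variable (S) in
/-- The energy form `ε⁻² a_θ + b_θ`. -/
noncomputable def energy (ε : ℝ) (θ : Pt n) : Form H H := ((ε : ℂ) ^ 2)⁻¹ • S.a θ + S.b θ

theorem energy_apply (ε : ℝ) (θ : Pt n) (u v : H) :
    S.energy ε θ u v = (((ε ^ 2)⁻¹ : ℝ) : ℂ) * S.a θ u v + S.b θ u v := by
  simp [energy]

theorem qf_energy (ε : ℝ) (θ : Pt n) (u : H) :
    qf (S.energy ε θ) u = (ε ^ 2)⁻¹ * qf (S.a θ) u + qf (S.b θ) u := by
  rw [qf, energy_apply, Complex.add_re, Complex.re_ofReal_mul]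
  rfl

theorem isNonneg_energy (ε : ℝ) {θ : Pt n} (hθ : θ ∈ S.Θ) : (S.energy ε θ).IsNonneg := by
  intro u
  refine ⟨?_, ?_⟩
  · rw [energy_apply, Complex.add_im, Complex.im_ofReal_mul, (S.isNonneg_a hθ u).1,
      (S.isNonneg_b hθ u).1, mul_zero, add_zero]
  · have := qf_energy (S := S) ε θ u
    rw [qf] at this
    rw [this]
    have h1 := (S.isNonneg_a hθ).qf_nonneg u
    have h2 := (S.isNonneg_b hθ).qf_nonneg u
    positivity

theorem qf_a_le_energy {ε : ℝ} (hε : 0 < ε) {θ : Pt n} (hθ : θ ∈ S.Θ) (u : H) :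
    qf (S.a θ) u ≤ ε ^ 2 * qf (S.energy ε θ) u := by
  have h2 := (S.isNonneg_b hθ).qf_nonneg u
  rw [qf_energy, mul_add, mul_inv_cancel_left₀ (by positivity)]
  exact le_add_of_nonneg_right (by positivity)

theorem qf_b_le_energy (ε : ℝ) {θ : Pt n} (hθ : θ ∈ S.Θ) (u : H) :
    qf (S.b θ) u ≤ qf (S.energy ε θ) u := by
  have h2 := (S.isNonneg_a hθ).qf_nonneg u
  rw [qf_energy]
  exact le_add_of_nonneg_left (by positivity)

theorem sq_nrm_le_energy {ε : ℝ} (hε : 0 < ε) (hε1 : ε < 1) {θ : Pt n} (hθ : θ ∈ S.Θ) (u : H) :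
    qf (S.a θ) u + qf (S.b θ) u ≤ qf (S.energy ε θ) u := by
  have h2 := (S.isNonneg_a hθ).qf_nonneg u
  rw [qf_energy]
  gcongr
  exact le_mul_of_one_le_left h2 ((one_le_inv₀ (by positivity)).mpr (pow_le_one₀ hε.le hε1.le))

theorem exists_norm_d_le : ∃ C ≥ 0, ∀ θ ∈ S.Θ, ∀ f g, ‖S.d θ f g‖ ≤ C * ‖f‖ * ‖g‖ := by
  obtain ⟨K, hK, h⟩ := S.d_equiv
  have hq : ∀ θ ∈ S.Θ, ∀ f, √(qf (S.d θ) f) ≤ √K * ‖f‖ := fun θ hθ f => by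
    rw [← S.qf_zero, ← Real.sqrt_mul hK.le]
    exact Real.sqrt_le_sqrt (h θ hθ 0 S.zero_mem f)
  refine ⟨√K * √K, by positivity, fun θ hθ f g => ?_⟩
  calc ‖S.d θ f g‖ ≤ √(qf (S.d θ) f) * √(qf (S.d θ) g) := (S.isNonneg_d hθ).norm_apply_le f g
    _ ≤ (√K * ‖f‖) * (√K * ‖g‖) := by
      gcongr
      · exact hq θ hθ f
      · exact hq θ hθ g
    _ = _ := by ring

theorem exists_sqrt_qf_d_le : ∃ C ≥ 0, ∀ θ ∈ S.Θ, ∀ f, √(qf (S.d θ) f) ≤ C * ‖f‖ := by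
  obtain ⟨K, hK, h⟩ := S.d_equiv
  refine ⟨√K, by positivity, fun θ hθ f => ?_⟩
  rw [← S.qf_zero, ← Real.sqrt_mul hK.le]
  exact Real.sqrt_le_sqrt (h θ hθ 0 S.zero_mem f)

theorem H6.exists_norm_sub_le (h6 : S.H6 Vs e E) : ∃ C ≥ 0, ∀ θ ∈ S.Θ, ∀ x : 𝓗,
    ‖E θ x - x‖ ≤ C * ‖θ‖ * ‖x‖ := by
  obtain ⟨-, -, h0, K, hK, h⟩ := h6
  obtain ⟨C, hC, hn⟩ := S.norm_sq_le
  refine ⟨C * K, by positivity, fun θ hθ x => (hn θ hθ _).trans ?_⟩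
  have h1 := h θ hθ 0 S.zero_mem x
  rw [h0, sub_zero, S.qf_zero] at h1
  calc _ ≤ C * (K * ‖θ‖ * ‖x‖) := by gcongr
    _ = _ := by ring

theorem H6.sqrt_qf_d (h6 : S.H6 Vs e E) {θ : Pt n} (hθ : θ ∈ S.Θ) (x : 𝓗) :
    √(qf (S.d θ) (E θ x)) = ‖x‖ := by
  rw [qf, h6.2.1 θ hθ x x, ← qf, S.qf_zero]

theorem H6.exists_norm_le (h6 : S.H6 Vs e E) : ∃ C ≥ 0, ∀ θ ∈ S.Θ, ∀ x : 𝓗,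
    ‖E θ x‖ ≤ C * ‖x‖ ∧ ‖(E θ).symm x‖ ≤ C * ‖x‖ := by
  obtain ⟨C, hC, hn⟩ := S.norm_sq_le
  obtain ⟨K, hK, hd⟩ := S.exists_sqrt_qf_d_le
  refine ⟨C + K, by positivity, fun θ hθ x => ⟨?_, ?_⟩⟩
  · have h1 := hn θ hθ (E θ x)
    rw [h6.sqrt_qf_d hθ] at h1
    refine h1.trans ?_
    gcongr
    linarith
  · rw [← h6.sqrt_qf_d hθ, ContinuousLinearEquiv.apply_symm_apply]
    refine (hd θ hθ x).trans ?_
    gcongr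
    linarith

theorem d_eq_d_zero (h6 : S.H6 Vs e E) {θ : Pt n} (hθ : θ ∈ S.Θ) (f x : 𝓗) :
    S.d θ f (E θ x) = S.d 0 ((E θ).symm f) x := by
  rw [← h6.2.1 θ hθ, ContinuousLinearEquiv.apply_symm_apply]

/-- The `a`-parts vanish on both sides and the transfer preserves the `b`-parts. -/
theorem nrm_zero_eq_nrm (hZ : S.IsDefect Vs Z) (he : S.IsTransfer Vs Z e) {θ : Pt n}
    (hθ : θ ∈ S.Θ) (v : Vs) : S.nrm 0 (v : H) = S.nrm θ (e θ v) := by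
  have e1 : S.a θ (e θ v) (e θ v) = 0 := by
    refine Vstar_subset_V hZ θ ?_
    rw [← (he.1 θ hθ).2]
    exact ⟨v, rfl⟩
  have e2 : S.a 0 (v : H) (v : H) = 0 := by
    have : (v : H) ∈ S.V 0 := by
      rw [← hZ.2.1]
      exact Submodule.mem_sup_left v.2
    exact this
  rw [nrm, nrm, formNorm, formNorm, qf, qf, qf, qf, e1, e2, he.2.1 θ hθ]

theorem a_transfer (hZ : S.IsDefect Vs Z) (he : S.IsTransfer Vs Z e) {θ : Pt n}
    (hθ : θ ∈ S.Θ) (v : Vs) : S.a θ (e θ v) = 0 := by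
  rw [← S.mem_V_iff hθ]
  refine Vstar_subset_V hZ θ ?_
  rw [← (he.1 θ hθ).2]
  exact ⟨v, rfl⟩

theorem exists_norm_transfer_le (hZ : S.IsDefect Vs Z) (he : S.IsTransfer Vs Z e) :
    ∃ C ≥ 0, ∀ θ ∈ S.Θ, ∀ v : Vs, ‖e θ v‖ ≤ C * ‖v‖ ∧ ‖v‖ ≤ C * ‖e θ v‖ := by
  obtain ⟨M, hM, hb⟩ := S.exists_bounds
  have hM0 : 0 ≤ M := zero_le_one.trans hM
  refine ⟨M * M, by positivity, fun θ hθ v => ⟨?_, ?_⟩⟩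
  · calc ‖e θ v‖ ≤ M * S.nrm θ (e θ v) := (hb θ hθ).2.2.2.2.1 _
      _ = M * S.nrm 0 (v : H) := by rw [nrm_zero_eq_nrm hZ he hθ]
      _ ≤ M * (M * ‖v‖) := by
        gcongr
        exact (hb 0 S.zero_mem).2.2.2.1 _
      _ = _ := by ring
  · calc ‖v‖ ≤ M * S.nrm 0 (v : H) := (hb 0 S.zero_mem).2.2.2.2.1 _
      _ = M * S.nrm θ (e θ v) := by rw [nrm_zero_eq_nrm hZ he hθ]
      _ ≤ M * (M * ‖e θ v‖) := by
        gcongr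
        exact (hb θ hθ).2.2.2.1 _
      _ = _ := by ring

theorem exists_b_transfer_sub_le (he : S.IsTransfer Vs Z e) :
    ∃ C ≥ 0, ∀ θ ∈ S.Θ, ∀ (v : Vs) (z : Z),
      ‖S.b θ (e θ v) z - S.b 0 (v : H) z‖ ≤ C * ‖θ‖ * ‖v‖ * ‖z‖ := by
  obtain ⟨K, hK, h⟩ := he.2.2
  obtain ⟨M, hM, hb⟩ := S.exists_bounds
  have hM0 : 0 ≤ M := zero_le_one.trans hM
  refine ⟨K * M * M, by positivity, fun θ hθ v z => ?_⟩
  calc _ ≤ K * ‖θ‖ * S.nrm 0 v * S.nrm 0 z := h θ hθ v z z.2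
    _ ≤ K * ‖θ‖ * (M * ‖v‖) * (M * ‖z‖) := by
      have e1 := (hb 0 S.zero_mem).2.2.2.1 (v : H)
      have e2 := (hb 0 S.zero_mem).2.2.2.1 (z : H)
      have e3 := S.nrm_nonneg 0 (z : H)
      gcongr
      · exact e1
      · exact e2
    _ = _ := by ring

theorem H5.exists_b_sub_le (h5 : S.H5) (hZ : S.IsDefect Vs Z) :
    ∃ C ≥ 0, ∀ θ ∈ S.Θ, ∀ z z' : Z,
      ‖S.b θ (z : H) z' - S.b 0 (z : H) z'‖ ≤ C * ‖θ‖ * ‖z‖ * ‖z'‖ := by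
  obtain ⟨-, K, hK, h⟩ := h5
  obtain ⟨M, hM, hb⟩ := S.exists_bounds
  have hM0 : 0 ≤ M := zero_le_one.trans hM
  have hV : ∀ z : Z, (z : H) ∈ S.V 0 := fun z => by
    rw [← hZ.2.1]
    exact Submodule.mem_sup_right z.2
  refine ⟨K * M * M, by positivity, fun θ hθ z z' => ?_⟩
  calc _ ≤ K * ‖θ‖ * S.nrm 0 z * S.nrm θ z' := h θ hθ z (hV z) z' (hV z')
    _ ≤ K * ‖θ‖ * (M * ‖z‖) * (M * ‖z'‖) := by
      have e1 := (hb 0 S.zero_mem).2.2.2.1 (z : H)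
      have e2 := (hb θ hθ).2.2.2.1 (z' : H)
      have e3 := S.nrm_nonneg θ (z' : H)
      gcongr
      · exact e1
      · exact e2
    _ = _ := by ring

section Residual

variable [CompleteSpace H]

/-- The approximation `e_θ v + z + ∑_j θ_j N^j z` of the solution of the fibre problem. -/
noncomputable def approx (h1 : S.H1) (a' : Fin n → Form ↥(Vs ⊔ Z) H) (e : Pt n → Vs →ₗ[ℂ] H)
    (θ : Pt n) (v : Vs) (z : Z) : H :=
  e θ v + ((z : H) + S.dirCorrector h1 a' θ (inclZ Vs Z z))

/-- The transferred part lies in the kernel of `a_θ`, so only the corrected `z` meets the factor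
`ε⁻²`. -/
theorem energy_approx (h1 : S.H1) (hZ : S.IsDefect Vs Z) (he : S.IsTransfer Vs Z e) (ε : ℝ)
    {θ : Pt n} (hθ : θ ∈ S.Θ) (v : Vs) (z : Z) (w : H) :
    S.energy ε θ (approx h1 a' e θ v z) w = (((ε ^ 2)⁻¹ : ℝ) : ℂ) *
      S.a θ ((z : H) + S.dirCorrector h1 a' θ (inclZ Vs Z z)) w + (S.b θ (e θ v) w + S.b θ z w +
        S.b θ (S.dirCorrector h1 a' θ (inclZ Vs Z z)) w) := by
  rw [energy_apply, approx, map_add (S.a θ), add_apply, a_transfer hZ he hθ, zero_apply,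
    zero_add, map_add (S.b θ), map_add (S.b θ), add_apply, add_apply]
  ring

/-- In these directions `a_θ` vanishes. As `e_θ` preserves `b` and `E_θ` preserves `d`, the limit
equation tested with `(v', 0)` cancels all but the mismatch of `b_θ(z, e_θ v')` with `b_0(z, v')`
and the corrector term. -/
theorem exists_residual_V (h1 : S.H1) (hZ : S.IsDefect Vs Z) (he : S.IsTransfer Vs Z e)
    (h6 : S.H6 Vs e E) : ∃ C ≥ 0, ∀ θ ∈ S.Θ, ∀ (ε : ℝ) (f : 𝓗) (v : Vs) (z : Z),
      S.IsFibreSol h1 a' a'' (ε⁻¹ • θ) ((E θ).symm f) v z → ∀ v' : Vs,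
        ‖S.d θ f (S.ι (e θ v')) - S.energy ε θ (approx h1 a' e θ v z) (e θ v')‖ ≤
          C * ‖θ‖ * ‖z‖ * ‖v'‖ := by
  obtain ⟨K, hK, hbz⟩ := exists_b_transfer_sub_le he
  obtain ⟨C, hC, hN⟩ := S.exists_dirCorrector_le h1 a'
  obtain ⟨D, hD, hE⟩ := exists_norm_transfer_le hZ he
  obtain ⟨M, hM, hb⟩ := S.exists_bounds
  have hM0 : 0 ≤ M := zero_le_one.trans hM
  refine ⟨K + M * C * D, by positivity, fun θ hθ ε f v z h v' => ?_⟩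
  set N := S.dirCorrector h1 a' θ (inclZ Vs Z z) with hNdef
  have e1 : S.d θ f (S.ι (e θ v')) = S.b 0 (v : H) v' + S.b 0 (z : H) v' := by
    have := h v' 0
    rw [map_zero, zero_add, ZeroMemClass.coe_zero, add_zero, map_add, add_apply] at this
    rw [this, ← h6.1 θ hθ, d_eq_d_zero h6 hθ]
  have e2 := energy_approx (a' := a') h1 hZ he ε hθ v z (e θ v')
  rw [← hNdef, (S.isNonneg_a hθ).apply_eq_zero' (by rw [a_transfer hZ he hθ, zero_apply]),
    mul_zero, zero_add, he.2.1 θ hθ] at e2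
  have e3 : S.d θ f (S.ι (e θ v')) - S.energy ε θ (approx h1 a' e θ v z) (e θ v') =
      -(starRingEnd ℂ) (S.b θ (e θ v') z - S.b 0 (v' : H) z) - S.b θ N (e θ v') := by
    rw [e1, e2, map_sub, (S.isNonneg_b hθ).conj_symm, (S.isNonneg_b S.zero_mem).conj_symm]
    ring
  rw [e3]
  refine (norm_sub_le _ _).trans ?_
  rw [norm_neg, RCLike.norm_conj]
  have e4 : ‖S.b θ N (e θ v')‖ ≤ M * C * D * ‖θ‖ * ‖z‖ * ‖v'‖ := by
    calc _ ≤ M * ‖N‖ * ‖e θ v'‖ := (hb θ hθ).2.1 _ _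
      _ ≤ M * (C * ‖θ‖ * ‖z‖) * (D * ‖v'‖) := by
        gcongr
        · exact hN θ (inclZ Vs Z z)
        · exact (hE θ hθ v').1
      _ = _ := by ring
  refine (add_le_add (hbz θ hθ v' z) e4).trans (le_of_eq ?_)
  ring

/-- Subtract the limit equation tested with `(0, z')`; by homogeneity its symbol at `θ/ε` is `ε⁻²`
times the symbol at `θ`. Every remaining difference contains a factor `‖θ‖`, kept next to `‖z'‖`
because `‖θ‖ ‖z'‖` is `O(ε)` in the energy norm. -/
theorem exists_residual_Z (h1 : S.H1) (hZ : S.IsDefect Vs Z) (h4 : S.H4 Vs Z a' a'') (h5 : S.H5)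
    (he : S.IsTransfer Vs Z e) (h6 : S.H6 Vs e E) :
    ∃ C ≥ 0, ∀ θ ∈ S.Θ, ∀ (ε : ℝ) (f : 𝓗) (v : Vs) (z : Z),
      S.IsFibreSol h1 a' a'' (ε⁻¹ • θ) ((E θ).symm f) v z → ∀ z' : Z,
        ‖S.d θ f (S.ι z') - S.energy ε θ (approx h1 a' e θ v z) z'‖ ≤
          C * ((ε ^ 2)⁻¹ * ‖θ‖ ^ 2 * ‖z‖ + ‖v‖ + ‖z‖ + ‖f‖) * (‖θ‖ * ‖z'‖) := by
  obtain ⟨K, hK, hbz⟩ := exists_b_transfer_sub_le he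
  obtain ⟨C, hC, hN⟩ := S.exists_dirCorrector_le h1 a'
  obtain ⟨L, hL, hbL⟩ := h5.exists_b_sub_le hZ
  obtain ⟨A, hA, ha⟩ := h4.exists_corrected_Z h1
  obtain ⟨D, hD, hd⟩ := S.exists_norm_d_le
  obtain ⟨F, hF, hE⟩ := h6.exists_norm_sub_le
  obtain ⟨M, hM, hb⟩ := S.exists_bounds
  have hM0 : 0 ≤ M := zero_le_one.trans hM
  refine ⟨A + K + L + M * C + D * F * ‖S.ι‖, by positivity, fun θ hθ ε f v z h z' => ?_⟩
  set N := S.dirCorrector h1 a' θ (inclZ Vs Z z) with hNdef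
  -- The limit equation involves `E_θ z'`, the residual `z'` itself; their difference is `O(‖θ‖)`.
  have e1 : S.d θ f (S.ι z') = (((ε ^ 2)⁻¹ : ℝ) : ℂ) * S.symbol h1 a' a'' θ z z' +
      (S.b 0 (v : H) z' + S.b 0 (z : H) z') - S.d θ f (E θ (S.ι z') - S.ι z') := by
    have := h 0 z'
    rw [symbol_smul, ZeroMemClass.coe_zero, zero_add, map_add, add_apply,
      ← d_eq_d_zero h6 hθ] at this
    have e2 : (((ε ^ 2)⁻¹ : ℝ) : ℂ) * S.symbol h1 a' a'' θ z z' =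
        (((ε⁻¹ : ℝ) : ℂ) ^ 2 • S.symbol h1 a' a'' θ) z z' := by
      rw [smul_apply, smul_apply, smul_eq_mul]
      push_cast
      rw [inv_pow]
    rw [e2, this, map_sub]
    ring
  have e2 := energy_approx (a' := a') h1 hZ he ε hθ v z z'
  rw [← hNdef] at e2
  have e3 : S.d θ f (S.ι z') - S.energy ε θ (approx h1 a' e θ v z) z' =
      -((((ε ^ 2)⁻¹ : ℝ) : ℂ) * (S.a θ ((z : H) + N) z' - S.symbol h1 a' a'' θ z z') +
        (S.b θ (e θ v) z' - S.b 0 (v : H) z') + (S.b θ (z : H) z' - S.b 0 (z : H) z') +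
        S.b θ N z' + S.d θ f (E θ (S.ι z') - S.ι z')) := by
    rw [e1, e2]
    ring
  have n1 : ‖(((ε ^ 2)⁻¹ : ℝ) : ℂ) * (S.a θ ((z : H) + N) z' - S.symbol h1 a' a'' θ z z')‖ ≤
      A * ((ε ^ 2)⁻¹ * ‖θ‖ ^ 2 * ‖z‖) * (‖θ‖ * ‖z'‖) := by
    rw [norm_mul, Complex.norm_real, Real.norm_of_nonneg (by positivity)]
    calc _ ≤ (ε ^ 2)⁻¹ * (A * ‖θ‖ ^ 3 * ‖z‖ * ‖z'‖) := by gcongr; exact ha θ hθ z z'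
      _ = _ := by ring
  have n2 := hbz θ hθ v z'
  have n3 := hbL θ hθ z z'
  have n4 : ‖S.b θ N z'‖ ≤ M * C * ‖z‖ * (‖θ‖ * ‖z'‖) := by
    calc _ ≤ M * ‖N‖ * ‖(z' : H)‖ := (hb θ hθ).2.1 _ _
      _ ≤ M * (C * ‖θ‖ * ‖z‖) * ‖z'‖ := by
        gcongr
        · exact hN θ (inclZ Vs Z z)
        · exact le_rfl
      _ = _ := by ring
  have n5 : ‖S.d θ f (E θ (S.ι z') - S.ι z')‖ ≤ D * F * ‖S.ι‖ * ‖f‖ * (‖θ‖ * ‖z'‖) := by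
    calc _ ≤ D * ‖f‖ * ‖E θ (S.ι z') - S.ι z'‖ := hd θ hθ _ _
      _ ≤ D * ‖f‖ * (F * ‖θ‖ * ‖S.ι z'‖) := by gcongr; exact hE θ hθ _
      _ ≤ D * ‖f‖ * (F * ‖θ‖ * (‖S.ι‖ * ‖z'‖)) := by gcongr; exact S.ι.le_opNorm _
      _ = _ := by ring
  rw [e3, norm_neg]
  refine (norm_add_le _ _).trans ((add_le_add ((norm_add_le _ _).trans (add_le_add
    ((norm_add_le _ _).trans (add_le_add ((norm_add_le _ _).trans (add_le_add n1 n2)) n3))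
    n4)) n5).trans ?_)
  have hT : 0 ≤ ‖θ‖ * ‖z'‖ := by positivity
  have p1 : K * ‖θ‖ * ‖v‖ * ‖z'‖ = K * ‖v‖ * (‖θ‖ * ‖z'‖) := by ring
  have p2 : L * ‖θ‖ * ‖z‖ * ‖z'‖ = L * ‖z‖ * (‖θ‖ * ‖z'‖) := by ring
  rw [p1, p2, ← add_mul, ← add_mul, ← add_mul, ← add_mul]
  refine mul_le_mul_of_nonneg_right ?_ hT
  set X := (ε ^ 2)⁻¹ * ‖θ‖ ^ 2 * ‖z‖ with hX
  have hX0 : 0 ≤ X := by positivity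
  set G := A + K + L + M * C + D * F * ‖S.ι‖ with hG
  have hs1 : 0 ≤ M * C := by positivity
  have hs2 : 0 ≤ D * F * ‖S.ι‖ := by positivity
  have q1 : A * X ≤ G * X := by gcongr; linarith
  have q2 : K * ‖v‖ ≤ G * ‖v‖ := by gcongr; linarith
  have q3 : (L + M * C) * ‖z‖ ≤ G * ‖z‖ := by gcongr; linarith
  have q4 : D * F * ‖S.ι‖ * ‖f‖ ≤ G * ‖f‖ := by gcongr; linarith
  linarith

/-- The limit equation plays no role here. Boundedness is enough, since `‖w‖` is `O(ε)` in the
energy norm; what must be avoided is a term of size `ε⁻² ‖θ‖ ‖z‖`, and the corrector removes it. -/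
theorem exists_residual_W (h1 : S.H1) (hZ : S.IsDefect Vs Z) (h4 : S.H4 Vs Z a' a'')
    (he : S.IsTransfer Vs Z e) :
    ∃ C ≥ 0, ∀ θ ∈ S.Θ, ∀ (ε : ℝ) (f : 𝓗) (v : Vs) (z : Z), ∀ w ∈ S.W 0,
        ‖S.d θ f (S.ι w) - S.energy ε θ (approx h1 a' e θ v z) w‖ ≤
          C * ((ε ^ 2)⁻¹ * ‖θ‖ ^ 2 * ‖z‖ + ‖v‖ + ‖z‖ + ‖f‖) * ‖w‖ := by
  obtain ⟨C, hC, hN⟩ := S.exists_dirCorrector_le h1 a'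
  obtain ⟨A, hA, ha⟩ := h4.exists_corrected_W h1
  obtain ⟨D, hD, hd⟩ := S.exists_norm_d_le
  obtain ⟨T, hT, hE⟩ := exists_norm_transfer_le hZ he
  obtain ⟨R, hR, hΘ⟩ := S.exists_norm_le_of_mem
  obtain ⟨M, hM, hb⟩ := S.exists_bounds
  have hM0 : 0 ≤ M := zero_le_one.trans hM
  refine ⟨A + M * T + M + M * C * R + D * ‖S.ι‖, by positivity, fun θ hθ ε f v z w hw => ?_⟩
  set N := S.dirCorrector h1 a' θ (inclZ Vs Z z) with hNdef
  have e2 := energy_approx (a' := a') h1 hZ he ε hθ v z w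
  rw [← hNdef] at e2
  have n1 : ‖(((ε ^ 2)⁻¹ : ℝ) : ℂ) * S.a θ ((z : H) + N) w‖ ≤
      A * ((ε ^ 2)⁻¹ * ‖θ‖ ^ 2 * ‖z‖) * ‖w‖ := by
    rw [norm_mul, Complex.norm_real, Real.norm_of_nonneg (by positivity)]
    calc _ ≤ (ε ^ 2)⁻¹ * (A * ‖θ‖ ^ 2 * ‖z‖ * ‖w‖) := by
          gcongr
          exact ha θ hθ (inclZ Vs Z z) w hw
      _ = _ := by ring
  have n2 : ‖S.b θ (e θ v) w‖ ≤ M * T * ‖v‖ * ‖w‖ := by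
    calc _ ≤ M * ‖e θ v‖ * ‖w‖ := (hb θ hθ).2.1 _ _
      _ ≤ M * (T * ‖v‖) * ‖w‖ := by gcongr; exact (hE θ hθ v).1
      _ = _ := by ring
  have n3 : ‖S.b θ (z : H) w‖ ≤ M * ‖z‖ * ‖w‖ := (hb θ hθ).2.1 _ _
  have n4 : ‖S.b θ N w‖ ≤ M * C * R * ‖z‖ * ‖w‖ := by
    calc _ ≤ M * ‖N‖ * ‖w‖ := (hb θ hθ).2.1 _ _
      _ ≤ M * (C * R * ‖z‖) * ‖w‖ := by
        gcongr
        refine (hN θ (inclZ Vs Z z)).trans ?_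
        change C * ‖θ‖ * ‖z‖ ≤ _
        gcongr
        exact hΘ θ hθ
      _ = _ := by ring
  have n5 : ‖S.d θ f (S.ι w)‖ ≤ D * ‖S.ι‖ * ‖f‖ * ‖w‖ := by
    calc _ ≤ D * ‖f‖ * ‖S.ι w‖ := hd θ hθ _ _
      _ ≤ D * ‖f‖ * (‖S.ι‖ * ‖w‖) := by gcongr; exact S.ι.le_opNorm _
      _ = _ := by ring
  rw [e2]
  refine (norm_sub_le _ _).trans ((add_le_add n5 ((norm_add_le _ _).trans (add_le_add n1
    ((norm_add_le _ _).trans (add_le_add ((norm_add_le _ _).trans (add_le_add n2 n3)) n4))))).trans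
    ?_)
  rw [← add_mul, ← add_mul, ← add_mul, ← add_mul]
  refine mul_le_mul_of_nonneg_right ?_ (norm_nonneg w)
  set X := (ε ^ 2)⁻¹ * ‖θ‖ ^ 2 * ‖z‖ with hX
  have hX0 : 0 ≤ X := by positivity
  have hs1 : 0 ≤ M * T := by positivity
  have hs2 : 0 ≤ M * C * R := by positivity
  have hs3 : 0 ≤ D * ‖S.ι‖ := by positivity
  set G := A + M * T + M + M * C * R + D * ‖S.ι‖ with hG
  have q1 : A * X ≤ G * X := by gcongr; linarith
  have q2 : M * T * ‖v‖ ≤ G * ‖v‖ := by gcongr; linarith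
  have q3 : (M + M * C * R) * ‖z‖ ≤ G * ‖z‖ := by gcongr; linarith
  have q4 : D * ‖S.ι‖ * ‖f‖ ≤ G * ‖f‖ := by gcongr; linarith
  linarith

end Residual

end Setting

/-! ### The estimate on the fibres -/

namespace Setting

variable {n : ℕ} {H 𝓗 : Type*} [NormedAddCommGroup H] [InnerProductSpace ℂ H]
  [NormedAddCommGroup 𝓗] [InnerProductSpace ℂ 𝓗] {S : Setting n H 𝓗}
  {Vs Z : Submodule ℂ H} {a' : Fin n → Form ↥(Vs ⊔ Z) H}
  {a'' : Fin n → Fin n → Form ↥(Vs ⊔ Z) ↥(Vs ⊔ Z)}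
  {e : Pt n → Vs →ₗ[ℂ] H} {E : Pt n → 𝓗 ≃L[ℂ] 𝓗}

theorem exists_norm_le_energy : ∃ M ≥ 0, ∀ θ ∈ S.Θ, ∀ ε : ℝ, 0 < ε → ε < 1 → ∀ u,
    ‖u‖ ≤ M * √(qf (S.energy ε θ) u) ∧ ‖S.ι u‖ ≤ M * √(qf (S.energy ε θ) u) := by
  obtain ⟨M, hM, hb⟩ := S.exists_bounds
  have hM0 : 0 ≤ M := zero_le_one.trans hM
  obtain ⟨K, hK, hd⟩ := S.norm_sq_le
  refine ⟨√M + K, by positivity, fun θ hθ ε hε hε1 u => ?_⟩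
  have h0 := Real.sqrt_nonneg (qf (S.energy ε θ) u)
  rw [add_mul]
  constructor
  · have e1 : ‖u‖ ≤ √M * √(qf (S.energy ε θ) u) := by
      rw [← Real.sqrt_mul hM0]
      refine Real.le_sqrt_of_sq_le (((hb θ hθ).2.2.1 u).trans ?_)
      exact mul_le_mul_of_nonneg_left (sq_nrm_le_energy hε hε1 hθ u) hM0
    exact e1.trans (le_add_of_nonneg_right (by positivity))
  · have e1 : ‖S.ι u‖ ≤ K * √(qf (S.energy ε θ) u) := by
      refine (hd θ hθ _).trans ?_
      gcongr
      exact (S.d_le θ hθ u).trans (qf_b_le_energy ε hθ u)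
    exact e1.trans (le_add_of_nonneg_left (by positivity))

/-- The energy contains `ε⁻² a_θ`, so whatever `a_θ` controls is smaller than the energy norm by a
factor `ε`. -/
theorem norm_le_of_sq_le_a {θ : Pt n} (hθ : θ ∈ S.Θ) {ε C x : ℝ} (hε : 0 < ε) (hC : 0 < C) {w : H}
    (h : x ^ 2 ≤ C * qf (S.a θ) w) : x ≤ √C * (ε * √(qf (S.energy ε θ) w)) := by
  have h1 : x ^ 2 ≤ (√C * (ε * √(qf (S.energy ε θ) w))) ^ 2 := by
    rw [mul_pow, mul_pow, Real.sq_sqrt hC.le, Real.sq_sqrt ((isNonneg_energy ε hθ).qf_nonneg w)]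
    exact h.trans (mul_le_mul_of_nonneg_left (qf_a_le_energy hε hθ w) hC.le)
  exact le_of_sq_le_sq h1 (by positivity)

section Estimate

variable [CompleteSpace H]

/-- Bounds for the solution of the limit fibre problem in terms of the parameters of the original
one. -/
theorem exists_scaled_fibreSol_le (h1 : S.H1) (h2 : S.H2 Vs) (hZ : S.IsDefect Vs Z) (h3 : S.H3)
    (h4 : S.H4 Vs Z a' a'') (h6 : S.H6 Vs e E) : ∃ C ≥ 0, ∀ θ ∈ S.Θ, ∀ (ε : ℝ), 0 < ε →
      ∀ (f : 𝓗) (v : Vs) (z : Z), S.IsFibreSol h1 a' a'' (ε⁻¹ • θ) ((E θ).symm f) v z →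
        ‖v‖ ≤ C * ‖f‖ ∧ ‖z‖ ≤ C * ‖f‖ ∧ ‖θ‖ * ‖z‖ ≤ ε * (C * ‖f‖) ∧
          (ε ^ 2)⁻¹ * ‖θ‖ ^ 2 * ‖z‖ ≤ C * ‖f‖ := by
  obtain ⟨C, hC, h⟩ := exists_fibreSol_le h1 h2 hZ h3 h4
  obtain ⟨K, hK, hE⟩ := h6.exists_norm_le
  refine ⟨C * K, by positivity, fun θ hθ ε hε f v z hs => ?_⟩
  have h0 : C * ‖(E θ).symm f‖ ≤ C * K * ‖f‖ := by
    rw [mul_assoc]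
    gcongr
    exact (hE θ hθ f).2
  obtain ⟨b1, b2, b3, b4⟩ := h _ _ v z hs
  have e1 : ‖ε⁻¹ • θ‖ = ε⁻¹ * ‖θ‖ := by
    rw [norm_smul, Real.norm_of_nonneg (inv_nonneg.mpr hε.le)]
  rw [e1] at b3 b4
  refine ⟨b1.trans h0, b2.trans h0, ?_, ?_⟩
  · have := b3.trans h0
    rwa [mul_assoc, inv_mul_le_iff₀ hε] at this
  · have := b4.trans h0
    rwa [mul_pow, inv_pow] at this

/-- The error `u - approx` is measured in the energy norm by duality on the dense sum of `V^⋆_θ`,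
`Z` and `W_0`. The three residuals are each `O(ε ‖f‖)` times the energy norm of the whole test
function: the first through `‖θ‖ ‖z‖ = O(ε ‖f‖)`, the others through coercivity. -/
theorem exists_fibre_near (h1 : S.H1) (h2 : S.H2 Vs) (hZ : S.IsDefect Vs Z) (h3 : S.H3)
    (h4 : S.H4 Vs Z a' a'') (h5 : S.H5) (he : S.IsTransfer Vs Z e) (h6 : S.H6 Vs e E) :
    ∃ C ≥ 0, ∃ δ > 0, ∀ θ ∈ S.Θ, θ ≠ 0 → ‖θ‖ ≤ δ → ∀ ε : ℝ, 0 < ε → ε < 1 →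
      ∀ (f : 𝓗) (u : H) (v : Vs) (z : Z), (∀ w, S.energy ε θ u w = S.d θ f (S.ι w)) →
        S.IsFibreSol h1 a' a'' (ε⁻¹ • θ) ((E θ).symm f) v z →
          ‖S.ι u - E θ (S.ι ((v : H) + z))‖ ≤ C * ε * ‖f‖ := by
  obtain ⟨P, hP, hs⟩ := exists_scaled_fibreSol_le h1 h2 hZ h3 h4 h6
  obtain ⟨M, hM, hen⟩ := S.exists_norm_le_energy
  obtain ⟨A, hA, δ₁, hδ₁, hsplit⟩ := exists_norm_le_near h2 hZ
  obtain ⟨δ₂, hδ₂, hdense⟩ := exists_dense_near h2 hZ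
  obtain ⟨B, hB, δ₃, hδ₃, hcoer⟩ := exists_coercive_near h1 h2 hZ h3 h4
  obtain ⟨Rv, hRv, hrv⟩ := exists_residual_V (a' := a') (a'' := a'') h1 hZ he h6
  obtain ⟨Rz, hRz, hrz⟩ := exists_residual_Z h1 hZ h4 h5 he h6
  obtain ⟨Rw, hRw, hrw⟩ := exists_residual_W h1 hZ h4 he
  obtain ⟨T, hT, hE⟩ := exists_norm_transfer_le hZ he
  obtain ⟨N, hN, hcor⟩ := S.exists_dirCorrector_le h1 a'
  obtain ⟨F, hF, hEs⟩ := h6.exists_norm_sub_le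
  -- Three terms of the bracket in the residual bounds are at most `P ‖f‖`; the fourth is `‖f‖`.
  let G : ℝ := 3 * P + 1
  let K : ℝ := Rv * P * (T * (A * M)) + Rz * G * √B + Rw * G * √B
  have hG : 0 ≤ G := by positivity
  have hK : 0 ≤ K := by positivity
  refine ⟨M * K + ‖S.ι‖ * N * P + F * ‖S.ι‖ * P, by positivity, min δ₁ (min δ₂ δ₃), by positivity,
    fun θ hθ hθ0 hθδ ε hε hε1 f u v z hu hvz => ?_⟩
  have d1 : ‖θ‖ ≤ δ₁ := hθδ.trans (min_le_left _ _)
  have d2 : ‖θ‖ ≤ δ₂ := hθδ.trans ((min_le_right _ _).trans (min_le_left _ _))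
  have d3 : ‖θ‖ ≤ δ₃ := hθδ.trans ((min_le_right _ _).trans (min_le_right _ _))
  obtain ⟨s1, s2, s3, s4⟩ := hs θ hθ ε hε f v z hvz
  have hsum : (ε ^ 2)⁻¹ * ‖θ‖ ^ 2 * ‖z‖ + ‖v‖ + ‖z‖ + ‖f‖ ≤ G * ‖f‖ := by
    simp only [G]
    linarith
  have hx : √(qf (S.energy ε θ) (u - approx h1 a' e θ v z)) ≤ K * ε * ‖f‖ := by
    refine (isNonneg_energy ε hθ).sqrt_qf_le (hdense θ hθ d2) (by positivity) ?_
    rintro w ⟨v', hv', z', hz', w', hw', rfl⟩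
    set X := √(qf (S.energy ε θ) (v' + z' + w')) with hXdef
    have hX : 0 ≤ X := Real.sqrt_nonneg _
    have c1 := hsplit θ hθ d1 v' hv' z' hz' w' hw'
    have c2 := (hen θ hθ ε hε hε1 (v' + z' + w')).1
    obtain ⟨c3, c4⟩ := hcoer θ hθ hθ0 d3 v' hv' z' hz' w' hw'
    have c5 := norm_le_of_sq_le_a hθ hε hB c3
    have c6 := norm_le_of_sq_le_a hθ hε hB c4
    rw [← hXdef] at c2 c5 c6
    rw [← (he.1 θ hθ).2] at hv'
    obtain ⟨v₀, rfl⟩ := hv'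
    have c7 : ‖v₀‖ ≤ T * (A * M) * X := by
      calc ‖v₀‖ ≤ T * ‖e θ v₀‖ := (hE θ hθ v₀).2
        _ ≤ T * (A * (M * X)) := by
          gcongr
          have := mul_le_mul_of_nonneg_left c2 hA
          linarith [norm_nonneg z', norm_nonneg w']
        _ = _ := by ring
    have r1 : ‖S.d θ f (S.ι (e θ v₀)) - S.energy ε θ (approx h1 a' e θ v z) (e θ v₀)‖ ≤
        Rv * P * (T * (A * M)) * (ε * ‖f‖ * X) := by
      calc _ ≤ Rv * ‖θ‖ * ‖z‖ * ‖v₀‖ := hrv θ hθ ε f v z hvz v₀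
        _ = Rv * (‖θ‖ * ‖z‖) * ‖v₀‖ := by ring
        _ ≤ Rv * (ε * (P * ‖f‖)) * (T * (A * M) * X) := by gcongr
        _ = _ := by ring
    have r2 : ‖S.d θ f (S.ι z') - S.energy ε θ (approx h1 a' e θ v z) z'‖ ≤
        Rz * G * √B * (ε * ‖f‖ * X) := by
      calc _ ≤ Rz * ((ε ^ 2)⁻¹ * ‖θ‖ ^ 2 * ‖z‖ + ‖v‖ + ‖z‖ + ‖f‖) * (‖θ‖ * ‖z'‖) :=
            hrz θ hθ ε f v z hvz ⟨z', hz'⟩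
        _ ≤ Rz * (G * ‖f‖) * (√B * (ε * X)) := by gcongr
        _ = _ := by ring
    have r3 : ‖S.d θ f (S.ι w') - S.energy ε θ (approx h1 a' e θ v z) w'‖ ≤
        Rw * G * √B * (ε * ‖f‖ * X) := by
      calc _ ≤ Rw * ((ε ^ 2)⁻¹ * ‖θ‖ ^ 2 * ‖z‖ + ‖v‖ + ‖z‖ + ‖f‖) * ‖w'‖ :=
            hrw θ hθ ε f v z w' hw'
        _ ≤ Rw * (G * ‖f‖) * (√B * (ε * X)) := by gcongr
        _ = _ := by ring
    have e1 : S.energy ε θ (u - approx h1 a' e θ v z) (e θ v₀ + z' + w') =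
        (S.d θ f (S.ι (e θ v₀)) - S.energy ε θ (approx h1 a' e θ v z) (e θ v₀)) +
        (S.d θ f (S.ι z') - S.energy ε θ (approx h1 a' e θ v z) z') +
        (S.d θ f (S.ι w') - S.energy ε θ (approx h1 a' e θ v z) w') := by
      rw [map_sub, sub_apply, hu]
      simp only [map_add]
      ring
    rw [e1]
    refine (norm_add_le _ _).trans ((add_le_add ((norm_add_le _ _).trans (add_le_add r1 r2))
      r3).trans (le_of_eq ?_))
    simp only [K]
    ring
  -- On `V_⋆` the operators `E_θ` and `e_θ` agree. What is left besides the energy error is the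
  -- corrector and `E_θ z - z`, both `O(‖θ‖ ‖z‖) = O(ε ‖f‖)`.
  have e2 : S.ι u - E θ (S.ι ((v : H) + z)) = S.ι (u - approx h1 a' e θ v z) +
      S.ι (S.dirCorrector h1 a' θ (inclZ Vs Z z)) - (E θ (S.ι z) - S.ι z) := by
    rw [map_add S.ι, map_add (E θ), h6.1 θ hθ, approx, map_sub, map_add, map_add]
    abel
  have n1 : ‖S.ι (u - approx h1 a' e θ v z)‖ ≤ M * K * ε * ‖f‖ := by
    calc _ ≤ M * √(qf (S.energy ε θ) (u - approx h1 a' e θ v z)) := (hen θ hθ ε hε hε1 _).2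
      _ ≤ M * (K * ε * ‖f‖) := by gcongr
      _ = _ := by ring
  have n2 : ‖S.ι (S.dirCorrector h1 a' θ (inclZ Vs Z z))‖ ≤ ‖S.ι‖ * N * P * ε * ‖f‖ := by
    calc _ ≤ ‖S.ι‖ * ‖S.dirCorrector h1 a' θ (inclZ Vs Z z)‖ := S.ι.le_opNorm _
      _ ≤ ‖S.ι‖ * (N * ‖θ‖ * ‖z‖) := by gcongr; exact hcor θ (inclZ Vs Z z)
      _ = ‖S.ι‖ * N * (‖θ‖ * ‖z‖) := by ring
      _ ≤ ‖S.ι‖ * N * (ε * (P * ‖f‖)) := by gcongr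
      _ = _ := by ring
  have n3 : ‖E θ (S.ι z) - S.ι z‖ ≤ F * ‖S.ι‖ * P * ε * ‖f‖ := by
    calc _ ≤ F * ‖θ‖ * ‖S.ι z‖ := hEs θ hθ _
      _ ≤ F * ‖θ‖ * (‖S.ι‖ * ‖z‖) := by gcongr; exact S.ι.le_opNorm _
      _ = F * ‖S.ι‖ * (‖θ‖ * ‖z‖) := by ring
      _ ≤ F * ‖S.ι‖ * (ε * (P * ‖f‖)) := by gcongr
      _ = _ := by ring
  rw [e2]
  refine (norm_sub_le _ _).trans ((add_le_add ((norm_add_le _ _).trans (add_le_add n1 n2))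
    n3).trans (le_of_eq ?_))
  ring

/-- For `‖θ‖ ≥ δ` the gap is at least `γ δ²`, so the `W_θ`-components of test functions are `O(ε)`
in the energy norm; and `‖θ‖ ‖z‖ = O(ε ‖f‖)` makes `z` itself small. No corrector is needed: `u` is
compared with `e_θ v`. -/
theorem exists_fibre_far (h1 : S.H1) (h2 : S.H2 Vs) (hZ : S.IsDefect Vs Z) (h3 : S.H3)
    (h4 : S.H4 Vs Z a' a'') (he : S.IsTransfer Vs Z e) (h6 : S.H6 Vs e E) {δ : ℝ} (hδ : 0 < δ) :
    ∃ C ≥ 0, ∀ θ ∈ S.Θ, δ ≤ ‖θ‖ → ∀ ε : ℝ, 0 < ε → ε < 1 →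
      ∀ (f : 𝓗) (u : H) (v : Vs) (z : Z), (∀ w, S.energy ε θ u w = S.d θ f (S.ι w)) →
        S.IsFibreSol h1 a' a'' (ε⁻¹ • θ) ((E θ).symm f) v z →
          ‖S.ι u - E θ (S.ι ((v : H) + z))‖ ≤ C * ε * ‖f‖ := by
  obtain ⟨P, hP, hs⟩ := exists_scaled_fibreSol_le h1 h2 hZ h3 h4 h6
  obtain ⟨M, hM, hen⟩ := S.exists_norm_le_energy
  obtain ⟨B, hB, hb⟩ := S.exists_bounds
  have hB0 : 0 < B := zero_lt_one.trans_le hB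
  obtain ⟨γ, hγ, hgap⟩ := h3
  obtain ⟨T, hT, hE⟩ := exists_norm_transfer_le hZ he
  obtain ⟨D, hD, hd⟩ := S.exists_norm_d_le
  obtain ⟨F, hF, hEn⟩ := h6.exists_norm_le
  let A : ℝ := B ^ 2 / (γ * δ ^ 2)
  have hA : 0 < A := by positivity
  let K : ℝ := B * (P / δ) * (T * (M + √A)) + (D * ‖S.ι‖ + B * T * P) * √A
  have hK : 0 ≤ K := by positivity
  refine ⟨M * K + F * ‖S.ι‖ * (P / δ), by positivity,
    fun θ hθ hθδ ε hε hε1 f u v z hu hvz => ?_⟩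
  have hθ0 : θ ≠ 0 := by
    rintro rfl
    rw [norm_zero] at hθδ
    linarith
  obtain ⟨s1, -, s3, -⟩ := hs θ hθ ε hε f v z hvz
  have hz : ‖z‖ ≤ P / δ * (ε * ‖f‖) := by
    rw [div_mul_eq_mul_div, le_div_iff₀ hδ]
    calc ‖z‖ * δ ≤ ‖z‖ * ‖θ‖ := by gcongr
      _ = ‖θ‖ * ‖z‖ := mul_comm _ _
      _ ≤ ε * (P * ‖f‖) := s3
      _ = _ := by ring
  have hat := a_transfer hZ he hθ
  have hx : √(qf (S.energy ε θ) (u - e θ v)) ≤ K * ε * ‖f‖ := by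
    refine (isNonneg_energy ε hθ).sqrt_qf_le dense_univ (by positivity) fun w _ => ?_
    obtain ⟨v', hv', p, hp, hwp⟩ := exists_V_W hθ w
    set X := √(qf (S.energy ε θ) w) with hXdef
    have hX : 0 ≤ X := Real.sqrt_nonneg _
    have c1 : ‖p‖ ^ 2 ≤ A * qf (S.a θ) w := by
      have e1 : qf (S.a θ) w = qf (S.a θ) p := by
        rw [hwp, (S.isNonneg_a hθ).qf_add_of_ker hv']
      have e2 := (hb θ hθ).2.2.2.2.1 p
      have e3 := hgap θ hθ p hp
      rw [e1]
      calc ‖p‖ ^ 2 ≤ (B * S.nrm θ p) ^ 2 := by gcongr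
        _ = A * (γ * δ ^ 2 * S.nrm θ p ^ 2) := by
          simp only [A]
          field_simp
        _ ≤ A * (γ * ‖θ‖ ^ 2 * S.nrm θ p ^ 2) := by gcongr
        _ ≤ _ := by gcongr
    have c2 := norm_le_of_sq_le_a hθ hε hA c1
    have c3 := (hen θ hθ ε hε hε1 w).1
    rw [← hXdef] at c2 c3
    have hv'' : v' ∈ S.Vstar Vs θ := by rwa [Vstar, if_neg hθ0]
    rw [← (he.1 θ hθ).2] at hv''
    obtain ⟨v₀, hv₀⟩ := hv''
    have c4 : ‖v₀‖ ≤ T * (M + √A) * X := by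
      have e1 : ‖e θ v₀‖ ≤ ‖w‖ + ‖p‖ := by
        rw [hv₀, ← sub_eq_iff_eq_add.mpr hwp]
        exact norm_sub_le _ _
      have e2 : √A * (ε * X) ≤ √A * X := by
        gcongr
        exact mul_le_of_le_one_left hX hε1.le
      calc ‖v₀‖ ≤ T * ‖e θ v₀‖ := (hE θ hθ v₀).2
        _ ≤ T * (M * X + √A * X) := by
          gcongr
          linarith
        _ = _ := by ring
    -- The limit equation tested with `(v₀, 0)` cancels the `V_θ`-direction up to the small term
    -- `b_0(z, v₀)`.
    have e1 : S.energy ε θ (u - e θ v) w =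
        S.b 0 (z : H) v₀ + (S.d θ f (S.ι p) - S.b θ (e θ v) p) := by
      have e2 := hvz v₀ 0
      rw [map_zero, zero_add, ZeroMemClass.coe_zero, add_zero, map_add, add_apply,
        ← d_eq_d_zero h6 hθ, h6.1 θ hθ, ← he.2.1 θ hθ] at e2
      rw [map_sub, sub_apply, hu, energy_apply, hat, zero_apply, mul_zero, zero_add, hwp, ← hv₀,
        map_add, map_add, map_add, ← e2]
      ring
    have n1 : ‖S.b 0 (z : H) v₀‖ ≤ B * (P / δ) * (T * (M + √A)) * (ε * ‖f‖ * X) := by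
      calc _ ≤ B * ‖z‖ * ‖v₀‖ := (hb 0 S.zero_mem).2.1 _ _
        _ ≤ B * (P / δ * (ε * ‖f‖)) * (T * (M + √A) * X) := by gcongr
        _ = _ := by ring
    have n2 : ‖S.d θ f (S.ι p)‖ ≤ D * ‖S.ι‖ * √A * (ε * ‖f‖ * X) := by
      calc _ ≤ D * ‖f‖ * ‖S.ι p‖ := hd θ hθ _ _
        _ ≤ D * ‖f‖ * (‖S.ι‖ * (√A * (ε * X))) := by
          gcongr
          exact (S.ι.le_opNorm _).trans (by gcongr)
        _ = _ := by ring
    have n3 : ‖S.b θ (e θ v) p‖ ≤ B * T * P * √A * (ε * ‖f‖ * X) := by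
      calc _ ≤ B * ‖e θ v‖ * ‖p‖ := (hb θ hθ).2.1 _ _
        _ ≤ B * (T * (P * ‖f‖)) * (√A * (ε * X)) := by
          gcongr
          exact ((hE θ hθ v).1).trans (by gcongr)
        _ = _ := by ring
    rw [e1]
    refine (norm_add_le _ _).trans ((add_le_add n1 ((norm_sub_le _ _).trans
      (add_le_add n2 n3))).trans (le_of_eq ?_))
    simp only [K]
    ring
  have e2 : S.ι u - E θ (S.ι ((v : H) + z)) = S.ι (u - e θ v) - E θ (S.ι z) := by
    rw [map_add S.ι, map_add (E θ), h6.1 θ hθ, map_sub]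
    abel
  have n1 : ‖S.ι (u - e θ v)‖ ≤ M * K * ε * ‖f‖ := by
    calc _ ≤ M * √(qf (S.energy ε θ) (u - e θ v)) := (hen θ hθ ε hε hε1 _).2
      _ ≤ M * (K * ε * ‖f‖) := by gcongr
      _ = _ := by ring
  have n2 : ‖E θ (S.ι z)‖ ≤ F * ‖S.ι‖ * (P / δ) * ε * ‖f‖ := by
    calc _ ≤ F * ‖S.ι z‖ := (hEn θ hθ _).1
      _ ≤ F * (‖S.ι‖ * (P / δ * (ε * ‖f‖))) := by
        gcongr
        exact (S.ι.le_opNorm _).trans (by gcongr; exact hz)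
      _ = _ := by ring
  rw [e2]
  refine (norm_sub_le _ _).trans ((add_le_add n1 n2).trans (le_of_eq ?_))
  ring

/-- The uniform estimate of the difference of the solutions of the original and of the limit
problem on the fibres. -/
theorem exists_fibre_estimate (h1 : S.H1) (h2 : S.H2 Vs) (hZ : S.IsDefect Vs Z) (h3 : S.H3)
    (h4 : S.H4 Vs Z a' a'') (h5 : S.H5) (he : S.IsTransfer Vs Z e) (h6 : S.H6 Vs e E) :
    ∃ C ≥ 0, ∀ θ ∈ S.Θ, θ ≠ 0 → ∀ ε : ℝ, 0 < ε → ε < 1 →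
      ∀ (f : 𝓗) (u : H) (v : Vs) (z : Z), (∀ w, S.energy ε θ u w = S.d θ f (S.ι w)) →
        S.IsFibreSol h1 a' a'' (ε⁻¹ • θ) ((E θ).symm f) v z →
          ‖S.ι u - E θ (S.ι ((v : H) + z))‖ ≤ C * ε * ‖f‖ := by
  obtain ⟨C, hC, δ, hδ, hn⟩ := exists_fibre_near h1 h2 hZ h3 h4 h5 he h6
  obtain ⟨C', hC', hf⟩ := exists_fibre_far h1 h2 hZ h3 h4 he h6 hδ
  refine ⟨C + C', by positivity, fun θ hθ hθ0 ε hε hε1 f u v z hu hvz => ?_⟩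
  rcases le_total ‖θ‖ δ with h | h
  · refine (hn θ hθ hθ0 h ε hε hε1 f u v z hu hvz).trans ?_
    gcongr
    linarith
  · refine (hf θ hθ h ε hε hε1 f u v z hu hvz).trans ?_
    gcongr
    linarith

end Estimate

end Setting

/-! ### Solvability of the fibre problems -/

namespace Setting

variable {n : ℕ} {H 𝓗 : Type*} [NormedAddCommGroup H] [InnerProductSpace ℂ H]
  [NormedAddCommGroup 𝓗] [InnerProductSpace ℂ 𝓗] {S : Setting n H 𝓗}
  {Vs Z : Submodule ℂ H} {a' : Fin n → Form ↥(Vs ⊔ Z) H}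
  {a'' : Fin n → Fin n → Form ↥(Vs ⊔ Z) ↥(Vs ⊔ Z)}

section FibreOperator

theorem eq_zero_of_d_eq_zero {θ : Pt n} (hθ : θ ∈ S.Θ) {f : 𝓗}
    (h : ∀ m, S.d θ f (S.ι.toLinearMap m) = 0) : f = 0 := by
  have h1 : ∀ g, S.d θ f g = 0 := fun g =>
    S.ι_dense.induction_on (p := fun g => S.d θ f g = 0) g
      (isClosed_eq (S.d θ f).continuous continuous_const) h
  obtain ⟨K, hK, hd⟩ := S.norm_sq_le
  have h2 := hd θ hθ f
  rw [qf, h1, Complex.zero_re, Real.sqrt_zero, mul_zero] at h2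
  exact norm_le_zero_iff.mp h2

theorem eq_zero_of_energy_eq_zero {θ : Pt n} (hθ : θ ∈ S.Θ) {ε : ℝ} (hε : 0 < ε) (hε1 : ε < 1)
    (m : H) (h : Form.toSesq (S.energy ε θ) m m = 0) : m = 0 := by
  obtain ⟨M, hM, hen⟩ := S.exists_norm_le_energy
  have h1 := (hen θ hθ ε hε hε1 m).1
  have h2 : S.energy ε θ m m = 0 := h
  rw [qf, h2, Complex.zero_re, Real.sqrt_zero, mul_zero] at h1
  exact norm_le_zero_iff.mp h1

theorem exists_energy_solution [CompleteSpace H] {θ : Pt n} (hθ : θ ∈ S.Θ) {ε : ℝ} (hε : 0 < ε)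
    (hε1 : ε < 1) (f : 𝓗) : ∃ u, ∀ w, S.energy ε θ u w = S.d θ f (S.ι w) := by
  obtain ⟨M, hM, hb⟩ := S.exists_bounds
  have hM0 : 0 < M := zero_lt_one.trans_le hM
  obtain ⟨N, hN⟩ := exists_solution (S.energy ε θ)
    ((S.d θ).bilinearComp (ContinuousLinearMap.id ℂ 𝓗) S.ι) (c := M⁻¹) (inv_pos.mpr hM0)
    (fun w => by
      rw [inv_mul_le_iff₀ hM0]
      refine ((hb θ hθ).2.2.1 w).trans ?_
      exact mul_le_mul_of_nonneg_left (sq_nrm_le_energy hε hε1 hθ w) hM0.le)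
  exact ⟨N f, fun w => hN f w⟩

theorem fibreOp_bijective [CompleteSpace H] {θ : Pt n} (hθ : θ ∈ S.Θ) {ε : ℝ} (hε : 0 < ε)
    (hε1 : ε < 1) : Function.Bijective (S.fibreOp ε θ) :=
  formOperator_bijective S.ι_injective (fun _ h => eq_zero_of_d_eq_zero hθ h)
    (eq_zero_of_energy_eq_zero hθ hε hε1) (exists_energy_solution hθ hε hε1)

theorem opInv_fibreOp {θ : Pt n} (hθ : θ ∈ S.Θ) {ε : ℝ} (hε : 0 < ε)
    (hε1 : ε < 1) {f : 𝓗} {u : H} (h : ∀ w, S.energy ε θ u w = S.d θ f (S.ι w)) :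
    opInv (S.fibreOp ε θ) f = S.ι u :=
  opInv_formOperator (B := Form.toSesq (S.energy ε θ)) (J := S.ι.toLinearMap) S.ι_injective
    (fun _ h => eq_zero_of_d_eq_zero hθ h) (eq_zero_of_energy_eq_zero hθ hε hε1) h

end FibreOperator

section LimitFibre

variable [CompleteSpace H]

theorem continuous_symbol (h1 : S.H1) : Continuous (S.symbol h1 a' a'') := by
  have : ContinuousAdd (Form Z Z) := ContinuousLinearMap.topologicalAddGroup.toContinuousAdd
  have h : ∀ j : Fin n, Continuous fun ξ : Pt n => (ξ j : ℂ) := fun j =>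
    Complex.continuous_ofReal.comp (EuclideanSpace.proj (𝕜 := ℝ) j).continuous
  exact continuous_finsetSum _ fun j _ => continuous_finsetSum _ fun k _ =>
    ((h j).mul (h k)).smul continuous_const

theorem continuous_bilinearComp {V W X Y : Type*} [NormedAddCommGroup V] [NormedSpace ℂ V]
    [NormedAddCommGroup W] [NormedSpace ℂ W] [NormedAddCommGroup X] [NormedSpace ℂ X]
    [NormedAddCommGroup Y] [NormedSpace ℂ Y] (p : X →L[ℂ] V) (q : Y →L[ℂ] W) :
    Continuous fun B : Form V W => (B.bilinearComp p q : Form X Y) := by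
  let L : Form V W →ₗ[ℂ] Form X Y :=
    { toFun := fun B => B.bilinearComp p q
      map_add' := fun B B' => rfl
      map_smul' := fun c B => rfl }
  refine AddMonoidHomClass.continuous_of_bound L (‖p‖ * ‖q‖) fun B => ?_
  refine ContinuousLinearMap.opNorm_le_bound₂ _ (by positivity) fun x y => ?_
  calc ‖B (p x) (q y)‖ ≤ ‖B‖ * ‖p x‖ * ‖q y‖ := B.le_opNorm₂ _ _
    _ ≤ ‖B‖ * (‖p‖ * ‖x‖) * (‖q‖ * ‖y‖) := by
      gcongr
      · exact p.le_opNorm x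
      · exact q.le_opNorm y
    _ = _ := by ring

/-- The solution operators of the limit problem on the Fourier fibres. -/
theorem exists_limit_solution (h1 : S.H1) (h2 : S.H2 Vs) (hZ : S.IsDefect Vs Z) (h3 : S.H3)
    (h4 : S.H4 Vs Z a' a'') : ∃ (RV : Pt n → 𝓗 →L[ℂ] Vs) (RZ : Pt n → 𝓗 →L[ℂ] Z),
      Continuous RV ∧ Continuous RZ ∧
        ∀ ξ f, S.IsFibreSol h1 a' a'' ξ f (RV ξ f) (RZ ξ f) := by
  have : CompleteSpace Vs := h2.1.completeSpace_coe
  have : CompleteSpace Z := hZ.1.completeSpace_coe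
  obtain ⟨κ, hκ, hb0⟩ := hZ.exists_b_coercive
  -- With the `L²` norm the product is a Hilbert space, so the fibre problem becomes an operator
  -- equation there. Coercivity with the constant `κ` of `b_0` is uniform in `ξ`, as the symbol is
  -- non-negative.
  let p : WithLp 2 (Vs × Z) →L[ℂ] Vs := WithLp.fstL 2 ℂ Vs Z
  let q : WithLp 2 (Vs × Z) →L[ℂ] Z := WithLp.sndL 2 ℂ Vs Z
  let s : WithLp 2 (Vs × Z) →L[ℂ] H := Vs.subtypeL.comp p + Z.subtypeL.comp q
  let B : Pt n → Form (WithLp 2 (Vs × Z)) (WithLp 2 (Vs × Z)) := fun ξ =>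
    (S.symbol h1 a' a'' ξ).bilinearComp q q + (S.b 0).bilinearComp s s
  let l : Form 𝓗 (WithLp 2 (Vs × Z)) :=
    (S.d 0).bilinearComp (ContinuousLinearMap.id ℂ 𝓗) (S.ι.comp s)
  have hBc : Continuous B := by
    have : ContinuousAdd (Form (WithLp 2 (Vs × Z)) (WithLp 2 (Vs × Z))) :=
      ContinuousLinearMap.topologicalAddGroup.toContinuousAdd
    exact ((continuous_bilinearComp q q).comp (continuous_symbol h1)).add continuous_const
  let T : Pt n → WithLp 2 (Vs × Z) →L[ℂ] WithLp 2 (Vs × Z) := fun ξ => riesz.comp (B ξ)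
  have hTc : Continuous T := continuous_const.clm_comp hBc
  have hT : ∀ ξ x y, inner ℂ y (T ξ x) = B ξ x y := fun ξ x y => inner_riesz (B ξ x) y
  have hu : ∀ ξ, IsUnit (T ξ) := fun ξ => by
    refine ContinuousLinearMap.isUnit_of_forall_le_norm_inner_map (T ξ)
      (c := ⟨κ, hκ.le⟩) (by exact_mod_cast hκ) (fun x => ?_)
    rw [norm_inner_symm, hT]
    refine le_trans ?_ (Complex.re_le_norm _)
    have e1 := (isNonneg_symbol h1 h2 hZ h3 h4 ξ (q x)).2
    have e2 := hb0 (p x) (p x).2 (q x) (q x).2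
    have e3 : ‖x‖ ^ 2 = ‖((p x : Vs) : H)‖ ^ 2 + ‖((q x : Z) : H)‖ ^ 2 :=
      WithLp.prod_norm_sq_eq_of_L2 x
    have e4 : (B ξ x x).re = (S.symbol h1 a' a'' ξ (q x) (q x)).re +
      qf (S.b 0) ((p x : H) + (q x : H)) := rfl
    change ‖x‖ ^ 2 * κ ≤ _
    rw [e3, e4]
    linarith
  let U : Pt n → WithLp 2 (Vs × Z) ≃L[ℂ] WithLp 2 (Vs × Z) := fun ξ =>
    ContinuousLinearEquiv.unitsEquiv ℂ _ (hu ξ).unit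
  have hU : ∀ ξ, (U ξ : WithLp 2 (Vs × Z) →L[ℂ] WithLp 2 (Vs × Z)) = T ξ := fun ξ => rfl
  let R : Pt n → 𝓗 →L[ℂ] WithLp 2 (Vs × Z) := fun ξ =>
    ((U ξ).symm : WithLp 2 (Vs × Z) →L[ℂ] WithLp 2 (Vs × Z)).comp (riesz.comp l)
  -- Inversion is continuous at invertible operators. Continuity in `ξ` is what makes the fibrewise
  -- solutions measurable.
  have hRc : Continuous R := by
    refine Continuous.clm_comp ?_ continuous_const
    refine continuous_iff_continuousAt.mpr fun ξ => ?_
    have e1 : ContinuousAt ContinuousLinearMap.inverse (T ξ) :=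
      (contDiffAt_map_inverse (𝕜 := ℂ) (n := 0) (U ξ)).continuousAt
    have e2 : ContinuousAt (fun x => ContinuousLinearMap.inverse (T x)) ξ :=
      ContinuousAt.comp e1 hTc.continuousAt
    refine e2.congr (Eventually.of_forall fun x => ?_)
    exact ContinuousLinearMap.inverse_equiv (U x)
  have hR : ∀ ξ f x, B ξ (R ξ f) x = l f x := fun ξ f x => by
    have e1 : T ξ (R ξ f) = riesz (l f) := (U ξ).apply_symm_apply (riesz (l f))
    rw [← hT, e1]
    exact inner_riesz (l f) x
  refine ⟨fun ξ => p.comp (R ξ), fun ξ => q.comp (R ξ), continuous_const.clm_comp hRc,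
    continuous_const.clm_comp hRc, fun ξ f v' z' => ?_⟩
  exact hR ξ f (WithLp.toLp 2 (v', z'))

end LimitFibre

end Setting

/-! ### The limit operator in Fourier variables -/

theorem aestronglyMeasurable_clm_family {n : ℕ} {F G : Type*} [NormedAddCommGroup F]
    [NormedSpace ℂ F] [NormedAddCommGroup G] [NormedSpace ℂ G] {R : Pt n → F →L[ℂ] G}
    (hR : Continuous R) (f : Lp F 2 (volume : Measure (Pt n))) :
    AEStronglyMeasurable (fun ξ => R ξ (f ξ)) volume :=
  (isBoundedBilinearMap_apply (𝕜 := ℂ) (E := F) (F := G)).continuous.comp_aestronglyMeasurable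
    (hR.aestronglyMeasurable.prodMk (Lp.aestronglyMeasurable f))

theorem intForm_eq_integral_fourier {n : ℕ} {F G : Type*} [NormedAddCommGroup F]
    [InnerProductSpace ℂ F] [CompleteSpace F] [NormedAddCommGroup G] [InnerProductSpace ℂ G]
    [CompleteSpace G] (B : Form F G) (f : Lp F 2 (volume : Measure (Pt n)))
    (g : Lp G 2 (volume : Measure (Pt n))) :
    intForm B f g = ∫ ξ, B (fourier f ξ) (fourier g ξ) :=
  (intForm_fourier B f g).symm

theorem sum_intForm_eq_integral {n : ℕ} {F G : Type*} [NormedAddCommGroup F]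
    [InnerProductSpace ℂ F] [CompleteSpace F] [NormedAddCommGroup G] [InnerProductSpace ℂ G]
    [CompleteSpace G] {ι κ : Type*} [Fintype ι] [Fintype κ] (B : ι → κ → Form F F) (b : Form G G)
    (u : ι → Lp F 2 (volume : Measure (Pt n))) (u' : κ → Lp F 2 (volume : Measure (Pt n)))
    (w w' : Lp G 2 (volume : Measure (Pt n))) :
    Integrable (fun ξ => (∑ j, ∑ k, B j k (fourier (u j) ξ) (fourier (u' k) ξ)) +
        b (fourier w ξ) (fourier w' ξ)) ∧
      (∑ j, ∑ k, intForm (B j k) (u j) (u' k)) + intForm b w w' =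
        ∫ ξ, ((∑ j, ∑ k, B j k (fourier (u j) ξ) (fourier (u' k) ξ)) +
          b (fourier w ξ) (fourier w' ξ)) := by
  have hI := fun j k => integrable_form (B j k) (fourier (u j)) (fourier (u' k))
  have hS := fun j => integrable_finsetSum Finset.univ fun k _ => hI j k
  have hT := integrable_finsetSum Finset.univ fun j _ => hS j
  have hb := integrable_form b (fourier w) (fourier w')
  refine ⟨hT.add hb, ?_⟩
  rw [integral_add hT hb, integral_finsetSum _ fun j _ => hS j]
  simp only [intForm_eq_integral_fourier]
  congr 1
  exact Finset.sum_congr rfl fun j _ => (integral_finsetSum _ fun k _ => hI j k).symm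

theorem eq_zero_of_add_sq_nonpos {a b : ℝ} (h : a ^ 2 + b ^ 2 ≤ 0) : a = 0 ∧ b = 0 :=
  ⟨pow_eq_zero_iff two_ne_zero |>.mp (le_antisymm (by linarith [sq_nonneg b]) (sq_nonneg a)),
    pow_eq_zero_iff two_ne_zero |>.mp (le_antisymm (by linarith [sq_nonneg a]) (sq_nonneg b))⟩

theorem continuous_coord {n : ℕ} (j : Fin n) : Continuous fun ξ : Pt n => (ξ j : ℂ) :=
  Complex.continuous_ofReal.comp (EuclideanSpace.proj (𝕜 := ℝ) j).continuous

theorem Form.apply_smul_smul {V W : Type*} [NormedAddCommGroup V] [NormedSpace ℂ V]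
    [NormedAddCommGroup W] [NormedSpace ℂ W] (B : Form V W) (s t : ℝ) (v : V) (w : W) :
    B ((Complex.I * (s : ℂ)) • v) ((Complex.I * (t : ℂ)) • w) = (s : ℂ) * (t : ℂ) * B v w := by
  simp only [map_smul, map_smulₛₗ, smul_apply, smul_eq_mul, map_mul, Complex.conj_I,
    Complex.conj_ofReal]
  linear_combination (-(s : ℂ) * (t : ℂ) * B v w) * Complex.I_sq

namespace Setting

variable {n : ℕ} {H 𝓗 : Type*} [NormedAddCommGroup H] [InnerProductSpace ℂ H]
  [NormedAddCommGroup 𝓗] [InnerProductSpace ℂ 𝓗] {S : Setting n H 𝓗}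
  {Vs Z : Submodule ℂ H} {a' : Fin n → Form ↥(Vs ⊔ Z) H}
  {a'' : Fin n → Fin n → Form ↥(Vs ⊔ Z) ↥(Vs ⊔ Z)}

theorem IsDefect.mem_sobolev_iff [CompleteSpace Z] (hZ : S.IsDefect Vs Z)
    {p : Lp Z 2 (volume : Measure (Pt n)) × (Fin n → Lp Z 2 (volume : Measure (Pt n)))} :
    p ∈ sobolev n Z (S.b 0) ↔
      ∀ j, ∀ᵐ ξ, fourier (p.2 j) ξ = (Complex.I * (ξ j : ℂ)) • fourier p.1 ξ := by
  refine Bivariate.mem_sobolev_iff fun z hz => ?_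
  obtain ⟨κ, hκ, h⟩ := hZ.exists_b_coercive
  have h1 := h 0 Vs.zero_mem z z.2
  rw [zero_add, qf, hz z, Complex.zero_re, norm_zero] at h1
  have h2 := (eq_zero_of_add_sq_nonpos (nonpos_of_mul_nonpos_right h1 hκ)).2
  exact Subtype.ext (norm_eq_zero.mp h2)

section

variable [CompleteSpace Vs] [CompleteSpace Z]

theorem fourier_value [CompleteSpace H] (m : S.FormDomain Vs Z) :
    fourier (S.value Vs Z m) =ᵐ[volume]
      fun ξ => ((fourier m.2 ξ : Vs) : H) + ((fourier m.1.1.1 ξ : Z) : H) := by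
  have e : fourier (S.value Vs Z m) =
      Z.subtypeL.compLp (fourier m.1.1.1) + Vs.subtypeL.compLp (fourier m.2) := by
    rw [← fourier_compLp, ← fourier_compLp, ← map_add]
    rfl
  rw [e]
  filter_upwards [Lp.coeFn_add (Z.subtypeL.compLp (fourier m.1.1.1))
    (Vs.subtypeL.compLp (fourier m.2)), Z.subtypeL.coeFn_compLp (fourier m.1.1.1),
    Vs.subtypeL.coeFn_compLp (fourier m.2)] with ξ h1 h2 h3
  rw [h1, Pi.add_apply, h2, h3, add_comm]
  rfl

/-- The gradient is listed as separate data in the form domain; it is determined by the function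
through the multipliers `i ξ_j`. -/
theorem formDomain_eq_zero (hZ : S.IsDefect Vs Z) {m : S.FormDomain Vs Z}
    (h : ∀ᵐ ξ, fourier m.2 ξ = 0 ∧ fourier m.1.1.1 ξ = 0) : m = 0 := by
  have key : ∀ {F : Type _} [NormedAddCommGroup F] [InnerProductSpace ℂ F] [CompleteSpace F]
      (f : Lp F 2 (volume : Measure (Pt n))), (∀ᵐ ξ, fourier f ξ = 0) → f = 0 := fun f hf => by
    apply fourier.injective
    rw [map_zero]
    exact Lp.eq_zero_iff_ae_eq_zero.mpr hf
  have hp := hZ.mem_sobolev_iff.mp m.1.2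
  refine Prod.ext (Subtype.ext (Prod.ext (key _ (h.mono fun _ => And.right)) (funext fun j => ?_)))
    (key _ (h.mono fun _ => And.left))
  refine key _ ?_
  filter_upwards [h, hp j] with ξ e1 e2
  rw [e2, e1.2, smul_zero]

end

variable [CompleteSpace H]

theorem symbol_apply_eq_sum (h1 : S.H1) (ξ : Pt n) (z z' : Z) :
    S.symbol h1 a' a'' ξ z z' =
      ∑ j, ∑ k, (ξ j : ℂ) * (ξ k : ℂ) * S.ah h1 a' a'' j k z z' := by
  simp only [symbol, sum_apply, smul_apply, smul_eq_mul]

theorem Q_apply (h1 : S.H1) (m m' : S.FormDomain Vs Z) :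
    S.Q h1 a' a'' m m' = (∑ j, ∑ k, intForm (S.ah h1 a' a'' j k) (m.1.1.2 j) (m'.1.1.2 k)) +
      intForm (S.b 0) (S.value Vs Z m) (S.value Vs Z m') := rfl

variable [CompleteSpace Vs] [CompleteSpace Z]

/-- The integrand of the bivariate form in Fourier variables. -/
noncomputable def fibreForm (h1 : S.H1) (a' : Fin n → Form ↥(Vs ⊔ Z) H)
    (a'' : Fin n → Fin n → Form ↥(Vs ⊔ Z) ↥(Vs ⊔ Z)) (m m' : S.FormDomain Vs Z) (ξ : Pt n) : ℂ :=
  S.symbol h1 a' a'' ξ (fourier m.1.1.1 ξ) (fourier m'.1.1.1 ξ) +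
    S.b 0 ((fourier m.2 ξ : Vs) + (fourier m.1.1.1 ξ : Z) : H)
      ((fourier m'.2 ξ : Vs) + (fourier m'.1.1.1 ξ : Z) : H)

/-- Each derivative contributes `i ξ_j`; antilinearity in the second argument cancels the imaginary
units and leaves `ξ_j ξ_k`. -/
theorem fibreForm_ae_eq (h1 : S.H1) (hZ : S.IsDefect Vs Z) (m m' : S.FormDomain Vs Z) :
    fibreForm h1 a' a'' m m' =ᵐ[volume] fun ξ =>
      (∑ j, ∑ k, S.ah h1 a' a'' j k (fourier (m.1.1.2 j) ξ) (fourier (m'.1.1.2 k) ξ)) +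
        S.b 0 (fourier (S.value Vs Z m) ξ) (fourier (S.value Vs Z m') ξ) := by
  have hp := eventually_all.mpr (hZ.mem_sobolev_iff.mp m.1.2)
  have hp' := eventually_all.mpr (hZ.mem_sobolev_iff.mp m'.1.2)
  filter_upwards [hp, hp', fourier_value m, fourier_value m'] with ξ e1 e2 e3 e4
  rw [e3, e4, fibreForm, symbol_apply_eq_sum]
  refine congrArg (· + _) (Finset.sum_congr rfl fun j _ => Finset.sum_congr rfl fun k _ => ?_)
  rw [e1 j, e2 k]
  exact (Form.apply_smul_smul _ _ _ _ _).symm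

theorem integrable_fibreForm (h1 : S.H1) (hZ : S.IsDefect Vs Z) (m m' : S.FormDomain Vs Z) :
    Integrable (fibreForm h1 a' a'' m m') :=
  (sum_intForm_eq_integral (S.ah h1 a' a'') (S.b 0) m.1.1.2 m'.1.1.2 (S.value Vs Z m)
    (S.value Vs Z m')).1.congr (fibreForm_ae_eq (a' := a') (a'' := a'') h1 hZ m m').symm

theorem Q_eq_integral (h1 : S.H1) (hZ : S.IsDefect Vs Z) (m m' : S.FormDomain Vs Z) :
    S.Q h1 a' a'' m m' = ∫ ξ, fibreForm h1 a' a'' m m' ξ := by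
  rw [Q_apply, (sum_intForm_eq_integral (S.ah h1 a' a'') (S.b 0) m.1.1.2 m'.1.1.2
    (S.value Vs Z m) (S.value Vs Z m')).2]
  exact (integral_congr_ae (fibreForm_ae_eq h1 hZ m m')).symm

/-- Hermitian symmetry is known for the symbol and not for the individual `a^h_{jk}`, hence the
detour through the Fourier fibres. -/
theorem Q_hermitian (h1 : S.H1) (h2 : S.H2 Vs) (hZ : S.IsDefect Vs Z) (h3 : S.H3)
    (h4 : S.H4 Vs Z a' a'') (m m' : S.FormDomain Vs Z) :
    S.Q h1 a' a'' m m' = (starRingEnd ℂ) (S.Q h1 a' a'' m' m) := by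
  rw [Q_eq_integral h1 hZ m m', Q_eq_integral h1 hZ m' m, ← integral_conj]
  refine integral_congr_ae (Eventually.of_forall fun ξ => ?_)
  simp only [fibreForm, map_add (starRingEnd ℂ)]
  rw [(isNonneg_symbol h1 h2 hZ h3 h4 ξ).conj_symm, (S.isNonneg_b S.zero_mem).conj_symm]

theorem Q_self_eq_zero (h1 : S.H1) (h2 : S.H2 Vs) (hZ : S.IsDefect Vs Z) (h3 : S.H3)
    (h4 : S.H4 Vs Z a' a'') (m : S.FormDomain Vs Z) (h : S.Q h1 a' a'' m m = 0) : m = 0 := by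
  obtain ⟨κ, hκ, hb⟩ := hZ.exists_b_coercive
  have hi := integrable_fibreForm (a' := a') (a'' := a'') h1 hZ m m
  have he := Q_eq_integral (a' := a') (a'' := a'') h1 hZ m m
  have hle : ∀ ξ, κ * (‖fourier m.2 ξ‖ ^ 2 + ‖fourier m.1.1.1 ξ‖ ^ 2) ≤
      (fibreForm h1 a' a'' m m ξ).re := fun ξ => by
    rw [fibreForm, Complex.add_re]
    have e1 := (isNonneg_symbol h1 h2 hZ h3 h4 ξ (fourier m.1.1.1 ξ)).2
    have e2 := hb _ (fourier m.2 ξ).2 _ (fourier m.1.1.1 ξ).2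
    exact e2.trans (le_add_of_nonneg_left e1)
  have h0 : ∫ ξ, (fibreForm h1 a' a'' m m ξ).re = 0 := by
    have := integral_re hi
    rw [← he, h] at this
    exact this
  have h5 := (integral_eq_zero_iff_of_nonneg
    (fun ξ => le_trans (by positivity) (hle ξ)) hi.re).mp h0
  refine formDomain_eq_zero hZ ?_
  filter_upwards [h5] with ξ h6
  have h7 := hle ξ
  have h8 : (fibreForm h1 a' a'' m m ξ).re = 0 := h6
  rw [h8] at h7
  have h9 := nonpos_of_mul_nonpos_right h7 hκ
  exact (eq_zero_of_add_sq_nonpos h9).imp norm_eq_zero.mp norm_eq_zero.mp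

variable [CompleteSpace 𝓗]

/-- The limit problem can be solved fibrewise in the form domain. -/
theorem exists_formDomain_fibreSol (h1 : S.H1) (h2 : S.H2 Vs) (hZ : S.IsDefect Vs Z) (h3 : S.H3)
    (h4 : S.H4 Vs Z a' a'') (g : Lp 𝓗 2 (volume : Measure (Pt n))) :
    ∃ m : S.FormDomain Vs Z,
      ∀ᵐ ξ, S.IsFibreSol h1 a' a'' ξ (fourier g ξ) (fourier m.2 ξ) (fourier m.1.1.1 ξ) := by
  obtain ⟨RV, RZ, hV, hRZ, hR⟩ := exists_limit_solution h1 h2 hZ h3 h4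
  obtain ⟨C, hC, hle⟩ := exists_fibreSol_le h1 h2 hZ h3 h4
  have hb := fun ξ f => hle ξ f _ _ (hR ξ f)
  have mV : MemLp (fun ξ => RV ξ (fourier g ξ)) 2 (volume : Measure (Pt n)) :=
    MemLp.of_le_mul (c := C) (Lp.memLp (fourier g)) (aestronglyMeasurable_clm_family hV _)
      (Eventually.of_forall fun ξ => (hb ξ _).1)
  have sZ := aestronglyMeasurable_clm_family hRZ (fourier g)
  have mZ : MemLp (fun ξ => RZ ξ (fourier g ξ)) 2 (volume : Measure (Pt n)) :=
    MemLp.of_le_mul (c := C) (Lp.memLp (fourier g)) sZ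
      (Eventually.of_forall fun ξ => (hb ξ _).2.1)
  -- The bound on `‖ξ‖ ‖z‖` puts the solution into `H¹`.
  have mD : ∀ j : Fin n, MemLp (fun ξ => (Complex.I * (ξ j : ℂ)) • RZ ξ (fourier g ξ)) 2
      (volume : Measure (Pt n)) := fun j => by
    refine MemLp.of_le_mul (c := C) (Lp.memLp (fourier g))
      ((continuous_const.mul (continuous_coord j)).aestronglyMeasurable.smul sZ)
      (Eventually.of_forall fun ξ => ?_)
    rw [norm_smul, norm_mul, Complex.norm_I, one_mul, Complex.norm_real]
    refine (mul_le_mul_of_nonneg_right ?_ (norm_nonneg _)).trans (hb ξ _).2.2.1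
    exact PiLp.norm_apply_le ξ j
  let p : Lp Z 2 (volume : Measure (Pt n)) × (Fin n → Lp Z 2 (volume : Measure (Pt n))) :=
    (fourier.symm (mZ.toLp _), fun j => fourier.symm ((mD j).toLp _))
  have hp : p ∈ sobolev n Z (S.b 0) := by
    rw [hZ.mem_sobolev_iff]
    intro j
    have e1 : fourier (p.2 j) = (mD j).toLp _ := fourier.apply_symm_apply _
    have e2 : fourier p.1 = mZ.toLp _ := fourier.apply_symm_apply _
    rw [e1, e2]
    filter_upwards [(mD j).coeFn_toLp, mZ.coeFn_toLp] with ξ h5 h6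
    rw [h5, h6]
  refine ⟨(⟨p, hp⟩, fourier.symm (mV.toLp _)), ?_⟩
  have e1 : fourier (fourier.symm (mV.toLp _)) = mV.toLp _ := fourier.apply_symm_apply _
  have e2 : fourier p.1 = mZ.toLp _ := fourier.apply_symm_apply _
  simp only [e1, e2]
  filter_upwards [mV.coeFn_toLp, mZ.coeFn_toLp] with ξ h5 h6
  rw [h5, h6]
  exact hR ξ _

theorem fourier_embed (m : S.FormDomain Vs Z) :
    fourier (S.embed Vs Z m : Lp 𝓗 2 (volume : Measure (Pt n))) =ᵐ[volume]
      fun ξ => S.ι ((fourier m.2 ξ : Vs) + (fourier m.1.1.1 ξ : Z)) := by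
  have e : fourier (S.embed Vs Z m : Lp 𝓗 2 (volume : Measure (Pt n))) =
      S.ι.compLp (fourier (S.value Vs Z m)) := by
    rw [← fourier_compLp]
    rfl
  rw [e]
  filter_upwards [S.ι.coeFn_compLp (fourier (S.value Vs Z m)), fourier_value m] with ξ h1 h2
  rw [h1, h2]

theorem embed_injective (hZ : S.IsDefect Vs Z) : Function.Injective (S.embed Vs Z) := by
  rw [injective_iff_map_eq_zero]
  intro m hm
  obtain ⟨κ, hκ, hb⟩ := hZ.exists_b_coercive
  refine formDomain_eq_zero hZ ?_
  have e := fourier_embed m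
  rw [hm, ZeroMemClass.coe_zero, map_zero] at e
  filter_upwards [e, Lp.coeFn_zero 𝓗 2 (volume : Measure (Pt n))] with ξ h1 h2
  rw [h1, Pi.zero_apply] at h2
  have h3 : ((fourier m.2 ξ : Vs) : H) + (fourier m.1.1.1 ξ : Z) = 0 :=
    S.ι_injective (h2.trans (map_zero _).symm)
  have h4 := hb _ (fourier m.2 ξ).2 _ (fourier m.1.1.1 ξ).2
  rw [h3, qf, map_zero, Complex.zero_re] at h4
  have h9 := nonpos_of_mul_nonpos_right h4 hκ
  exact (eq_zero_of_add_sq_nonpos h9).imp (fun h => Subtype.ext (norm_eq_zero.mp h))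
    fun h => Subtype.ext (norm_eq_zero.mp h)

theorem inner_embed (m : S.FormDomain Vs Z) (g : Lp 𝓗 2 (volume : Measure (Pt n))) :
    inner ℂ (S.embed Vs Z m : Lp 𝓗 2 (volume : Measure (Pt n))) g =
      ∫ ξ, S.d 0 (fourier g ξ) (S.ι ((fourier m.2 ξ : Vs) + (fourier m.1.1.1 ξ : Z))) := by
  rw [← fourier.inner_map_map, L2.inner_def]
  refine integral_congr_ae ?_
  filter_upwards [fourier_embed m] with ξ h
  rw [h, S.d_zero]

theorem Q_eq_inner_of_fibreSol (h1 : S.H1) (hZ : S.IsDefect Vs Z) {m : S.FormDomain Vs Z}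
    {g : Lp 𝓗 2 (volume : Measure (Pt n))}
    (h : ∀ᵐ ξ, S.IsFibreSol h1 a' a'' ξ (fourier g ξ) (fourier m.2 ξ) (fourier m.1.1.1 ξ))
    (m' : S.FormDomain Vs Z) :
    S.Q h1 a' a'' m m' =
      inner ℂ (S.embed Vs Z m' : Lp 𝓗 2 (volume : Measure (Pt n))) g := by
  rw [Q_eq_integral h1 hZ m m', inner_embed]
  refine integral_congr_ae ?_
  filter_upwards [h] with ξ hξ
  exact hξ _ _

theorem exists_form_solution (h1 : S.H1) (h2 : S.H2 Vs) (hZ : S.IsDefect Vs Z) (h3 : S.H3)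
    (h4 : S.H4 Vs Z a' a'') (f : S.LH0 Vs Z) :
    ∃ m, ∀ m', S.Q h1 a' a'' m m' = innerForm (S.LH0 Vs Z) f (S.embed Vs Z m') := by
  obtain ⟨m, hm⟩ := exists_formDomain_fibreSol h1 h2 hZ h3 h4
    (f : Lp 𝓗 2 (volume : Measure (Pt n)))
  exact ⟨m, fun m' => Q_eq_inner_of_fibreSol h1 hZ hm m'⟩

/-- Density of the form domain. If `f` is orthogonal to it, the form solution `m` with right-hand
side `f` satisfies `Q(m, m) = 0`, so `m = 0`. The fibre equations then say that the Fourier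
transform of `f` is orthogonal to `V_⋆ + Z` almost everywhere; as it takes values in the closure of
that space, it vanishes. -/
theorem eq_zero_of_inner_embed_eq_zero (h1 : S.H1) (h2 : S.H2 Vs) (hZ : S.IsDefect Vs Z)
    (h3 : S.H3) (h4 : S.H4 Vs Z a' a'') (f : S.LH0 Vs Z)
    (h : ∀ m, innerForm (S.LH0 Vs Z) f (S.embed Vs Z m) = 0) : f = 0 := by
  obtain ⟨m, hm⟩ := exists_formDomain_fibreSol h1 h2 hZ h3 h4
    (f : Lp 𝓗 2 (volume : Measure (Pt n)))
  have hm0 : m = 0 := Q_self_eq_zero h1 h2 hZ h3 h4 m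
    ((Q_eq_inner_of_fibreSol h1 hZ hm m).trans (h m))
  have : CompleteSpace (S.H0 Vs Z) :=
    (Submodule.isClosed_topologicalClosure _).completeSpace_coe
  have hf : ∀ᵐ ξ, fourier (f : Lp 𝓗 2 (volume : Measure (Pt n))) ξ ∈ S.H0 Vs Z :=
    fourier_mem_lpIn f.2
  have hzero : ∀ᵐ ξ, fourier (f : Lp 𝓗 2 (volume : Measure (Pt n))) ξ = 0 := by
    have z1 : ∀ᵐ ξ, fourier m.2 ξ = 0 := by
      rw [hm0, Prod.snd_zero, map_zero]
      exact Lp.coeFn_zero _ _ _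
    have z2 : ∀ᵐ ξ, fourier m.1.1.1 ξ = 0 := by
      rw [hm0, Prod.fst_zero, ZeroMemClass.coe_zero, Prod.fst_zero, map_zero]
      exact Lp.coeFn_zero _ _ _
    filter_upwards [hm, hf, z1, z2] with ξ e1 e2 e3 e4
    rw [e3, e4] at e1
    have e5 : ∀ x ∈ (Vs ⊔ Z).map S.ι.toLinearMap,
        inner ℂ x (fourier (f : Lp 𝓗 2 (volume : Measure (Pt n))) ξ) = 0 := by
      rintro - ⟨y, hy, rfl⟩
      obtain ⟨v, hv, z, hz, rfl⟩ := Submodule.mem_sup.mp hy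
      have e6 := e1 ⟨v, hv⟩ ⟨z, hz⟩
      rw [S.d_zero] at e6
      refine Eq.trans e6.symm ?_
      simp
    have e7 : fourier (f : Lp 𝓗 2 (volume : Measure (Pt n))) ξ ∈ (S.H0 Vs Z)ᗮ := by
      rw [Submodule.orthogonal_closure]
      exact (Submodule.mem_orthogonal _ _).mpr e5
    exact inner_self_eq_zero.mp ((Submodule.mem_orthogonal _ _).mp e7 _ e2)
  apply Subtype.ext
  apply fourier.injective
  rw [ZeroMemClass.coe_zero, map_zero]
  exact Lp.eq_zero_iff_ae_eq_zero.mpr hzero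

theorem bivariate_bijective (h1 : S.H1) (h2 : S.H2 Vs) (hZ : S.IsDefect Vs Z) (h3 : S.H3)
    (h4 : S.H4 Vs Z a' a'') : Function.Bijective (S.bivariate h1 a' a'') :=
  formOperator_bijective (embed_injective hZ) (eq_zero_of_inner_embed_eq_zero h1 h2 hZ h3 h4)
    (Q_self_eq_zero h1 h2 hZ h3 h4) (exists_form_solution h1 h2 hZ h3 h4)

theorem isSelfAdjoint_bivariate (h1 : S.H1) (h2 : S.H2 Vs) (hZ : S.IsDefect Vs Z) (h3 : S.H3)
    (h4 : S.H4 Vs Z a' a'') : IsSelfAdjoint (S.bivariate h1 a' a'') :=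
  isSelfAdjoint_formOperator (embed_injective hZ)
    (eq_zero_of_inner_embed_eq_zero h1 h2 hZ h3 h4) (Q_hermitian h1 h2 hZ h3 h4)
    (exists_form_solution h1 h2 hZ h3 h4)

/-- The resolvent of the bivariate operator acts fibrewise in Fourier variables. -/
theorem exists_opInv_bivariate (h1 : S.H1) (h2 : S.H2 Vs) (hZ : S.IsDefect Vs Z) (h3 : S.H3)
    (h4 : S.H4 Vs Z a' a'') (g : Lp 𝓗 2 (volume : Measure (Pt n))) :
    ∃ m : S.FormDomain Vs Z,
      (∀ᵐ ξ, S.IsFibreSol h1 a' a'' ξ (fourier g ξ) (fourier m.2 ξ) (fourier m.1.1.1 ξ)) ∧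
        opInv (S.bivariate h1 a' a'') (S.proj Vs Z g) = S.embed Vs Z m := by
  obtain ⟨m, hm⟩ := exists_formDomain_fibreSol h1 h2 hZ h3 h4 g
  refine ⟨m, hm, opInv_formOperator (B := S.Q h1 a' a'') (J := S.embed Vs Z)
    (d := innerForm (S.LH0 Vs Z)) (embed_injective hZ)
    (eq_zero_of_inner_embed_eq_zero h1 h2 hZ h3 h4) (Q_self_eq_zero h1 h2 hZ h3 h4) fun m' => ?_⟩
  -- The projection is invisible to test functions in `L²(ℝⁿ; 𝓗_0)`, so the unprojected `g` may
  -- serve as right-hand side of the fibre problems.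
  rw [Q_eq_inner_of_fibreSol h1 hZ hm m']
  exact (Submodule.inner_orthogonalProjectionOnto_eq_of_mem_left _ _).symm

end Setting

/-! ### The connecting operators -/

section Lp

variable {n : ℕ} {F : Type*} [NormedAddCommGroup F] [NormedSpace ℂ F] {Θ : Set (Pt n)}

theorem coeFn_extendZero (hΘ : MeasurableSet Θ)
    (f : Lp F 2 ((volume : Measure (Pt n)).restrict Θ)) :
    extendZero hΘ f =ᵐ[volume] Θ.indicator f :=
  (memLp_extendZero hΘ f).coeFn_toLp

theorem coeFn_mulIndicator (hΘ : MeasurableSet Θ) (f : Lp F 2 (volume : Measure (Pt n))) :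
    mulIndicator hΘ f =ᵐ[volume] Θ.indicator f :=
  ((Lp.memLp f).indicator hΘ).coeFn_toLp

theorem coeFn_restrictTo (f : Lp F 2 (volume : Measure (Pt n))) :
    restrictTo Θ f =ᵐ[(volume : Measure (Pt n)).restrict Θ] f :=
  LpToLpRestrictCLM_coeFn ℂ Θ f

theorem coeFn_fibrewise (hΘ : IsCompact Θ) {T : Pt n → F →L[ℂ] F} (hT : ContinuousOn T Θ)
    (f : Lp F 2 ((volume : Measure (Pt n)).restrict Θ)) :
    fibrewise hΘ hT f =ᵐ[(volume : Measure (Pt n)).restrict Θ] fun θ => T θ (f θ) :=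
  (memLp_fibrewise hΘ hT f).coeFn_toLp

theorem restrictTo_extendZero (hΘ : MeasurableSet Θ)
    (f : Lp F 2 ((volume : Measure (Pt n)).restrict Θ)) : restrictTo Θ (extendZero hΘ f) = f := by
  apply Lp.ext
  filter_upwards [coeFn_restrictTo (Θ := Θ) (extendZero hΘ f),
    ae_restrict_of_ae (coeFn_extendZero hΘ f), ae_restrict_mem hΘ] with θ h1 h2 h3
  rw [h1, h2, indicator_of_mem h3]

theorem extendZero_restrictTo (hΘ : MeasurableSet Θ) (f : Lp F 2 (volume : Measure (Pt n))) :
    extendZero hΘ (restrictTo Θ f) = mulIndicator hΘ f := by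
  apply Lp.ext
  filter_upwards [coeFn_extendZero hΘ (restrictTo Θ f), coeFn_mulIndicator hΘ f,
    (ae_restrict_iff' hΘ).mp (coeFn_restrictTo (Θ := Θ) f)] with θ h1 h2 h3
  rw [h1, h2]
  by_cases h : θ ∈ Θ
  · rw [indicator_of_mem h, indicator_of_mem h, h3 h]
  · rw [indicator_of_notMem h, indicator_of_notMem h]

end Lp

namespace Setting

variable {n : ℕ} {H 𝓗 : Type*} [NormedAddCommGroup H] [InnerProductSpace ℂ H]
  [NormedAddCommGroup 𝓗] [InnerProductSpace ℂ 𝓗] {S : Setting n H 𝓗}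
  {Vs Z : Submodule ℂ H} {a' : Fin n → Form ↥(Vs ⊔ Z) H}
  {a'' : Fin n → Fin n → Form ↥(Vs ⊔ Z) ↥(Vs ⊔ Z)}
  {e : Pt n → Vs →ₗ[ℂ] H} {E : Pt n → 𝓗 ≃L[ℂ] 𝓗} [CompleteSpace 𝓗]

/-- Up to the isometries `Γ_ε` and `𝓕`, the connecting operator is the fibrewise application
of `E_θ⁻¹`. -/
theorem fourier_dilation_connect (h6 : S.H6 Vs e E) {ε : ℝ} (hε : 0 < ε)
    (g : Lp 𝓗 2 ((volume : Measure (Pt n)).restrict S.Θ)) :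
    fourier (dilation hε (S.connect h6 hε g)) =
      extendZero S.isCompact.measurableSet (fibrewise S.isCompact h6.continuousOn_symm g) := by
  rw [connect, LinearIsometryEquiv.apply_symm_apply, LinearIsometryEquiv.apply_symm_apply]

/-- The dilation and the Fourier transform are unitary, extension by zero reduces the integral to
`Θ`, and there `E_θ` carries `d_0` into `d_θ`. -/
theorem inner_connect (h6 : S.H6 Vs e E) {ε : ℝ} (hε : 0 < ε)
    (g : Lp 𝓗 2 ((volume : Measure (Pt n)).restrict S.Θ))
    (f : Lp 𝓗 2 (volume : Measure (Pt n))) :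
    inner ℂ (S.connect h6 hε g) f = ∫ θ in S.Θ, S.d θ (S.connectAdj h6 hε f θ) (g θ) := by
  have hΘ := S.isCompact.measurableSet
  rw [← (dilation hε).inner_map_map, ← fourier.inner_map_map, fourier_dilation_connect,
    L2.inner_def]
  set F := fourier (dilation hε f) with hF
  have e1 : (fun θ => inner ℂ (extendZero hΘ (fibrewise S.isCompact h6.continuousOn_symm g) θ)
      (F θ)) =ᵐ[volume] S.Θ.indicator fun θ =>
        inner ℂ (fibrewise S.isCompact h6.continuousOn_symm g θ) (F θ) := by
    filter_upwards [coeFn_extendZero hΘ (fibrewise S.isCompact h6.continuousOn_symm g)] with θ h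
    rw [h]
    by_cases hθ : θ ∈ S.Θ
    · rw [indicator_of_mem hθ, indicator_of_mem hθ]
    · rw [indicator_of_notMem hθ, indicator_of_notMem hθ, inner_zero_left]
  rw [integral_congr_ae e1, integral_indicator hΘ]
  refine integral_congr_ae ?_
  filter_upwards [coeFn_fibrewise S.isCompact h6.continuousOn_symm g,
    coeFn_fibrewise S.isCompact h6.continuousOn (restrictTo S.Θ F), coeFn_restrictTo (Θ := S.Θ) F,
    ae_restrict_mem hΘ] with θ h1 h2 h3 hθ
  rw [connectAdj, ← hF, h1, h2, h3, ← S.d_zero, ← h6.2.1 θ hθ]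
  exact congrArg (S.d θ (E θ (F θ))) ((E θ).apply_symm_apply _)

theorem connectAdj_connect (h6 : S.H6 Vs e E) {ε : ℝ} (hε : 0 < ε)
    (g : Lp 𝓗 2 ((volume : Measure (Pt n)).restrict S.Θ)) :
    S.connectAdj h6 hε (S.connect h6 hε g) = g := by
  rw [connectAdj, fourier_dilation_connect, restrictTo_extendZero]
  apply Lp.ext
  filter_upwards [coeFn_fibrewise S.isCompact h6.continuousOn
    (fibrewise S.isCompact h6.continuousOn_symm g),
    coeFn_fibrewise S.isCompact h6.continuousOn_symm g] with θ h1 h2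
  rw [h1, h2]
  exact (E θ).apply_symm_apply _

theorem norm_connect_sq (h6 : S.H6 Vs e E) {ε : ℝ} (hε : 0 < ε)
    (g : Lp 𝓗 2 ((volume : Measure (Pt n)).restrict S.Θ)) :
    ‖S.connect h6 hε g‖ ^ 2 = ∫ θ in S.Θ, qf (S.d θ) (g θ) := by
  have h := inner_connect h6 hε g (S.connect h6 hε g)
  rw [connectAdj_connect] at h
  rw [← Complex.ofReal_inj, ← integral_complex_ofReal]
  push_cast
  refine (inner_self_eq_norm_sq_to_K (𝕜 := ℂ) _).symm.trans (h.trans ?_)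
  refine integral_congr_ae ?_
  filter_upwards [ae_restrict_mem S.isCompact.measurableSet] with θ hθ
  exact Complex.ext rfl (S.d_nonneg θ hθ _).1

theorem connect_connectAdj (h6 : S.H6 Vs e E) {ε : ℝ} (hε : 0 < ε)
    (f : Lp 𝓗 2 (volume : Measure (Pt n))) :
    S.connect h6 hε (S.connectAdj h6 hε f) =
      (dilation hε).symm (fourier.symm
        (mulIndicator S.isCompact.measurableSet (fourier (dilation hε f)))) := by
  have h : fibrewise S.isCompact h6.continuousOn_symm (S.connectAdj h6 hε f) =
      restrictTo S.Θ (fourier (dilation hε f)) := by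
    apply Lp.ext
    filter_upwards [coeFn_fibrewise S.isCompact h6.continuousOn_symm (S.connectAdj h6 hε f),
      coeFn_fibrewise S.isCompact h6.continuousOn (restrictTo S.Θ (fourier (dilation hε f)))]
      with θ h1 h2
    rw [h1, connectAdj, h2]
    exact (E θ).symm_apply_apply _
  rw [connect, h, extendZero_restrictTo]

theorem fourier_symm_dilation {ε : ℝ} (hε : 0 < ε) (f : Lp 𝓗 2 (volume : Measure (Pt n))) :
    fourier.symm (dilation hε f) = (dilation hε).symm (fourier.symm f) := by
  apply fourier.injective
  rw [LinearIsometryEquiv.apply_symm_apply, dilation_symm, fourier_dilation,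
    LinearIsometryEquiv.apply_symm_apply]
  exact ((dilation (inv_pos.mpr hε)).symm_apply_eq.mpr ((dilation hε).symm_apply_apply f).symm).symm

theorem connect_connectAdj_eq_fourier_symm (h6 : S.H6 Vs e E) {ε : ℝ} (hε : 0 < ε)
    (f : Lp 𝓗 2 (volume : Measure (Pt n))) :
    S.connect h6 hε (S.connectAdj h6 hε f) =
      fourier.symm (dilation hε
        (mulIndicator S.isCompact.measurableSet ((dilation hε).symm (fourier f)))) := by
  rw [connect_connectAdj, fourier_symm_dilation, fourier_dilation]

/-- Together with `connectAdj_ae_eq` this matches the fibre `θ` with the frequency `θ/ε`. The same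
factor `ε^{-n/2}` occurs in both and is harmless by linearity. -/
theorem symm_apply_ae_eq (h6 : S.H6 Vs e E) {ε : ℝ} (hε : 0 < ε)
    (g : Lp 𝓗 2 ((volume : Measure (Pt n)).restrict S.Θ)) :
    ∀ᵐ θ ∂((volume : Measure (Pt n)).restrict S.Θ), (E θ).symm (g θ) =
      (((ε⁻¹) ^ ((n : ℝ) / 2) : ℝ) : ℂ) • fourier (S.connect h6 hε g) (ε⁻¹ • θ) := by
  have hΘ := S.isCompact.measurableSet
  have hA := fourier_dilation_connect h6 hε g
  rw [fourier_dilation, dilation_symm] at hA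
  have h0 := coeFn_dilation (inv_pos.mpr hε) (fourier (S.connect h6 hε g))
  rw [hA] at h0
  filter_upwards [ae_restrict_of_ae h0, ae_restrict_of_ae (coeFn_extendZero hΘ
    (fibrewise S.isCompact h6.continuousOn_symm g)),
    coeFn_fibrewise S.isCompact h6.continuousOn_symm g, ae_restrict_mem hΘ] with θ e1 e2 e3 hθ
  rw [Complex.coe_smul, ← e1, e2, indicator_of_mem hθ, e3]
  rfl

theorem connectAdj_ae_eq (h6 : S.H6 Vs e E) {ε : ℝ} (hε : 0 < ε)
    (f : Lp 𝓗 2 (volume : Measure (Pt n))) :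
    ∀ᵐ θ ∂((volume : Measure (Pt n)).restrict S.Θ), S.connectAdj h6 hε f θ =
      E θ ((((ε⁻¹) ^ ((n : ℝ) / 2) : ℝ) : ℂ) • fourier f (ε⁻¹ • θ)) := by
  have h0 := coeFn_dilation (inv_pos.mpr hε) (fourier f)
  rw [← dilation_symm hε, ← fourier_dilation] at h0
  filter_upwards [ae_restrict_of_ae h0,
    coeFn_fibrewise S.isCompact h6.continuousOn (restrictTo S.Θ (fourier (dilation hε f))),
    coeFn_restrictTo (Θ := S.Θ) (fourier (dilation hε f))] with θ e1 e2 e3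
  rw [Complex.coe_smul, ← e1, ← e3]
  exact e2

end Setting

/-! ### The resolvent estimate -/

namespace Setting

variable {n : ℕ} {H 𝓗 : Type*} [NormedAddCommGroup H] [InnerProductSpace ℂ H]
  [NormedAddCommGroup 𝓗] [InnerProductSpace ℂ 𝓗] {S : Setting n H 𝓗}
  {Vs Z : Submodule ℂ H} {a' : Fin n → Form ↥(Vs ⊔ Z) H}
  {a'' : Fin n → Fin n → Form ↥(Vs ⊔ Z) ↥(Vs ⊔ Z)}
  {e : Pt n → Vs →ₗ[ℂ] H} {E : Pt n → 𝓗 ≃L[ℂ] 𝓗} [CompleteSpace H]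

theorem IsFibreSol.smul {h1 : S.H1} {ξ : Pt n} {f : 𝓗} {v : Vs} {z : Z}
    (h : S.IsFibreSol h1 a' a'' ξ f v z) (c : ℂ) :
    S.IsFibreSol h1 a' a'' ξ (c • f) (c • v) (c • z) := fun v' z' => by
  rw [Submodule.coe_smul, Submodule.coe_smul, ← smul_add]
  simp only [map_smul, smul_apply, smul_eq_mul]
  rw [← mul_add, h v' z']

variable [CompleteSpace 𝓗]

/-- The limit operator sandwiched between the connecting operators acts fibrewise. -/
theorem exists_fibreSol_connectAdj (h1 : S.H1) (h2 : S.H2 Vs) (hZ : S.IsDefect Vs Z) (h3 : S.H3)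
    (h4 : S.H4 Vs Z a' a'') (h6 : S.H6 Vs e E) {ε : ℝ} (hε : 0 < ε)
    (g : Lp 𝓗 2 ((volume : Measure (Pt n)).restrict S.Θ)) :
    ∀ᵐ θ ∂((volume : Measure (Pt n)).restrict S.Θ), ∃ (v : Vs) (z : Z),
      S.IsFibreSol h1 a' a'' (ε⁻¹ • θ) ((E θ).symm (g θ)) v z ∧
        S.connectAdj h6 hε
          ((opInv (S.bivariate h1 a' a'') (S.proj Vs Z (S.connect h6 hε g)) : S.LH0 Vs Z) :
            Lp 𝓗 2 (volume : Measure (Pt n))) θ = E θ (S.ι ((v : H) + z)) := by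
  have : CompleteSpace Vs := h2.1.completeSpace_coe
  have : CompleteSpace Z := hZ.1.completeSpace_coe
  obtain ⟨m, hm, hinv⟩ := exists_opInv_bivariate h1 h2 hZ h3 h4 (S.connect h6 hε g)
  have hε' := inv_pos.mpr hε
  rw [hinv]
  filter_upwards [ae_restrict_of_ae (ae_dilate hε' hm),
    ae_restrict_of_ae (ae_dilate hε' (fourier_embed m)), symm_apply_ae_eq h6 hε g,
    connectAdj_ae_eq h6 hε (S.embed Vs Z m)] with θ e1 e2 e3 e4
  set c : ℂ := (((ε⁻¹) ^ ((n : ℝ) / 2) : ℝ) : ℂ)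
  -- The solution at frequency `θ/ε`, scaled by the factor common to `A_ε` and `A_ε^*`.
  refine ⟨c • fourier m.2 (ε⁻¹ • θ), c • fourier m.1.1.1 (ε⁻¹ • θ), ?_, ?_⟩
  · rw [e3]
    exact e1.smul c
  · rw [e4, e2, ← map_smul S.ι, smul_add]
    rfl

theorem exists_resolvent_estimate (hn : 1 ≤ n) (h1 : S.H1) (h2 : S.H2 Vs) (hZ : S.IsDefect Vs Z)
    (h3 : S.H3) (h4 : S.H4 Vs Z a' a'') (h5 : S.H5) (he : S.IsTransfer Vs Z e)
    (h6 : S.H6 Vs e E) :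
    ∃ C : ℝ, ∀ (ε : ℝ) (hε : 0 < ε), ε < 1 →
      ∀ g : Lp 𝓗 2 ((volume : Measure (Pt n)).restrict S.Θ),
      ∀ᵐ θ ∂((volume : Measure (Pt n)).restrict S.Θ),
        √(qf (S.d θ) (opInv (S.fibreOp ε θ) (g θ) -
          S.connectAdj h6 hε
            ((opInv (S.bivariate h1 a' a'') (S.proj Vs Z (S.connect h6 hε g)) : S.LH0 Vs Z) :
              Lp 𝓗 2 (volume : Measure (Pt n))) θ))
          ≤ C * ε * √(qf (S.d θ) (g θ)) := by
  obtain ⟨C, hC, hest⟩ := exists_fibre_estimate h1 h2 hZ h3 h4 h5 he h6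
  obtain ⟨D, hD, hd⟩ := S.exists_sqrt_qf_d_le
  obtain ⟨K, hK, hk⟩ := S.norm_sq_le
  have : Nonempty (Fin n) := ⟨⟨0, hn⟩⟩
  -- The fibre estimate excludes `θ = 0`, a null set because `n ≥ 1`.
  have hne : ∀ᵐ θ ∂((volume : Measure (Pt n)).restrict S.Θ), θ ≠ 0 :=
    ae_restrict_of_ae (Measure.ae_ne volume 0)
  refine ⟨D * C * K, fun ε hε hε1 g => ?_⟩
  filter_upwards [exists_fibreSol_connectAdj h1 h2 hZ h3 h4 h6 hε g, hne,
    ae_restrict_mem S.isCompact.measurableSet] with θ ⟨v, z, hs, hc⟩ h0 hθ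
  obtain ⟨u, hu⟩ := exists_energy_solution hθ hε hε1 (g θ)
  rw [hc, opInv_fibreOp hθ hε hε1 hu]
  calc _ ≤ D * ‖S.ι u - E θ (S.ι ((v : H) + z))‖ := hd θ hθ _
    _ ≤ D * (C * ε * ‖g θ‖) :=
      mul_le_mul_of_nonneg_left (hest θ hθ h0 ε hε hε1 _ _ _ _ hu hs) hD
    _ ≤ D * (C * ε * (K * √(qf (S.d θ) (g θ)))) := by
      gcongr
      exact hk θ hθ _
    _ = _ := by ring

end Setting

end Bivariate

theorem mainTheorem2 {n : ℕ} (hn : 1 ≤ n)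
    {H 𝓗 : Type*} [NormedAddCommGroup H] [InnerProductSpace ℂ H] [CompleteSpace H]
    [TopologicalSpace.SeparableSpace H] [NormedAddCommGroup 𝓗] [InnerProductSpace ℂ 𝓗]
    [CompleteSpace 𝓗] [TopologicalSpace.SeparableSpace 𝓗]
    (S : Setting n H 𝓗) (h1 : S.H1)
    (Vs Z : Submodule ℂ H) (h2 : S.H2 Vs) (hZ : S.IsDefect Vs Z) (h3 : S.H3)
    (a' : Fin n → Form ↥(Vs ⊔ Z) H) (a'' : Fin n → Fin n → Form ↥(Vs ⊔ Z) ↥(Vs ⊔ Z))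
    (h4 : S.H4 Vs Z a' a'') (h5 : S.H5)
    (e : Pt n → Vs →ₗ[ℂ] H) (he : S.IsTransfer Vs Z e)
    (E : Pt n → 𝓗 ≃L[ℂ] 𝓗) (h6 : S.H6 Vs e E) :
    -- the inverses below are those of operators which are bijective on their domains
    (∀ ε, 0 < ε → ε < 1 → ∀ θ ∈ S.Θ, Function.Bijective (S.fibreOp ε θ)) ∧
    IsSelfAdjoint (S.bivariate h1 a' a'') ∧
    Function.Bijective (S.bivariate h1 a' a'') ∧
    -- the resolvent estimate
    (∃ C : ℝ, ∀ (ε : ℝ) (hε : 0 < ε), ε < 1 →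
      ∀ g : Lp 𝓗 2 ((volume : Measure (Pt n)).restrict S.Θ),
      ∀ᵐ θ ∂((volume : Measure (Pt n)).restrict S.Θ),
        √(qf (S.d θ) (opInv (S.fibreOp ε θ) (g θ) -
          S.connectAdj h6 hε
            ((opInv (S.bivariate h1 a' a'') (S.proj Vs Z (S.connect h6 hε g)) : S.LH0 Vs Z) :
              Lp 𝓗 2 (volume : Measure (Pt n))) θ))
          ≤ C * ε * √(qf (S.d θ) (g θ))) ∧
    ∀ (ε : ℝ) (hε : 0 < ε), ε < 1 →
      -- `connectAdj` is the adjoint of `connect`, for the inner product `∫ d_θ dθ` on `L²(Θ; 𝓗)`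
      (∀ (g : Lp 𝓗 2 ((volume : Measure (Pt n)).restrict S.Θ))
        (f : Lp 𝓗 2 (volume : Measure (Pt n))),
        inner ℂ (S.connect h6 hε g) f =
          ∫ θ in S.Θ, S.d θ (S.connectAdj h6 hε f θ) (g θ)) ∧
      -- `connect` is an isometry
      (∀ g : Lp 𝓗 2 ((volume : Measure (Pt n)).restrict S.Θ),
        ‖S.connect h6 hε g‖ ^ 2 = ∫ θ in S.Θ, qf (S.d θ) (g θ)) ∧
      (∀ g, S.connectAdj h6 hε (S.connect h6 hε g) = g) ∧
      (∀ f, S.connect h6 hε (S.connectAdj h6 hε f) =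
        (dilation hε).symm (fourier.symm
          (mulIndicator S.isCompact.measurableSet (fourier (dilation hε f))))) ∧
      (∀ f, S.connect h6 hε (S.connectAdj h6 hε f) =
        fourier.symm (dilation hε
          (mulIndicator S.isCompact.measurableSet ((dilation hε).symm (fourier f))))) := by
  have : CompleteSpace Vs := h2.1.completeSpace_coe
  have : CompleteSpace Z := hZ.1.completeSpace_coe
  refine ⟨fun ε hε hε1 θ hθ => Setting.fibreOp_bijective hθ hε hε1,
    Setting.isSelfAdjoint_bivariate h1 h2 hZ h3 h4, Setting.bivariate_bijective h1 h2 hZ h3 h4,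
    Setting.exists_resolvent_estimate hn h1 h2 hZ h3 h4 h5 he h6, fun ε hε hε1 => ?_⟩
  exact ⟨Setting.inner_connect h6 hε, Setting.norm_connect_sq h6 hε,
    Setting.connectAdj_connect h6 hε, Setting.connect_connectAdj h6 hε,
    Setting.connect_connectAdj_eq_fourier_symm h6 hε⟩
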